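/- Let $\Omega\subset\mathbb R^2\cong\mathbb C$ be the open unit disc, let $\mu>1/2$, and let $a\in C^{1,\mu}(\overline\Omega)$ (complex-valued; in particular, real-valued), extended by zero outside $\overline\Omega$. For $z\in\Omega$ and $\boldsymbol\theta=(\cos\theta,\sin\theta)$, $\boldsymbol\theta^\perp=(-\sin\theta,\cos\theta)$, put $$h(z,\boldsymbol\theta)=\int_0^\infty a(z+t\boldsymbol\theta)\,dt-\tfrac12\,(I-\mathrm iH)\,Ra(z\cdot\boldsymbol\theta^\perp,\boldsymbol\theta^\perp),$$ where $Ra(s,\boldsymbol\theta^\perp)=\int_{-\infty}^{\infty}a(s\boldsymbol\theta^\perp+t\boldsymbol\theta)\,dt$ and $H\psi(s)=\frac1\pi\,\mathrm{p.v.}\!\int_{-\infty}^{\infty}\frac{\psi(t)}{s-t}\,dt$ is the Hilbert transform in the variable $s$. For $k\ge 0$ let $$\alpha_k(z)=\frac1{2\pi}\int_0^{2\pi}e^{-h(z,\boldsymbol\theta)}e^{-\mathrm ik\theta}\,d\theta,\qquad \beta_k(z)=\frac1{2\pi}\int_0^{2\pi}e^{h(z,\boldsymbol\theta)}e^{-\mathrm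 ik\theta}\,d\theta .$$ For sequences ${\bf u}=\langle u_0,u_{-1},u_{-2},\dots\rangle$ of complex-valued functions on $\Omega$ let $L{\bf u}=\langle u_{-1},u_{-2},\dots\rangle$ and $$e^{-G}{\bf u}=\sum_{k=0}^\infty\alpha_kL^k{\bf u},\qquad e^{G}{\bf u}=\sum_{k=0}^\infty\beta_kL^k{\bf u}.$$ Let $\overline\partial=\frac12(\partial_{x_1}+\mathrm i\partial_{x_2})$ and $\partial=\frac12(\partial_{x_1}-\mathrm i\partial_{x_2})$, acting componentwise in the weak sense, and let $l^2(\mathbb N;X)$ be the space of sequences in $X$ with $\sum_{j\ge0}\|u_{-j}\|_X^2<\infty$. Equations below hold componentwise almost everywhere in $\Omega$. (i) If ${\bf u}\in l^2(\mathbb N;H^1(\Omega))$ solves $\overline\partial{\bf u}+L^2\partial{\bf u}+aL{\bf u}={\bf w}$, then the series defining $e^{-G}{\bf u}$ and $e^{-G}{\bf w}$ converge absolutely almost everywhere in $\Omega$, and ${\bf v}=e^{-G}{\bf u}$ belongs to $l^2(\mathbb N;H^1(\Omega))$ and solves $\overline\partial{\bf v}+L^2\partial{\bf v}=e^{-G}{\bf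 w}$. (ii) Conversely, let ${\bf w}\in l^2(\mathbb N;L^2(\Omega))$. If ${\bf v}\in l^2(\mathbb N;H^1(\Omega))$ solves $\overline\partial{\bf v}+L^2\partial{\bf v}=e^{-G}{\bf w}$, then the series defining $e^{-G}{\bf w}$ and $e^{G}{\bf v}$ converge absolutely almost everywhere in $\Omega$, and ${\bf u}=e^{G}{\bf v}$ belongs to $l^2(\mathbb N;H^1(\Omega))$ and solves $\overline\partial{\bf u}+L^2\partial{\bf u}+aL{\bf u}={\bf w}$. -/

import Mathlib

open MeasureTheory Set Filter Topology

noncomputable section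

namespace BukhgeimBeltrami

/-! The plane is identified with `ℂ`. Sequences `⟨u₀, u₋₁, u₋₂, …⟩` of functions on the unit
disc `Ω` are written `u : ℕ → ℂ → ℂ`, where `u n` stands for `u₋ₙ`; only the values on `Ω`
matter, up to Lebesgue-null sets. -/

/-- The open unit disc `Ω`. -/
def disc : Set ℂ := Metric.ball 0 1

/-- Lebesgue measure on `Ω`. -/
def discMeasure : Measure ℂ := volume.restrict disc

/-! ### Function spaces -/

/-- `a ∈ C^{1,μ}(Ω̄)`: `a` is continuous on the closed disc and differentiable (over `ℝ`) in `Ω`,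
and its derivative is Hölder continuous with exponent `μ` in `Ω`; the derivative then extends to
a Hölder continuous (hence bounded) function on the closed disc. -/
structure IsC1Holder (μ : ℝ) (a : ℂ → ℂ) : Prop where
  continuousOn : ContinuousOn a (closure disc)
  differentiableOn : DifferentiableOn ℝ a disc
  holder : ∃ C : ℝ, ∀ x ∈ disc, ∀ y ∈ disc,
    ‖fderiv ℝ a x - fderiv ℝ a y‖ ≤ C * ‖x - y‖ ^ μ

/-- `g` is the weak derivative of `f` in `Ω` in the direction `e`. -/
def HasWeakPartial (e : ℂ) (f g : ℂ → ℂ) : Prop :=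
  LocallyIntegrableOn f disc ∧ LocallyIntegrableOn g disc ∧
    ∀ φ : ℂ → ℝ, ContDiff ℝ (⊤ : ℕ∞) φ → HasCompactSupport φ → tsupport φ ⊆ disc →
      ∫ z in disc, (fderiv ℝ φ z e) • f z = -∫ z in disc, φ z • g z

open Classical in
/-- The weak derivative of `f` in `Ω` in the direction `e` (unique up to null sets when it exists,
and `0` by convention when it does not). -/
def weakPartial (e : ℂ) (f : ℂ → ℂ) : ℂ → ℂ :=
  if h : ∃ g, HasWeakPartial e f g then h.choose else 0

/-- `∂̄ = (∂_{x₁} + i ∂_{x₂}) / 2`, in the weak sense. -/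
def dbar (f : ℂ → ℂ) (z : ℂ) : ℂ :=
  (1 / 2) * (weakPartial 1 f z + Complex.I * weakPartial Complex.I f z)

/-- `∂ = (∂_{x₁} - i ∂_{x₂}) / 2`, in the weak sense. -/
def del (f : ℂ → ℂ) (z : ℂ) : ℂ :=
  (1 / 2) * (weakPartial 1 f z - Complex.I * weakPartial Complex.I f z)

/-- `f ∈ H¹(Ω)`. -/
def MemH1 (f : ℂ → ℂ) : Prop :=
  MemLp f 2 discMeasure ∧
    (∃ g, HasWeakPartial 1 f g ∧ MemLp g 2 discMeasure) ∧
    (∃ g, HasWeakPartial Complex.I f g ∧ MemLp g 2 discMeasure)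

/-- The square of the `H¹(Ω)` norm. -/
def h1NormSq (f : ℂ → ℂ) : ENNReal :=
  ∫⁻ z, (‖f z‖ₑ ^ 2 + ‖weakPartial 1 f z‖ₑ ^ 2 + ‖weakPartial Complex.I f z‖ₑ ^ 2) ∂discMeasure

/-- `u ∈ l²(ℕ; H¹(Ω))`. -/
def Meml2H1 (u : ℕ → ℂ → ℂ) : Prop :=
  (∀ n, MemH1 (u n)) ∧ ∑' n, h1NormSq (u n) < ⊤

/-- `w ∈ l²(ℕ; L²(Ω))`. -/
def Meml2L2 (w : ℕ → ℂ → ℂ) : Prop :=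
  (∀ n, MemLp (w n) 2 discMeasure) ∧ ∑' n, ∫⁻ z, ‖w n z‖ₑ ^ 2 ∂discMeasure < ⊤

/-! ### The integrating factor -/

/-- The direction `θ = (cos φ, sin φ)`. -/
def dir (φ : ℝ) : ℂ := Complex.exp (φ * Complex.I)

/-- The direction `θ^⊥ = (-sin φ, cos φ)`. -/
def dirPerp (φ : ℝ) : ℂ := Complex.I * dir φ

/-- The extension of `a` by zero outside the closed disc. -/
def extendZero (a : ℂ → ℂ) : ℂ → ℂ := (closure disc).indicator a

/-- The ray integral `∫_0^∞ a(z + tθ) dt`. -/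
def rayIntegral (a : ℂ → ℂ) (z : ℂ) (φ : ℝ) : ℂ :=
  ∫ t in Ioi (0 : ℝ), extendZero a (z + t * dir φ)

/-- The Radon transform `Ra(s, θ^⊥) = ∫ a(s θ^⊥ + t θ) dt`. -/
def radon (a : ℂ → ℂ) (φ : ℝ) (s : ℝ) : ℂ :=
  ∫ t : ℝ, extendZero a (s * dirPerp φ + t * dir φ)

/-- The Hilbert transform `Hψ(s) = (1/π) p.v. ∫ ψ(t) / (s - t) dt`. -/
def hilbert (ψ : ℝ → ℂ) (s : ℝ) : ℂ :=
  (1 / (Real.pi : ℂ)) * limUnder (𝓝[>] (0 : ℝ))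
    (fun ε : ℝ => ∫ t in {t : ℝ | ε < |s - t|}, ψ t / ((s - t : ℝ) : ℂ))

/-- The function
`h(z, θ) = ∫_0^∞ a(z + tθ) dt - (1/2) (I - iH) Ra(z · θ^⊥, θ^⊥)`. -/
def finchH (a : ℂ → ℂ) (z : ℂ) (φ : ℝ) : ℂ :=
  rayIntegral a z φ - (1 / 2) *
    (radon a φ (inner ℝ z (dirPerp φ)) -
      Complex.I * hilbert (radon a φ) (inner ℝ z (dirPerp φ)))

/-- The `k`-th Fourier coefficient `(1/2π) ∫_0^{2π} F(φ) e^{-ikφ} dφ`. -/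
def fourierMode (F : ℝ → ℂ) (k : ℕ) : ℂ :=
  (1 / (2 * (Real.pi : ℂ))) *
    ∫ φ in (0 : ℝ)..(2 * Real.pi), F φ * Complex.exp (-(k * φ * Complex.I))

/-- `α_k(z)`, the Fourier modes of `e^{-h(z, ·)}`. -/
def alpha (a : ℂ → ℂ) (k : ℕ) (z : ℂ) : ℂ :=
  fourierMode (fun φ => Complex.exp (-finchH a z φ)) k

/-- `β_k(z)`, the Fourier modes of `e^{h(z, ·)}`. -/
def beta (a : ℂ → ℂ) (k : ℕ) (z : ℂ) : ℂ :=
  fourierMode (fun φ => Complex.exp (finchH a z φ)) k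

/-! ### The operators and the equations -/

/-- The left translation `L⟨u₀, u₋₁, u₋₂, …⟩ = ⟨u₋₁, u₋₂, …⟩`. -/
def shift (u : ℕ → ℂ → ℂ) : ℕ → ℂ → ℂ := fun n => u (n + 1)

/-- The convolution `γ ∗ u = ∑_k γ_k L^k u`, evaluated pointwise. -/
def conv (γ u : ℕ → ℂ → ℂ) : ℕ → ℂ → ℂ :=
  fun n z => ∑' k, γ k z * (shift^[k] u) n z

/-- The series defining `γ ∗ u` converges (absolutely) almost everywhere in `Ω`. -/
def ConvConverges (γ u : ℕ → ℂ → ℂ) : Prop :=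
  ∀ n, ∀ᵐ z ∂discMeasure, Summable fun k => γ k z * (shift^[k] u) n z

/-- `e^{-G} u = ∑_k α_k L^k u`. -/
def expNegG (a : ℂ → ℂ) (u : ℕ → ℂ → ℂ) : ℕ → ℂ → ℂ := conv (alpha a) u

/-- `e^{G} u = ∑_k β_k L^k u`. -/
def expG (a : ℂ → ℂ) (u : ℕ → ℂ → ℂ) : ℕ → ℂ → ℂ := conv (beta a) u

/-- `u` solves `∂̄u + L²∂u + aLu = w` in `Ω`: equality of all components, almost everywhere
(`∂` acts componentwise). Used for `u ∈ l²(ℕ; H¹(Ω))`, where the weak derivatives exist. -/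
def SolvesAttenuated (a : ℂ → ℂ) (u w : ℕ → ℂ → ℂ) : Prop :=
  ∀ n, ∀ᵐ z ∂discMeasure,
    dbar (u n) z + (shift^[2] fun m => del (u m)) n z + a z * shift u n z = w n z

/-- `v` solves `∂̄v + L²∂v = w` in `Ω`. -/
def SolvesBeltrami (v w : ℕ → ℂ → ℂ) : Prop :=
  ∀ n, ∀ᵐ z ∂discMeasure,
    dbar (v n) z + (shift^[2] fun m => del (v m)) n z = w n z

end BukhgeimBeltrami

end

/-! Read a sequence as the one-sided Fourier series Σ u_{-n} e^{-inθ}. Up to discarding positive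
modes, L is multiplication by ξ = e^{iθ} and ∂̄ + L²∂ is e^{iθ} θ·∇. Since θ·∇h = -a, the factor
e^{-h} is the classical integrating factor of θ·∇ + a. It yields an operator in nonnegative powers
of L because h has no negative Fourier modes.

The natural home of such operators is the Banach algebra ℓ¹(ℕ) with the Cauchy product (`Wiener`),
which acts on bounded sequences by x ↦ Σ x_k L^k (`Wiener.mul_act`). The task is to show that z ↦
h(z,·) is a C¹ map from Ω into this algebra, bounded together with its derivative.

Analyticity. The ray integral minus half the Radon transform is a function q that is odd under θ →
-θ. In polar coordinates around z the principal value becomes the integral of q(φ+ω) - q(φ-ω)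
against 1/sin ω. On odd modes this multiplies q_k by iπ sgn k, while the even modes of q vanish.
Hence h = 2 Σ_{k≥0} q_k ξ^k (`HolderData.hasSum_finchH`).

Smoothness. q is Lipschitz in θ and its z-gradient is ν-Hölder in θ, uniformly in z. The uniformity
up to ∂Ω, where a need not vanish, comes from a cancellation: the derivative of the half chord σ is
singular like 1/σ, but it multiplies a difference of endpoint values of a, which is O(σ)
(`HolderData.hasFDerivAt_qOdd`). Bernstein's theorem (`modeZ_tail`), which needs an exponent above
1/2, turns this into ℓ¹ bounds with uniform tails, so the series of h may be differentiated termwise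
(`HolderData.hasFDerivAt_expoW`).

Conclusion. Exponentials are taken in the algebra. Evaluation on the unit circle is injective, so
α_k and β_k are the coefficients of e^{-h} and e^{h}, and the transport equation becomes (∂̄ +
ξ²∂)e^{ch} = -c a ξ e^{ch} (`HolderData.exists_intFactor`). The product rule for weak derivatives
and Young's inequality ℓ¹ ∗ ℓ² ⊂ ℓ² carry this to l²(ℕ; H¹(Ω)) (`IntFactor.act_meml2H1`). The value
c = -1 gives (i); c = 1 and e^{h}e^{-h} = 1 give (ii). -/

noncomputable section

namespace BukhgeimBeltrami

section

/-! ### The analytic Wiener algebra -/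

/-- The analytic Wiener algebra `ℓ¹(ℕ)`; its product is the Cauchy product. -/
def Wiener : Type := lp (fun _ : ℕ => ℂ) 1

namespace Wiener

instance : NormedAddCommGroup Wiener := inferInstanceAs (NormedAddCommGroup (lp (fun _ : ℕ => ℂ) 1))
instance : NormedSpace ℂ Wiener := inferInstanceAs (NormedSpace ℂ (lp (fun _ : ℕ => ℂ) 1))
instance : CompleteSpace Wiener := inferInstanceAs (CompleteSpace (lp (fun _ : ℕ => ℂ) 1))

/-- The `k`-th coefficient. -/
def coeff (x : Wiener) (k : ℕ) : ℂ := (show lp (fun _ : ℕ => ℂ) 1 from x) k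

@[ext] lemma ext {x y : Wiener} (h : ∀ k, x.coeff k = y.coeff k) : x = y :=
  lp.ext (funext h)

@[simp] lemma coeff_zero (k : ℕ) : (0 : Wiener).coeff k = 0 := rfl
@[simp] lemma coeff_add (x y : Wiener) (k : ℕ) : (x + y).coeff k = x.coeff k + y.coeff k := rfl
@[simp] lemma coeff_sub (x y : Wiener) (k : ℕ) : (x - y).coeff k = x.coeff k - y.coeff k := rfl
@[simp] lemma coeff_smul (c : ℂ) (x : Wiener) (k : ℕ) : (c • x).coeff k = c * x.coeff k := rfl

lemma memlp_one_iff {f : ℕ → ℂ} : Memℓp f 1 ↔ Summable fun k => ‖f k‖ := by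
  rw [memℓp_gen_iff (by simp)]; simp

lemma hasSum_norm (x : Wiener) : HasSum (fun k => ‖x.coeff k‖) ‖x‖ := by
  have := lp.hasSum_norm (p := 1) (by simp) (show lp (fun _ : ℕ => ℂ) 1 from x)
  simp only [ENNReal.toReal_one, Real.rpow_one] at this
  exact this

lemma summable_norm (x : Wiener) : Summable fun k => ‖x.coeff k‖ := (hasSum_norm x).summable

lemma norm_eq (x : Wiener) : ‖x‖ = ∑' k, ‖x.coeff k‖ := (hasSum_norm x).tsum_eq.symm

lemma norm_coeff_le (x : Wiener) (k : ℕ) : ‖x.coeff k‖ ≤ ‖x‖ :=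
  le_hasSum (hasSum_norm x) k fun _ _ => norm_nonneg _

/-- The element with a given summable sequence of coefficients. -/
def mk (f : ℕ → ℂ) (hf : Summable fun k => ‖f k‖) : Wiener :=
  (⟨f, memlp_one_iff.2 hf⟩ : lp (fun _ : ℕ => ℂ) 1)

@[simp] lemma coeff_mk (f : ℕ → ℂ) (hf) (k : ℕ) : (mk f hf).coeff k = f k := rfl

/-- The formal power series of an element. -/
def toPS (x : Wiener) : PowerSeries ℂ := PowerSeries.mk x.coeff

lemma coeff_toPS (x : Wiener) (k : ℕ) : PowerSeries.coeff k x.toPS = x.coeff k :=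
  PowerSeries.coeff_mk _ _

/-- This embedding lets the ring axioms of the Cauchy product be inherited from formal power series.
-/
lemma toPS_injective : Function.Injective toPS := fun x y h => by
  ext k; rw [← coeff_toPS, h, coeff_toPS]

lemma summable_antidiagonal (x y : Wiener) :
    Summable fun n => ‖∑ p ∈ Finset.HasAntidiagonal.antidiagonal n, x.coeff p.1 * y.coeff p.2‖ :=
  summable_norm_sum_mul_antidiagonal_of_summable_norm x.summable_norm y.summable_norm

/-- The monomial `c ξ^k`. -/
def monomial (k : ℕ) (c : ℂ) : Wiener :=
  mk (Pi.single k c) (summable_of_hasFiniteSupport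
    ((finite_singleton k).subset fun i hi => by
      by_contra h; simp [Pi.single_apply, show i ≠ k from h] at hi))

lemma coeff_monomial (k : ℕ) (c : ℂ) (j : ℕ) :
    (monomial k c).coeff j = if j = k then c else 0 := by
  simp [monomial, Pi.single_apply]

instance : Mul Wiener := ⟨fun x y =>
  mk (fun n => ∑ p ∈ Finset.HasAntidiagonal.antidiagonal n, x.coeff p.1 * y.coeff p.2) (summable_antidiagonal x y)⟩

instance : One Wiener := ⟨monomial 0 1⟩

lemma coeff_mul (x y : Wiener) (n : ℕ) :
    (x * y).coeff n = ∑ p ∈ Finset.HasAntidiagonal.antidiagonal n, x.coeff p.1 * y.coeff p.2 := rfl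

lemma coeff_one (k : ℕ) : (1 : Wiener).coeff k = if k = 0 then 1 else 0 := coeff_monomial 0 1 k

lemma toPS_mul (x y : Wiener) : (x * y).toPS = x.toPS * y.toPS := by
  ext n; simp [coeff_toPS, PowerSeries.coeff_mul, coeff_mul]

lemma toPS_one : (1 : Wiener).toPS = 1 := by
  ext n; simp [coeff_toPS, PowerSeries.coeff_one, coeff_one]

lemma toPS_add (x y : Wiener) : (x + y).toPS = x.toPS + y.toPS := by
  ext n; simp [coeff_toPS]

lemma toPS_zero : (0 : Wiener).toPS = 0 := by
  ext n; simp [coeff_toPS]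

instance : NormedCommRing Wiener :=
  { (inferInstance : NormedAddCommGroup Wiener) with
    left_distrib := fun x y z => toPS_injective (by simp only [toPS_mul, toPS_add, mul_add])
    right_distrib := fun x y z => toPS_injective (by simp only [toPS_mul, toPS_add, add_mul])
    zero_mul := fun x => toPS_injective (by simp only [toPS_mul, toPS_zero, zero_mul])
    mul_zero := fun x => toPS_injective (by simp only [toPS_mul, toPS_zero, mul_zero])
    mul_assoc := fun x y z => toPS_injective (by simp only [toPS_mul, mul_assoc])
    one_mul := fun x => toPS_injective (by simp only [toPS_mul, toPS_one, one_mul])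
    mul_one := fun x => toPS_injective (by simp only [toPS_mul, toPS_one, mul_one])
    mul_comm := fun x y => toPS_injective (by simp only [toPS_mul, mul_comm])
    norm_mul_le := fun x y => by
      rw [norm_eq x, norm_eq y, tsum_mul_tsum_eq_tsum_sum_antidiagonal_of_summable_norm
        x.summable_norm.norm y.summable_norm.norm, norm_eq]
      refine Summable.tsum_le_tsum (fun n => ?_) (summable_norm _)
        (summable_norm_sum_mul_antidiagonal_of_summable_norm x.summable_norm.norm
          y.summable_norm.norm).of_norm
      rw [coeff_mul]
      exact (norm_sum_le _ _).trans (Finset.sum_le_sum fun p _ => norm_mul_le _ _) }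

instance : NormOneClass Wiener := ⟨by
  rw [norm_eq, tsum_eq_single 0] <;> simp +contextual [coeff_one]⟩

instance : NormedAlgebra ℂ Wiener :=
  { (inferInstance : NormedSpace ℂ Wiener), Algebra.ofModule (R := ℂ) (A := Wiener)
      (fun r x y => by ext n; simp [coeff_mul, Finset.mul_sum, mul_assoc])
      (fun r x y => by
        ext n; simp only [coeff_mul, coeff_smul, Finset.mul_sum]
        exact Finset.sum_congr rfl fun _ _ => by ring) with
    norm_smul_le := fun r x => norm_smul_le r x }

instance : NormedAlgebra ℚ Wiener := NormedAlgebra.restrictScalars ℚ ℂ Wiener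

/-- The `k`-th coefficient as a continuous linear functional. -/
def coeffL (k : ℕ) : Wiener →L[ℂ] ℂ :=
  LinearMap.mkContinuous ⟨⟨fun x => x.coeff k, fun _ _ => rfl⟩, fun _ _ => rfl⟩ 1
    fun x => by rw [one_mul]; exact norm_coeff_le x k

/-- The generator `ξ`. -/
def gen : Wiener := monomial 1 1

lemma coeff_gen_mul_zero (x : Wiener) : (gen * x).coeff 0 = 0 := by
  simp [coeff_mul, gen, coeff_monomial]

lemma coeff_gen_mul_succ (x : Wiener) (k : ℕ) : (gen * x).coeff (k + 1) = x.coeff k := by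
  rw [coeff_mul, Finset.sum_eq_single (1, k)]
  · simp [gen, coeff_monomial]
  · rintro ⟨i, j⟩ h1 h2
    rw [Finset.HasAntidiagonal.mem_antidiagonal] at h1
    have : i ≠ 1 := by rintro rfl; apply h2; ext <;> simp at * ; omega
    simp [gen, coeff_monomial, this]
  · intro h; exact absurd (Finset.HasAntidiagonal.mem_antidiagonal.2 (by ring)) h

lemma norm_dir_pow (φ : ℝ) (k : ℕ) : ‖dir φ ^ k‖ = 1 := by
  simp [dir, Complex.norm_exp]

lemma summable_eval (φ : ℝ) (x : Wiener) : Summable fun k => ‖x.coeff k * dir φ ^ k‖ := by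
  simpa only [norm_mul, norm_dir_pow, mul_one] using x.summable_norm

/-- Evaluation at the point `e^{iφ}` of the unit circle. -/
def ev (φ : ℝ) : Wiener →ₐ[ℂ] ℂ :=
  AlgHom.ofLinearMap
    { toFun := fun x => ∑' k, x.coeff k * dir φ ^ k
      map_add' := fun x y => by
        rw [← Summable.tsum_add (summable_eval φ x).of_norm (summable_eval φ y).of_norm]
        exact tsum_congr fun k => by simp [add_mul]
      map_smul' := fun c x => by
        rw [RingHom.id_apply, smul_eq_mul, ← tsum_mul_left]
        exact tsum_congr fun k => by simp [mul_assoc] }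
    (by
      change ∑' k, (1 : Wiener).coeff k * dir φ ^ k = 1
      rw [tsum_eq_single 0] <;> simp +contextual [coeff_one])
    (fun x y => by
      change ∑' k, (x * y).coeff k * dir φ ^ k =
        (∑' k, x.coeff k * dir φ ^ k) * ∑' k, y.coeff k * dir φ ^ k
      rw [tsum_mul_tsum_eq_tsum_sum_antidiagonal_of_summable_norm (summable_eval φ x)
        (summable_eval φ y)]
      refine tsum_congr fun n => ?_
      rw [coeff_mul, Finset.sum_mul]
      refine Finset.sum_congr rfl fun p hp => ?_
      rw [← Finset.HasAntidiagonal.mem_antidiagonal.1 hp]; ring)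

lemma ev_apply (φ : ℝ) (x : Wiener) : ev φ x = ∑' k, x.coeff k * dir φ ^ k := rfl

lemma norm_ev_le (φ : ℝ) (x : Wiener) : ‖ev φ x‖ ≤ ‖x‖ := by
  rw [ev_apply, norm_eq]
  refine (norm_tsum_le_tsum_norm (summable_eval φ x)).trans (le_of_eq ?_)
  exact tsum_congr fun k => by rw [norm_mul, norm_dir_pow, mul_one]

/-- Evaluation at `e^{iφ}` as a continuous linear functional. -/
def evL (φ : ℝ) : Wiener →L[ℂ] ℂ :=
  (ev φ).toLinearMap.mkContinuous 1 fun x => by simpa using norm_ev_le φ x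

lemma ev_gen (φ : ℝ) : ev φ gen = dir φ := by
  rw [ev_apply, tsum_eq_single 1] <;> simp +contextual [gen, coeff_monomial]

/-- A continuous algebra homomorphism commutes with the exponential series. This links e^{±h} taken
in the algebra to the pointwise exponentials that define α_k and β_k. -/
lemma ev_exp (φ : ℝ) (x : Wiener) : ev φ (NormedSpace.exp x) = Complex.exp (ev φ x) := by
  rw [Complex.exp_eq_exp_ℂ]
  exact NormedSpace.map_exp (ev φ) (evL φ).continuous x

lemma integral_dir_pow (j k : ℕ) :
    ∫ φ in (0 : ℝ)..(2 * Real.pi), dir φ ^ j * Complex.exp (-(k * φ * Complex.I)) =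
      if j = k then 2 * (Real.pi : ℂ) else 0 := by
  have h : ∀ φ : ℝ, dir φ ^ j * Complex.exp (-(k * φ * Complex.I)) =
      Complex.exp ((((j : ℤ) - k : ℤ) * Complex.I) * φ) := fun φ => by
    rw [dir, ← Complex.exp_nat_mul, ← Complex.exp_add]; congr 1; push_cast; ring
  simp_rw [h]
  split_ifs with hjk
  · simp [hjk]
  · have hc : (((j : ℤ) - k : ℤ) * Complex.I : ℂ) ≠ 0 := by
      have : ((j : ℤ) - k : ℤ) ≠ 0 := by omega
      exact mul_ne_zero (by exact_mod_cast this) Complex.I_ne_zero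
    rw [integral_exp_mul_complex hc]
    have : ((((j : ℤ) - k : ℤ) * Complex.I) * ((2 * Real.pi : ℝ) : ℂ) : ℂ) =
      ((j : ℤ) - k : ℤ) * (2 * Real.pi * Complex.I) := by push_cast; ring
    rw [this, Complex.exp_int_mul_two_pi_mul_I]; simp

lemma dir_continuous : Continuous dir := by unfold dir; fun_prop

lemma hasSum_ev (φ : ℝ) (x : Wiener) : HasSum (fun k => x.coeff k * dir φ ^ k) (ev φ x) :=
  (summable_eval φ x).of_norm.hasSum

/-- The coefficients of `x` are the Fourier modes of its symbol. -/
lemma fourierMode_ev (x : Wiener) (k : ℕ) : fourierMode (fun φ => ev φ x) k = x.coeff k := by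
  have hs : HasSum (fun j : ℕ => ∫ φ in (0 : ℝ)..(2 * Real.pi),
      x.coeff j * dir φ ^ j * Complex.exp (-(k * φ * Complex.I)))
      (∫ φ in (0 : ℝ)..(2 * Real.pi), ev φ x * Complex.exp (-(k * φ * Complex.I))) := by
    refine intervalIntegral.hasSum_integral_of_dominated_convergence
      (fun j _ => ‖x.coeff j‖) (fun j => ?_) (fun j => ?_) ?_ ?_ ?_
    · exact (Continuous.aestronglyMeasurable (by
        have := dir_continuous
        fun_prop))
    · refine Eventually.of_forall fun φ _ => le_of_eq ?_
      rw [norm_mul, norm_mul, norm_dir_pow, Complex.norm_exp]; simp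
    · exact Eventually.of_forall fun φ _ => x.summable_norm
    · exact intervalIntegrable_const
    · exact Eventually.of_forall fun φ _ => (hasSum_ev φ x).mul_right _
  rw [fourierMode, ← hs.tsum_eq]
  have hj : ∀ j, ∫ φ in (0 : ℝ)..(2 * Real.pi),
      x.coeff j * dir φ ^ j * Complex.exp (-(k * φ * Complex.I)) =
        x.coeff j * if j = k then 2 * (Real.pi : ℂ) else 0 := fun j => by
    rw [← integral_dir_pow, ← intervalIntegral.integral_const_mul]
    exact intervalIntegral.integral_congr fun φ _ => mul_assoc _ _ _
  simp_rw [hj]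
  rw [tsum_eq_single k]
  · rw [if_pos rfl]; field_simp [Real.pi_ne_zero]
  · intro j hj; simp [hj]

/-- Coefficients are Fourier modes of the symbol, so identities in the algebra may be checked
pointwise on the unit circle. -/
lemma ext_ev {x y : Wiener} (h : ∀ φ, ev φ x = ev φ y) : x = y := by
  ext k; rw [← fourierMode_ev, ← fourierMode_ev, funext h]

end Wiener

end

section

/-! ### Fourier modes and Bernstein's theorem -/

/-- Fourier modes with integer index. -/
def modeZ (F : ℝ → ℂ) (k : ℤ) : ℂ :=
  (1 / (2 * (Real.pi : ℂ))) *
    ∫ φ in (0 : ℝ)..(2 * Real.pi), F φ * Complex.exp (-(k * φ * Complex.I))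

lemma modeZ_eq_fourierCoeffOn (F : ℝ → ℂ) (k : ℤ) :
    modeZ F k = fourierCoeffOn Real.two_pi_pos F k := by
  rw [fourierCoeffOn_eq_integral, modeZ, sub_zero, Complex.real_smul]
  push_cast
  congr 1
  refine intervalIntegral.integral_congr fun φ _ => ?_
  simp only [fourier_coe_apply, smul_eq_mul]
  rw [mul_comm]
  congr 2
  push_cast
  have : (Real.pi : ℂ) ≠ 0 := by exact_mod_cast Real.pi_ne_zero
  field_simp

lemma hasSum_sq_modeZ {F : ℝ → ℂ} (hF : Continuous F) :
    HasSum (fun k => ‖modeZ F k‖ ^ 2)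
      ((2 * Real.pi)⁻¹ * ∫ x in (0 : ℝ)..(2 * Real.pi), ‖F x‖ ^ 2) := by
  have h2 : MemLp F 2 (volume.restrict (Ioc 0 (2 * Real.pi))) := by
    obtain ⟨C, hC⟩ := isCompact_Icc.exists_bound_of_continuousOn
      (hF.continuousOn (s := Icc 0 (2 * Real.pi)))
    exact MemLp.of_bound hF.aestronglyMeasurable C
      ((ae_restrict_iff' measurableSet_Ioc).2 (ae_of_all _ fun x hx => hC x (Ioc_subset_Icc_self hx)))
  have := hasSum_sq_fourierCoeffOn Real.two_pi_pos h2
  simp_rw [modeZ_eq_fourierCoeffOn]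
  simpa using this

lemma exp_periodic_mode (k : ℤ) :
    Function.Periodic (fun φ : ℝ => Complex.exp (-(k * φ * Complex.I))) (2 * Real.pi) := fun φ => by
  have : -((k : ℂ) * ((φ + 2 * Real.pi : ℝ) : ℂ) * Complex.I) =
      -(k * φ * Complex.I) + (-k : ℤ) * (2 * Real.pi * Complex.I) := by push_cast; ring
  simp only [this, Complex.exp_add, Complex.exp_int_mul_two_pi_mul_I, mul_one]

lemma modeZ_shift {F : ℝ → ℂ} (hp : Function.Periodic F (2 * Real.pi)) (η : ℝ) (k : ℤ) :
    modeZ (fun x => F (x + η)) k = Complex.exp (k * η * Complex.I) * modeZ F k := by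
  have hper : Function.Periodic (fun φ : ℝ => F φ * Complex.exp (-(k * φ * Complex.I)))
      (2 * Real.pi) := hp.mul (exp_periodic_mode k)
  have h1 : ∫ φ in (0 : ℝ)..(2 * Real.pi), F (φ + η) * Complex.exp (-(k * φ * Complex.I)) =
      Complex.exp (k * η * Complex.I) *
        ∫ φ in (0 : ℝ)..(2 * Real.pi),
          F (φ + η) * Complex.exp (-(k * (φ + η : ℝ) * Complex.I)) := by
    rw [← intervalIntegral.integral_const_mul]
    refine intervalIntegral.integral_congr fun φ _ => ?_
    rw [mul_left_comm, ← Complex.exp_add]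
    congr 2; push_cast; ring
  rw [modeZ, modeZ, h1, mul_left_comm, intervalIntegral.integral_comp_add_right
    (fun φ : ℝ => F φ * Complex.exp (-(k * φ * Complex.I)))]
  have h2 := hper.intervalIntegral_add_eq η 0
  rw [zero_add] at h2
  rw [zero_add, add_comm, h2]

lemma modeZ_neg_index {F : ℝ → ℂ} (hp : Function.Periodic F (2 * Real.pi)) (k : ℤ) :
    modeZ F (-k) = modeZ (fun x => F (-x)) k := by
  have hper : Function.Periodic (fun φ : ℝ => F φ * Complex.exp (-((-k : ℤ) * φ * Complex.I)))
      (2 * Real.pi) := hp.mul (exp_periodic_mode (-k))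
  have h1 := intervalIntegral.integral_comp_neg (a := 0) (b := 2 * Real.pi)
    (fun φ : ℝ => F φ * Complex.exp (-((-k : ℤ) * φ * Complex.I)))
  have h2 := hper.intervalIntegral_add_eq (-(2 * Real.pi)) 0
  rw [neg_add_cancel, zero_add] at h2
  rw [modeZ, modeZ, ← h2, ← neg_zero, ← h1]
  simp

lemma modeZ_sub {F G : ℝ → ℂ} (hF : Continuous F) (hG : Continuous G) (k : ℤ) :
    modeZ (fun x => F x - G x) k = modeZ F k - modeZ G k := by
  simp only [modeZ, sub_mul]
  rw [intervalIntegral.integral_sub, mul_sub]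
  all_goals exact Continuous.intervalIntegrable (by fun_prop) _ _

lemma norm_exp_sub_one_sq (x : ℝ) (h1 : Real.pi / 2 ≤ x) (h2 : x ≤ Real.pi) :
    1 ≤ ‖Complex.exp (x * Complex.I) - 1‖ ^ 2 := by
  have hc : Real.cos x ≤ 0 := Real.cos_nonpos_of_pi_div_two_le_of_le h1 (by linarith [Real.pi_pos])
  rw [Complex.sq_norm, Complex.normSq_apply, Complex.sub_re, Complex.sub_im,
    Complex.exp_ofReal_mul_I_re, Complex.exp_ofReal_mul_I_im]
  simp only [Complex.one_re, Complex.one_im, sub_zero]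
  nlinarith [Real.sin_sq_add_cos_sq x]

/-- Parseval for F(·+η) - F, whose modes are (e^{ikη} - 1) times those of F and whose sup norm is
controlled by the Hölder condition. -/
lemma modeZ_block_sq {F : ℝ → ℂ} (hF : Continuous F) (hp : Function.Periodic F (2 * Real.pi))
    {C μ : ℝ} (hH : ∀ x y, ‖F x - F y‖ ≤ C * |x - y| ^ μ) (j : ℕ) :
    ∑ k ∈ Finset.Ico (2 ^ j) (2 ^ (j + 1)), ‖modeZ F (k : ℕ)‖ ^ 2 ≤
      (C * (Real.pi / 2 / 2 ^ j) ^ μ) ^ 2 := by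
  -- This shift puts kη in [π/2, π] throughout the dyadic block, where |e^{ikη} - 1| ≥ 1.
  set η : ℝ := Real.pi / 2 / 2 ^ j with hη
  have hη0 : 0 < η := by positivity
  have hcont : Continuous fun x => F (x + η) := by fun_prop
  have hs := hasSum_sq_modeZ (hcont.sub hF)
  have hint : ((2 * Real.pi)⁻¹ * ∫ x in (0 : ℝ)..(2 * Real.pi), ‖F (x + η) - F x‖ ^ 2) ≤
      (C * η ^ μ) ^ 2 := by
    have h1 : ∫ x in (0 : ℝ)..(2 * Real.pi), ‖F (x + η) - F x‖ ^ 2 ≤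
        ∫ x in (0 : ℝ)..(2 * Real.pi), (C * η ^ μ) ^ 2 := by
      refine intervalIntegral.integral_mono_on Real.two_pi_pos.le
        (Continuous.intervalIntegrable (by fun_prop) _ _) intervalIntegrable_const fun x _ => ?_
      have := hH (x + η) x
      rw [add_sub_cancel_left, abs_of_pos hη0] at this
      gcongr
    rw [intervalIntegral.integral_const, sub_zero, smul_eq_mul] at h1
    rw [inv_mul_le_iff₀ Real.two_pi_pos]
    exact h1
  refine le_trans ?_ hint
  have hle := sum_le_hasSum ((Finset.Ico (2 ^ j) (2 ^ (j + 1))).map Nat.castEmbedding)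
    (fun i _ => by positivity) hs
  rw [Finset.sum_map] at hle
  refine le_trans (Finset.sum_le_sum fun k hk => ?_) hle
  rw [Finset.mem_Ico] at hk
  change ‖modeZ F (k : ℕ)‖ ^ 2 ≤ ‖modeZ (fun x => F (x + η) - F x) ((k : ℕ) : ℤ)‖ ^ 2
  rw [modeZ_sub hcont hF, modeZ_shift hp, ← sub_one_mul, norm_mul, mul_pow]
  have hk1 : (2 : ℝ) ^ j ≤ k := by exact_mod_cast hk.1
  have hk2 : (k : ℝ) ≤ 2 ^ (j + 1) := by exact_mod_cast hk.2.le
  have := norm_exp_sub_one_sq (k * η)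
    (by rw [hη]; rw [mul_div_assoc', le_div_iff₀ (by positivity), mul_comm]; gcongr)
    (by
      rw [hη, mul_div_assoc', div_le_iff₀ (by positivity)]
      rw [pow_succ] at hk2
      nlinarith [Real.pi_pos])
  push_cast at this ⊢
  exact le_mul_of_one_le_left (by positivity) this

/-- Cauchy–Schwarz over 2^j indices costs 2^{j/2}, while the square bound gains 2^{-jμ}. The ratio
2^{1/2-μ} is where the threshold 1/2 comes from. -/
lemma modeZ_block {F : ℝ → ℂ} (hF : Continuous F) (hp : Function.Periodic F (2 * Real.pi))
    {C μ : ℝ} (hC : 0 ≤ C) (hH : ∀ x y, ‖F x - F y‖ ≤ C * |x - y| ^ μ) (j : ℕ) :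
    ∑ k ∈ Finset.Ico (2 ^ j) (2 ^ (j + 1)), ‖modeZ F (k : ℕ)‖ ≤
      C * (Real.pi / 2) ^ μ * ((2 : ℝ) ^ (1 / 2 - μ)) ^ j := by
  have h1 := sq_sum_le_card_mul_sum_sq (s := Finset.Ico (2 ^ j) (2 ^ (j + 1)))
    (f := fun k : ℕ => ‖modeZ F (k : ℕ)‖)
  have hcard : ((Finset.Ico (2 ^ j) (2 ^ (j + 1))).card : ℝ) = 2 ^ j := by
    rw [Nat.card_Ico, pow_succ, mul_two, Nat.add_sub_cancel]; push_cast; rfl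
  rw [hcard] at h1
  have h2 := h1.trans (mul_le_mul_of_nonneg_left (modeZ_block_sq hF hp hH j) (by positivity))
  refine abs_le_of_sq_le_sq' ?_ (by positivity) |>.2
  refine h2.trans (le_of_eq ?_)
  rw [Real.div_rpow (by positivity) (by positivity)]
  have e1 : ((2 : ℝ) ^ j) ^ μ = ((2 : ℝ) ^ μ) ^ j := by
    rw [← Real.rpow_natCast, ← Real.rpow_natCast, ← Real.rpow_mul (by norm_num), ← Real.rpow_mul (by norm_num), mul_comm]
  have e2 : ((2 : ℝ) ^ (1 / 2 - μ)) ^ j = ((2 : ℝ) ^ (1 / 2 : ℝ)) ^ j / ((2 : ℝ) ^ μ) ^ j := by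
    rw [Real.rpow_sub (by norm_num), div_pow]
  have e3 : (((2 : ℝ) ^ (1 / 2 : ℝ)) ^ j) ^ 2 = 2 ^ j := by
    rw [← pow_mul, mul_comm, pow_mul, ← Real.sqrt_eq_rpow, Real.sq_sqrt (by norm_num)]
  rw [e1, e2]
  calc _ = (((2 : ℝ) ^ (1 / 2 : ℝ)) ^ j) ^ 2 *
        (C * ((Real.pi / 2) ^ μ / ((2 : ℝ) ^ μ) ^ j)) ^ 2 := by rw [e3]
    _ = _ := by ring

/-- **Bernstein's theorem**: the Fourier series of a Hölder continuous function of exponent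
`μ > 1/2` converges absolutely, with tails controlled by the Hölder constant. -/
theorem modeZ_tail {F : ℝ → ℂ} (hF : Continuous F) (hp : Function.Periodic F (2 * Real.pi))
    {C μ : ℝ} (hμ : 1 / 2 < μ) (hC : 0 ≤ C) (hH : ∀ x y, ‖F x - F y‖ ≤ C * |x - y| ^ μ) (j : ℕ)
    (s : Finset ℕ) (hs : ∀ k ∈ s, 2 ^ j ≤ k) :
    ∑ k ∈ s, ‖modeZ F (k : ℕ)‖ ≤
      C * ((Real.pi / 2) ^ μ * ((2 : ℝ) ^ (1 / 2 - μ)) ^ j / (1 - (2 : ℝ) ^ (1 / 2 - μ))) := by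
  set ρ : ℝ := (2 : ℝ) ^ (1 / 2 - μ) with hρ
  have hρ1 : ρ < 1 := Real.rpow_lt_one_of_one_lt_of_neg (by norm_num) (by linarith)
  have hρ0 : 0 < ρ := by positivity
  -- Consecutive dyadic blocks are dominated by a geometric series of ratio ρ < 1.
  have key : ∀ n : ℕ, ∑ k ∈ Finset.Ico (2 ^ j) (2 ^ (j + n)), ‖modeZ F (k : ℕ)‖ ≤
      C * (Real.pi / 2) ^ μ * ρ ^ j * ∑ i ∈ Finset.range n, ρ ^ i := by
    intro n
    induction n with
    | zero => simp
    | succ n ih =>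
      rw [← Finset.sum_Ico_consecutive _ (n := 2 ^ (j + n))
        (Nat.pow_le_pow_right (by norm_num) (by omega))
        (Nat.pow_le_pow_right (by norm_num) (by omega)), Finset.sum_range_succ, mul_add]
      refine add_le_add ih ?_
      have := modeZ_block hF hp hC hH (j + n)
      rw [← hρ, pow_add ρ] at this
      rw [mul_assoc _ (ρ ^ j)]
      exact this
  obtain ⟨n, hn⟩ : ∃ n : ℕ, ∀ k ∈ s, k < 2 ^ (j + n) := by
    refine ⟨s.sup id, fun k hk => ?_⟩
    calc k ≤ s.sup id := Finset.le_sup (f := id) hk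
      _ < 2 ^ (s.sup id) := Nat.lt_two_pow_self
      _ ≤ _ := Nat.pow_le_pow_right (by norm_num) (by omega)
  have hsub : s ⊆ Finset.Ico (2 ^ j) (2 ^ (j + n)) := fun k hk =>
    Finset.mem_Ico.2 ⟨hs k hk, hn k hk⟩
  refine (Finset.sum_le_sum_of_subset_of_nonneg hsub fun _ _ _ => norm_nonneg _).trans
    ((key n).trans ?_)
  have hg : ∑ i ∈ Finset.range n, ρ ^ i ≤ (1 - ρ)⁻¹ := by
    rw [← tsum_geometric_of_lt_one hρ0.le hρ1]
    exact (summable_geometric_of_lt_one hρ0.le hρ1).sum_le_tsum _ fun _ _ => by positivity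
  calc _ ≤ C * (Real.pi / 2) ^ μ * ρ ^ j * (1 - ρ)⁻¹ := by gcongr
    _ = _ := by rw [div_eq_mul_inv]; ring

end

section

/-! ### The attenuation -/

/-- Quantitative form of `a ∈ C^{1,ν}(Ω̄)`. -/
structure HolderData (ν K : ℝ) (a : ℂ → ℂ) : Prop where
  half_lt : 1 / 2 < ν
  le_one : ν ≤ 1
  nonneg : 0 ≤ K
  continuousOn : ContinuousOn a (Metric.closedBall 0 1)
  hasFDerivAt : ∀ x ∈ disc, HasFDerivAt a (fderiv ℝ a x) x
  norm_fderiv_le : ∀ x ∈ disc, ‖fderiv ℝ a x‖ ≤ K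
  holder : ∀ x ∈ disc, ∀ y ∈ disc, ‖fderiv ℝ a x - fderiv ℝ a y‖ ≤ K * ‖x - y‖ ^ ν
  lipschitz : ∀ x ∈ Metric.closedBall (0 : ℂ) 1, ∀ y ∈ Metric.closedBall (0 : ℂ) 1,
    ‖a x - a y‖ ≤ K * ‖x - y‖
  norm_le : ∀ x ∈ Metric.closedBall (0 : ℂ) 1, ‖a x‖ ≤ K

lemma closure_disc : closure disc = Metric.closedBall (0 : ℂ) 1 :=
  closure_ball 0 one_ne_zero

lemma isOpen_disc : IsOpen disc := Metric.isOpen_ball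

lemma mem_disc {z : ℂ} : z ∈ disc ↔ ‖z‖ < 1 := by simp [disc]

lemma disc_subset : disc ⊆ Metric.closedBall (0 : ℂ) 1 := Metric.ball_subset_closedBall

lemma IsC1Holder.exists_holderData {μ : ℝ} (hμ : 1 / 2 < μ) {a : ℂ → ℂ} (ha : IsC1Holder μ a) :
    ∃ ν K, HolderData ν K a := by
  obtain ⟨C, hC⟩ := ha.holder
  have hcont : ContinuousOn a (Metric.closedBall 0 1) := closure_disc ▸ ha.continuousOn
  obtain ⟨A, hA⟩ := (isCompact_closedBall (0 : ℂ) 1).exists_bound_of_continuousOn hcont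
  -- The exponent is lowered to min μ 1, so that Lipschitz quantities also count as Hölder of that
  -- exponent. The factor 2^μ pays for this, Ω having diameter 2.
  set C₁ := max C 0 * 2 ^ μ with hC₁
  have hC₁0 : 0 ≤ C₁ := by positivity
  have h0 : (0 : ℂ) ∈ disc := by simp [mem_disc]
  have hC2 : ∀ x ∈ disc, ∀ y ∈ disc,
      ‖fderiv ℝ a x - fderiv ℝ a y‖ ≤ C₁ * ‖x - y‖ ^ min μ 1 := by
    intro x hx y hy
    rcases eq_or_ne x y with rfl | hxy
    · simp; positivity
    have hpos : 0 < ‖x - y‖ := norm_pos_iff.2 (sub_ne_zero.2 hxy)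
    have hle : ‖x - y‖ ≤ 2 := by
      rw [mem_disc] at hx hy
      linarith [norm_sub_le x y]
    refine (hC x hx y hy).trans ((mul_le_mul_of_nonneg_right (le_max_left C 0)
      (by positivity)).trans ?_)
    rw [hC₁, mul_assoc]
    refine mul_le_mul_of_nonneg_left ?_ (le_max_right _ _)
    have h1 : ‖x - y‖ ^ μ = ‖x - y‖ ^ (μ - min μ 1) * ‖x - y‖ ^ min μ 1 := by
      rw [← Real.rpow_add hpos]; ring_nf
    rw [h1]
    refine mul_le_mul_of_nonneg_right ?_ (by positivity)
    have h2 : 0 ≤ μ - min μ 1 := by linarith [min_le_left μ 1]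
    refine (Real.rpow_le_rpow hpos.le hle h2).trans ?_
    exact Real.rpow_le_rpow_of_exponent_le (by norm_num)
      (by have : 0 ≤ min μ 1 := le_min (by linarith) (by norm_num)
          linarith)
  set K₁ := ‖fderiv ℝ a 0‖ + C₁ with hK₁
  have hbd : ∀ x ∈ disc, ‖fderiv ℝ a x‖ ≤ K₁ := by
    intro x hx
    have h1 := hC2 x hx 0 h0
    have h2 : ‖x - 0‖ ^ min μ 1 ≤ 1 := by
      rw [sub_zero]
      exact Real.rpow_le_one (norm_nonneg _) (mem_disc.1 hx).le (le_min (by linarith) (by norm_num))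
    have h3 := norm_le_norm_add_norm_sub' (fderiv ℝ a x) (fderiv ℝ a 0)
    have h4 : C₁ * ‖x - 0‖ ^ min μ 1 ≤ C₁ := mul_le_of_le_one_right hC₁0 h2
    linarith
  have hlip : ∀ x ∈ Metric.closedBall (0 : ℂ) 1, ∀ y ∈ Metric.closedBall (0 : ℂ) 1,
      ‖a x - a y‖ ≤ K₁ * ‖x - y‖ := by
    have hL : LipschitzOnWith K₁.toNNReal a disc := by
      refine (convex_ball (0 : ℂ) 1).lipschitzOnWith_of_nnnorm_fderiv_le (𝕜 := ℝ)
        (fun x hx => (ha.differentiableOn x hx).differentiableAt (isOpen_disc.mem_nhds hx))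
        fun x hx => ?_
      rw [← NNReal.coe_le_coe, coe_nnnorm, Real.coe_toNNReal _ (by positivity)]
      exact hbd x hx
    have hL2 := hL.closure ha.continuousOn
    intro x hx y hy
    rw [← closure_disc] at hx hy
    have := hL2.dist_le_mul x hx y hy
    rwa [dist_eq_norm, dist_eq_norm, Real.coe_toNNReal _ (by positivity)] at this
  have hA0 : 0 ≤ A := (norm_nonneg _).trans (hA 0 (by simp))
  have hK : K₁ ≤ K₁ + A := by linarith
  refine ⟨min μ 1, K₁ + A, lt_min hμ (by norm_num), min_le_right _ _, by positivity, hcont,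
    fun x hx => (ha.differentiableOn.differentiableAt (isOpen_disc.mem_nhds hx)).hasFDerivAt,
    fun x hx => (hbd x hx).trans hK, fun x hx y hy => (hC2 x hx y hy).trans ?_,
    fun x hx y hy => (hlip x hx y hy).trans (by gcongr), fun x hx => (hA x hx).trans ?_⟩
  · have : 0 ≤ ‖fderiv ℝ a 0‖ := norm_nonneg _
    have : C₁ ≤ K₁ + A := by linarith
    gcongr
  · have : 0 ≤ K₁ := by positivity
    linarith

/-! ### Segments -/

/-- The average of `g` over the segment from `x` to `x + y`. -/
def avg {E : Type*} [NormedAddCommGroup E] [NormedSpace ℝ E] (g : ℂ → E) (x y : ℂ) : E :=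
  ∫ r in (0 : ℝ)..1, g (x + r * y)

/-- The segment from `x` to `x + y` lies in `Ω`, up to its endpoints. -/
def SegIn (x y : ℂ) : Prop := ∀ r ∈ Ioo (0 : ℝ) 1, x + r * y ∈ disc

lemma SegIn.mem_closedBall {x y : ℂ} (h : SegIn x y) {r : ℝ} (hr : r ∈ Icc (0 : ℝ) 1) :
    x + r * y ∈ Metric.closedBall (0 : ℂ) 1 := by
  have hc : Continuous fun r : ℝ => x + r * y := by fun_prop
  have h1 : MapsTo (fun r : ℝ => x + r * y) (closure (Ioo 0 1)) (closure disc) :=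
    MapsTo.closure (fun r hr => h r hr) hc
  rw [closure_Ioo (by norm_num), closure_disc] at h1
  exact h1 hr

lemma HolderData.continuousOn_fderiv {ν K : ℝ} {a : ℂ → ℂ} (H : HolderData ν K a) :
    ContinuousOn (fderiv ℝ a) disc := by
  have hν : 0 < ν := by linarith [H.half_lt]
  intro x hx
  refine tendsto_iff_norm_sub_tendsto_zero.2 ?_
  have h1 : Tendsto (fun y => K * ‖y - x‖ ^ ν) (𝓝[disc] x) (𝓝 0) := by
    have : Continuous fun y : ℂ => K * ‖y - x‖ ^ ν :=
      continuous_const.mul ((continuous_id.sub continuous_const).norm.rpow_const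
        fun _ => Or.inr hν.le)
    have h2 := (this.tendsto x).mono_left (nhdsWithin_le_nhds (s := disc))
    simpa [Real.zero_rpow hν.ne'] using h2
  refine squeeze_zero' (Eventually.of_forall fun _ => norm_nonneg _) ?_ h1
  filter_upwards [self_mem_nhdsWithin] with y hy using H.holder y hy x hx

lemma HolderData.intervalIntegrable_fderiv {ν K : ℝ} {a : ℂ → ℂ} (H : HolderData ν K a)
    {x y : ℂ} (h : SegIn x y) :
    IntervalIntegrable (fun r : ℝ => fderiv ℝ a (x + r * y)) volume 0 1 := by
  rw [intervalIntegrable_iff_integrableOn_Ioo_of_le zero_le_one]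
  refine IntegrableOn.of_bound (C := K) (by simp) ?_ ?_
  · refine ContinuousOn.aestronglyMeasurable ?_ measurableSet_Ioo
    exact H.continuousOn_fderiv.comp (by fun_prop) fun r hr => h r hr
  · exact (ae_restrict_iff' measurableSet_Ioo).2
      (ae_of_all _ fun r hr => H.norm_fderiv_le _ (h r hr))

lemma HolderData.intervalIntegrable_fderiv_apply {ν K : ℝ} {a : ℂ → ℂ} (H : HolderData ν K a)
    {x y : ℂ} (h : SegIn x y) (w : ℂ) :
    IntervalIntegrable (fun r : ℝ => fderiv ℝ a (x + r * y) w) volume 0 1 :=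
  ⟨(H.intervalIntegrable_fderiv h).1.apply_continuousLinearMap w,
    (H.intervalIntegrable_fderiv h).2.apply_continuousLinearMap w⟩

lemma HolderData.continuousOn_segment {ν K : ℝ} {a : ℂ → ℂ} (H : HolderData ν K a)
    {x y : ℂ} (h : SegIn x y) : ContinuousOn (fun r : ℝ => a (x + r * y)) (Icc 0 1) :=
  H.continuousOn.comp (by fun_prop) fun _ hr => h.mem_closedBall hr

lemma HolderData.norm_avg_fderiv_le {ν K : ℝ} {a : ℂ → ℂ} (H : HolderData ν K a)
    {x y : ℂ} (h : SegIn x y) : ‖avg (fderiv ℝ a) x y‖ ≤ K := by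
  have := intervalIntegral.norm_integral_le_of_norm_le_const_ae (a := 0) (b := 1) (C := K)
    (f := fun r : ℝ => fderiv ℝ a (x + r * y)) ?_
  · simpa [avg] using this
  -- The endpoint r = 1 may lie on the unit circle, where nothing is known about `fderiv`; it is
  -- discarded as a null set.
  · filter_upwards [Measure.ae_ne volume (1 : ℝ)] with r hr1 hr
    rw [uIoc_of_le zero_le_one] at hr
    exact H.norm_fderiv_le _ (h r ⟨hr.1, lt_of_le_of_ne hr.2 hr1⟩)

lemma HolderData.norm_avg_le {ν K : ℝ} {a : ℂ → ℂ} (H : HolderData ν K a)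
    {x y : ℂ} (h : SegIn x y) : ‖avg a x y‖ ≤ K := by
  have := intervalIntegral.norm_integral_le_of_norm_le_const (a := 0) (b := 1) (C := K)
    (f := fun r : ℝ => a (x + r * y)) ?_
  · simpa [avg] using this
  · intro r hr
    rw [uIoc_of_le zero_le_one] at hr
    exact H.norm_le _ (h.mem_closedBall ⟨hr.1.le, hr.2⟩)

lemma HolderData.avg_fderiv_sub {ν K : ℝ} {a : ℂ → ℂ} (H : HolderData ν K a)
    {x y x' y' : ℂ} (h : SegIn x y) (h' : SegIn x' y') :
    ‖avg (fderiv ℝ a) x y - avg (fderiv ℝ a) x' y'‖ ≤ K * (‖x - x'‖ + ‖y - y'‖) ^ ν := by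
  rw [avg, avg, ← intervalIntegral.integral_sub (H.intervalIntegrable_fderiv h)
    (H.intervalIntegrable_fderiv h')]
  have := intervalIntegral.norm_integral_le_of_norm_le_const_ae (a := 0) (b := 1)
    (C := K * (‖x - x'‖ + ‖y - y'‖) ^ ν)
    (f := fun r : ℝ => fderiv ℝ a (x + r * y) - fderiv ℝ a (x' + r * y')) ?_
  · simpa using this
  · filter_upwards [Measure.ae_ne volume (1 : ℝ)] with r hr1 hr
    rw [uIoc_of_le zero_le_one] at hr
    have hr' : r ∈ Ioo (0 : ℝ) 1 := ⟨hr.1, lt_of_le_of_ne hr.2 hr1⟩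
    refine (H.holder _ (h r hr') _ (h' r hr')).trans ?_
    refine mul_le_mul_of_nonneg_left (Real.rpow_le_rpow (norm_nonneg _) ?_
      (by linarith [H.half_lt])) H.nonneg
    have : x + r * y - (x' + r * y') = (x - x') + r * (y - y') := by ring
    rw [this]
    refine (norm_add_le _ _).trans (add_le_add_right ?_ _)
    rw [norm_mul, Complex.norm_real, Real.norm_of_nonneg hr.1.le]
    exact mul_le_of_le_one_left (norm_nonneg _) hr.2

lemma HolderData.avg_sub {ν K : ℝ} {a : ℂ → ℂ} (H : HolderData ν K a)
    {x y x' y' : ℂ} (h : SegIn x y) (h' : SegIn x' y') :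
    ‖avg a x y - avg a x' y'‖ ≤ K * (‖x - x'‖ + ‖y - y'‖) := by
  rw [avg, avg, ← intervalIntegral.integral_sub
    ((H.continuousOn_segment h).intervalIntegrable_of_Icc zero_le_one)
    ((H.continuousOn_segment h').intervalIntegrable_of_Icc zero_le_one)]
  have := intervalIntegral.norm_integral_le_of_norm_le_const (a := 0) (b := 1)
    (C := K * (‖x - x'‖ + ‖y - y'‖))
    (f := fun r : ℝ => a (x + r * y) - a (x' + r * y')) ?_
  · simpa using this
  · intro r hr
    rw [uIoc_of_le zero_le_one] at hr
    have hr' : r ∈ Icc (0 : ℝ) 1 := ⟨hr.1.le, hr.2⟩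
    refine (H.lipschitz _ (h.mem_closedBall hr') _ (h'.mem_closedBall hr')).trans ?_
    refine mul_le_mul_of_nonneg_left ?_ H.nonneg
    have : x + r * y - (x' + r * y') = (x - x') + r * (y - y') := by ring
    rw [this]
    refine (norm_add_le _ _).trans (add_le_add_right ?_ _)
    rw [norm_mul, Complex.norm_real, Real.norm_of_nonneg hr.1.le]
    exact mul_le_of_le_one_left (norm_nonneg _) hr.2

lemma HolderData.hasDerivAt_segment {ν K : ℝ} {a : ℂ → ℂ} (H : HolderData ν K a)
    {x y : ℂ} (h : SegIn x y) {r : ℝ} (hr : r ∈ Ioo (0 : ℝ) 1) :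
    HasDerivAt (fun r : ℝ => a (x + r * y)) (fderiv ℝ a (x + r * y) y) r := by
  have h1 : HasDerivAt (fun r : ℝ => x + r * y) y r := by
    simpa using ((Complex.ofRealCLM.hasDerivAt (x := r)).mul_const y).const_add x
  exact (H.hasFDerivAt _ (h r hr)).comp_hasDerivAt r h1

/-- The fundamental theorem of calculus along a segment. -/
lemma HolderData.avg_fderiv_apply {ν K : ℝ} {a : ℂ → ℂ} (H : HolderData ν K a)
    {x y : ℂ} (h : SegIn x y) : avg (fderiv ℝ a) x y y = a (x + y) - a x := by
  have hint := H.intervalIntegrable_fderiv h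
  rw [avg, ContinuousLinearMap.intervalIntegral_apply hint]
  have := intervalIntegral.integral_eq_sub_of_hasDerivAt_of_le zero_le_one
    (H.continuousOn_segment h) (fun r hr => H.hasDerivAt_segment h hr)
    (H.intervalIntegrable_fderiv_apply h y)
  simpa using this

/-- Integration by parts along a segment. -/
lemma HolderData.integral_mul_fderiv {ν K : ℝ} {a : ℂ → ℂ} (H : HolderData ν K a)
    {x y : ℂ} (h : SegIn x y) :
    ∫ r in (0 : ℝ)..1, (r : ℂ) * fderiv ℝ a (x + r * y) y = a (x + y) - avg a x y := by
  have h2 : IntervalIntegrable (fun r : ℝ => (r : ℂ) * fderiv ℝ a (x + r * y) y) volume 0 1 :=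
    (H.intervalIntegrable_fderiv_apply h y).continuousOn_mul (by fun_prop)
  have h1 : IntervalIntegrable (fun r : ℝ => a (x + r * y)) volume 0 1 :=
    (H.continuousOn_segment h).intervalIntegrable_of_Icc zero_le_one
  have := intervalIntegral.integral_eq_sub_of_hasDerivAt_of_le (a := 0) (b := 1) zero_le_one
    (f := fun r : ℝ => (r : ℂ) * a (x + r * y))
    (f' := fun r : ℝ => a (x + r * y) + (r : ℂ) * fderiv ℝ a (x + r * y) y)
    (ContinuousOn.mul (by fun_prop) (H.continuousOn_segment h))
    (fun r hr => by
      have := (hasDerivAt_id r).ofReal_comp.mul (H.hasDerivAt_segment h hr)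
      simp only [Complex.ofReal_one, one_mul] at this
      exact this)
    (h1.add h2)
  rw [intervalIntegral.integral_add h1 h2] at this
  simp only [Complex.ofReal_one, one_mul, Complex.ofReal_zero, zero_mul, sub_zero] at this
  rw [← this, avg]; ring

end

section

/-! ### Lines -/

/-- The coordinate `z · θ^⊥`. -/
def sPar (z : ℂ) (φ : ℝ) : ℝ := inner ℝ z (dirPerp φ)

/-- The coordinate `z · θ`. -/
def mPar (z : ℂ) (φ : ℝ) : ℝ := inner ℝ z (dir φ)

/-- Half the length of the chord through `z` in the direction `θ`. -/
def sig (z : ℂ) (φ : ℝ) : ℝ := √(1 - sPar z φ ^ 2)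

/-- The midpoint of the chord through `z` in the direction `θ`. -/
def mid (z : ℂ) (φ : ℝ) : ℂ := sPar z φ * dirPerp φ

lemma dir_eq (φ : ℝ) : dir φ = Real.cos φ + Real.sin φ * Complex.I := by
  rw [dir, Complex.exp_mul_I]; simp

lemma dir_re (φ : ℝ) : (dir φ).re = Real.cos φ := by simp [dir, Complex.exp_ofReal_mul_I_re]
lemma dir_im (φ : ℝ) : (dir φ).im = Real.sin φ := by simp [dir, Complex.exp_ofReal_mul_I_im]
lemma dirPerp_re (φ : ℝ) : (dirPerp φ).re = -Real.sin φ := by simp [dirPerp, dir_im]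
lemma dirPerp_im (φ : ℝ) : (dirPerp φ).im = Real.cos φ := by simp [dirPerp, dir_re]

lemma sPar_eq (z : ℂ) (φ : ℝ) : sPar z φ = -z.re * Real.sin φ + z.im * Real.cos φ := by
  rw [sPar, Complex.inner, Complex.mul_re, dirPerp_re, dirPerp_im]; simp; ring

lemma mPar_eq (z : ℂ) (φ : ℝ) : mPar z φ = z.re * Real.cos φ + z.im * Real.sin φ := by
  rw [mPar, Complex.inner, Complex.mul_re, dir_re, dir_im]; simp; ring

lemma norm_dir (φ : ℝ) : ‖dir φ‖ = 1 := by simpa using Wiener.norm_dir_pow φ 1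

lemma norm_dirPerp (φ : ℝ) : ‖dirPerp φ‖ = 1 := by simp [dirPerp, norm_dir]

lemma mid_add (z : ℂ) (φ : ℝ) : mid z φ + mPar z φ * dir φ = z := by
  have := Real.sin_sq_add_cos_sq φ
  apply Complex.ext
  · simp only [mid, Complex.add_re, Complex.re_ofReal_mul, dirPerp_re, dir_re, sPar_eq, mPar_eq]
    linear_combination z.re * this
  · simp only [mid, Complex.add_im, Complex.im_ofReal_mul, dirPerp_im, dir_im, sPar_eq, mPar_eq]
    linear_combination z.im * this

lemma normSq_frame (s t φ : ℝ) : ‖(s * dirPerp φ + t * dir φ : ℂ)‖ ^ 2 = s ^ 2 + t ^ 2 := by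
  rw [Complex.sq_norm, Complex.normSq_apply]
  simp only [Complex.add_re, Complex.add_im, Complex.re_ofReal_mul, Complex.im_ofReal_mul,
    dirPerp_re, dir_re, dirPerp_im, dir_im]
  linear_combination (s ^ 2 + t ^ 2) * Real.sin_sq_add_cos_sq φ

lemma sPar_sq_add_mPar_sq (z : ℂ) (φ : ℝ) : sPar z φ ^ 2 + mPar z φ ^ 2 = ‖z‖ ^ 2 := by
  rw [← normSq_frame _ _ φ]
  exact congrArg (fun w : ℂ => ‖w‖ ^ 2) (mid_add z φ)

variable {z : ℂ} {φ ψ : ℝ}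

lemma sPar_sq_lt (hz : z ∈ disc) (φ : ℝ) : sPar z φ ^ 2 < 1 := by
  have := sPar_sq_add_mPar_sq z φ
  have := mem_disc.1 hz
  nlinarith [norm_nonneg z, sq_nonneg (mPar z φ)]

lemma sig_pos (hz : z ∈ disc) (φ : ℝ) : 0 < sig z φ :=
  Real.sqrt_pos.2 (by linarith [sPar_sq_lt hz φ])

lemma sig_sq (hz : z ∈ disc) (φ : ℝ) : sig z φ ^ 2 = 1 - sPar z φ ^ 2 :=
  Real.sq_sqrt (by linarith [sPar_sq_lt hz φ])

lemma sig_le_one (hz : z ∈ disc) (φ : ℝ) : sig z φ ≤ 1 := by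
  have := sig_sq hz φ
  nlinarith [sig_pos hz φ, sq_nonneg (sPar z φ)]

lemma abs_mPar_lt_sig (hz : z ∈ disc) (φ : ℝ) : |mPar z φ| < sig z φ := by
  apply abs_lt_of_sq_lt_sq _ (sig_pos hz φ).le
  rw [sig_sq hz]
  have := sPar_sq_add_mPar_sq z φ
  have := mem_disc.1 hz
  nlinarith [norm_nonneg z]

lemma segIn_mid (hz : z ∈ disc) (φ : ℝ) {t : ℝ} (ht : |t| ≤ sig z φ) :
    SegIn (mid z φ) (t * dir φ) := by
  intro r hr
  have h1 : mid z φ + r * (t * dir φ) = (sPar z φ : ℂ) * dirPerp φ + (r * t : ℝ) * dir φ := by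
    rw [mid]; push_cast; ring
  rw [mem_disc, h1, ← sq_lt_one_iff₀ (norm_nonneg _), normSq_frame, mul_pow]
  have h2 := sig_sq hz φ
  have h3 : t ^ 2 ≤ sig z φ ^ 2 := sq_le_sq' (abs_le.1 ht).1 (abs_le.1 ht).2
  have h4 : r ^ 2 < 1 := by nlinarith [hr.1, hr.2]
  have h5 : 0 < sig z φ ^ 2 := by have := sig_pos hz φ; positivity
  nlinarith [sq_nonneg r]

lemma norm_dir_sub_le (φ ψ : ℝ) : ‖dir φ - dir ψ‖ ≤ |φ - ψ| := by
  have h1 : dir φ - dir ψ = dir ψ * (Complex.exp (Complex.I * (φ - ψ : ℝ)) - 1) := by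
    rw [mul_sub, mul_one, dir, dir, ← Complex.exp_add]; congr 2; push_cast; ring
  rw [h1, norm_mul, norm_dir, one_mul]
  exact Real.norm_exp_I_mul_ofReal_sub_one_le

lemma norm_dirPerp_sub_le (φ ψ : ℝ) : ‖dirPerp φ - dirPerp ψ‖ ≤ |φ - ψ| := by
  rw [dirPerp, dirPerp, ← mul_sub, norm_mul, Complex.norm_I, one_mul]
  exact norm_dir_sub_le φ ψ

lemma abs_sPar_le (hz : z ∈ disc) (φ : ℝ) : |sPar z φ| ≤ 1 := by
  rw [← sq_le_one_iff_abs_le_one]; exact (sPar_sq_lt hz φ).le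

lemma abs_mPar_le (hz : z ∈ disc) (φ : ℝ) : |mPar z φ| ≤ 1 :=
  (abs_mPar_lt_sig hz φ).le.trans (sig_le_one hz φ)

lemma abs_sPar_sub_le (hz : z ∈ disc) (φ ψ : ℝ) : |sPar z φ - sPar z ψ| ≤ |φ - ψ| := by
  rw [sPar, sPar, ← inner_sub_right]
  refine (abs_real_inner_le_norm _ _).trans ?_
  exact (mul_le_of_le_one_left (norm_nonneg _) (mem_disc.1 hz).le).trans (norm_dirPerp_sub_le φ ψ)

lemma abs_mPar_sub_le (hz : z ∈ disc) (φ ψ : ℝ) : |mPar z φ - mPar z ψ| ≤ |φ - ψ| := by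
  rw [mPar, mPar, ← inner_sub_right]
  refine (abs_real_inner_le_norm _ _).trans ?_
  exact (mul_le_of_le_one_left (norm_nonneg _) (mem_disc.1 hz).le).trans (norm_dir_sub_le φ ψ)

lemma sqrt_add_sq_le {A : ℝ} (hA : 0 ≤ A) (x y : ℝ) :
    √(A + x ^ 2) ≤ √(A + y ^ 2) + |x - y| := by
  apply Real.sqrt_le_iff.2 ⟨by positivity, ?_⟩
  have h1 : √(A + y ^ 2) ^ 2 = A + y ^ 2 := Real.sq_sqrt (by positivity)
  have h2 : |y| ≤ √(A + y ^ 2) := Real.abs_le_sqrt (by linarith)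
  have h3 : |x - y| ^ 2 = (x - y) ^ 2 := sq_abs _
  have h4 : y * (x - y) ≤ |y| * |x - y| := by rw [← abs_mul]; exact le_abs_self _
  nlinarith [abs_nonneg (x - y)]

lemma sig_eq (z : ℂ) (φ : ℝ) : sig z φ = √((1 - ‖z‖ ^ 2) + mPar z φ ^ 2) := by
  rw [sig, ← sPar_sq_add_mPar_sq z φ]; congr 1; ring

/-- Written as √((1 - |z|²) + (z·θ)²), the half chord is a 1-Lipschitz function of z·θ. It is thus
Lipschitz in the angle uniformly up to ∂Ω, although its derivative in z carries a factor 1/σ. -/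
lemma abs_sig_sub_le (hz : z ∈ disc) (φ ψ : ℝ) : |sig z φ - sig z ψ| ≤ |φ - ψ| := by
  have hA : 0 ≤ 1 - ‖z‖ ^ 2 := by
    have := mem_disc.1 hz
    nlinarith [norm_nonneg z]
  have h1 := sqrt_add_sq_le hA (mPar z φ) (mPar z ψ)
  have h2 := sqrt_add_sq_le hA (mPar z ψ) (mPar z φ)
  rw [← sig_eq, ← sig_eq] at h1 h2
  rw [abs_sub_comm (mPar z ψ)] at h2
  refine le_trans (abs_le.2 ⟨by linarith, by linarith⟩) (abs_mPar_sub_le hz φ ψ)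

lemma norm_real_mul_sub_le {s t L : ℝ} {u v : ℂ} (hs : |s| ≤ 1) (hst : |s - t| ≤ L)
    (hv : ‖v‖ = 1) (huv : ‖u - v‖ ≤ L) : ‖(s * u - t * v : ℂ)‖ ≤ 2 * L := by
  have : (s * u - t * v : ℂ) = s * (u - v) + (s - t : ℝ) * v := by push_cast; ring
  rw [this]
  refine (norm_add_le _ _).trans ?_
  rw [norm_mul, norm_mul, hv, mul_one, Complex.norm_real, Complex.norm_real, Real.norm_eq_abs,
    Real.norm_eq_abs]
  nlinarith [norm_nonneg (u - v), abs_nonneg s]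

lemma norm_mid_sub_le (hz : z ∈ disc) (φ ψ : ℝ) : ‖mid z φ - mid z ψ‖ ≤ 2 * |φ - ψ| :=
  norm_real_mul_sub_le (abs_sPar_le hz φ) (abs_sPar_sub_le hz φ ψ) (norm_dirPerp ψ)
    (norm_dirPerp_sub_le φ ψ)

/-! ### Continuity and derivatives of the parameters -/

lemma hasFDerivAt_sPar (z : ℂ) (φ : ℝ) :
    HasFDerivAt (fun z => sPar z φ) (innerSL ℝ (dirPerp φ)) z := by
  refine (innerSL ℝ (dirPerp φ)).hasFDerivAt.congr_of_eventuallyEq (Eventually.of_forall fun w => ?_)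
  simp [sPar, real_inner_comm]

lemma hasFDerivAt_mPar (z : ℂ) (φ : ℝ) :
    HasFDerivAt (fun z => mPar z φ) (innerSL ℝ (dir φ)) z := by
  refine (innerSL ℝ (dir φ)).hasFDerivAt.congr_of_eventuallyEq (Eventually.of_forall fun w => ?_)
  simp [mPar, real_inner_comm]

lemma contDiff_sPar (φ : ℝ) : ContDiff ℝ 1 (fun z => sPar z φ) := by
  exact contDiff_id.inner ℝ contDiff_const

lemma contDiff_mPar (φ : ℝ) : ContDiff ℝ 1 (fun z => mPar z φ) := by
  exact contDiff_id.inner ℝ contDiff_const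

lemma hasFDerivAt_sig (hz : z ∈ disc) (φ : ℝ) :
    HasFDerivAt (fun z => sig z φ) ((-(sPar z φ) / sig z φ) • innerSL ℝ (dirPerp φ)) z := by
  have h1 := ((hasFDerivAt_sPar z φ).pow 2).const_sub 1
  have h2 := h1.sqrt (by linarith [sPar_sq_lt hz φ])
  refine h2.congr_fderiv ?_
  ext e
  simp [sig]
  field_simp

lemma contDiffAt_sig (hz : z ∈ disc) (φ : ℝ) : ContDiffAt ℝ 1 (fun z => sig z φ) z := by
  unfold sig
  refine ContDiffAt.sqrt ?_ (by linarith [sPar_sq_lt hz φ])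
  exact (contDiff_const.sub ((contDiff_sPar φ).pow 2)).contDiffAt

end

/-! ### Differentiating averages and integrals over moving segments -/

section

/-- Segments may touch the unit circle at an endpoint, so domination comes from the Lipschitz bound
of a on the closed disc, and pointwise derivatives are used only for 0 < r < 1. -/
lemma HolderData.hasFDerivAt_avg {ν K : ℝ} {a : ℂ → ℂ} (H : HolderData ν K a)
    {X Y : ℂ → ℂ} {X' Y' : ℂ →L[ℝ] ℂ} {z : ℂ} (hX : HasFDerivAt X X' z) (hY : HasFDerivAt Y Y' z)
    (hXc : ContDiffAt ℝ 1 X z) (hYc : ContDiffAt ℝ 1 Y z)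
    (hseg : ∀ᶠ w in 𝓝 z, SegIn (X w) (Y w)) :
    IntervalIntegrable (fun r : ℝ => (fderiv ℝ a (X z + r * Y z)).comp (X' + r • Y'))
      volume 0 1 ∧
    HasFDerivAt (fun w => avg a (X w) (Y w))
      (∫ r in (0 : ℝ)..1, (fderiv ℝ a (X z + r * Y z)).comp (X' + r • Y')) z := by
  obtain ⟨KX, tX, htX, hLX⟩ := hXc.exists_lipschitzOnWith
  obtain ⟨KY, tY, htY, hLY⟩ := hYc.exists_lipschitzOnWith
  have h0 : SegIn (X z) (Y z) := hseg.self_of_nhds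
  have hae : ∀ᵐ r : ℝ, r ∈ uIoc (0 : ℝ) 1 → r ∈ Ioo (0 : ℝ) 1 := by
    filter_upwards [Measure.ae_ne volume (1 : ℝ)] with r hr1 hr
    rw [uIoc_of_le zero_le_one] at hr
    exact ⟨hr.1, lt_of_le_of_ne hr.2 hr1⟩
  have hmeas : AEStronglyMeasurable
      (fun r : ℝ => (fderiv ℝ a (X z + r * Y z)).comp (X' + r • Y'))
      (volume.restrict (uIoc (0 : ℝ) 1)) := by
    have h1 := (H.intervalIntegrable_fderiv h0).def'.aestronglyMeasurable
    have h2 : AEStronglyMeasurable (fun r : ℝ => X' + r • Y') (volume.restrict (uIoc (0 : ℝ) 1)) :=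
      (Continuous.aestronglyMeasurable (by fun_prop))
    exact (ContinuousLinearMap.compL ℝ ℂ ℂ ℂ).aestronglyMeasurable_comp₂ h1 h2
  refine intervalIntegral.hasFDerivAt_integral_of_dominated_loc_of_lip
    (F := fun w (r : ℝ) => a (X w + r * Y w))
    (s := {w | SegIn (X w) (Y w)} ∩ (tX ∩ tY)) (bound := fun _ => K * (KX + KY))
    (inter_mem hseg (inter_mem htX htY)) ?_ ?_ hmeas ?_ intervalIntegrable_const ?_
  · filter_upwards [hseg] with w hw
    exact ((H.continuousOn_segment hw).intervalIntegrable_of_Icc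
      zero_le_one).def'.aestronglyMeasurable
  · exact (H.continuousOn_segment h0).intervalIntegrable_of_Icc zero_le_one
  · filter_upwards [hae] with r hr0 hr'
    have hr := hr0 hr'
    have hr2 : r ∈ Icc (0 : ℝ) 1 := Ioo_subset_Icc_self hr
    refine LipschitzOnWith.of_dist_le_mul fun w hw w' hw' => ?_
    have h1 := hLX.dist_le_mul w hw.2.1 w' hw'.2.1
    have h2 := hLY.dist_le_mul w hw.2.2 w' hw'.2.2
    rw [dist_eq_norm] at h1 h2 ⊢
    have hK0 : (0 : ℝ) ≤ K * (KX + KY) := mul_nonneg H.nonneg (by positivity)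
    rw [Real.coe_nnabs, abs_of_nonneg hK0]
    refine (H.lipschitz _ (hw.1.mem_closedBall hr2) _ (hw'.1.mem_closedBall hr2)).trans ?_
    rw [mul_assoc]
    refine mul_le_mul_of_nonneg_left ?_ H.nonneg
    have : X w + r * Y w - (X w' + r * Y w') = (X w - X w') + r * (Y w - Y w') := by ring
    rw [this, add_mul]
    refine (norm_add_le _ _).trans (add_le_add h1 (le_trans ?_ h2))
    rw [norm_mul, Complex.norm_real, Real.norm_of_nonneg hr.1.le]
    exact mul_le_of_le_one_left (norm_nonneg _) hr.2.le
  · filter_upwards [hae] with r hr0 hr'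
    have hr := hr0 hr'
    have h1 : HasFDerivAt (fun w => X w + r * Y w) (X' + r • Y') z := by
      have := hX.add (hY.const_smul r)
      simp only [Pi.add_def, Pi.smul_def, Complex.real_smul] at this
      exact this
    exact (H.hasFDerivAt _ (h0 r hr)).comp z h1

/-- The integral of `a` over the segment of signed length `t` from the midpoint of a chord. -/
def chord (a : ℂ → ℂ) (z : ℂ) (φ t : ℝ) : ℂ := t * avg a (mid z φ) (t * dir φ)

/-- Leibniz's rule. Moving the free endpoint contributes the value of a there, recovered from the
average by integration by parts. Moving the midpoint along θ^⊥ contributes the averaged transversal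
derivative. -/
lemma HolderData.hasFDerivAt_chord {ν K : ℝ} {a : ℂ → ℂ} (H : HolderData ν K a)
    {z : ℂ} (hz : z ∈ disc) (φ : ℝ) {t : ℂ → ℝ} {t' : ℂ →L[ℝ] ℝ} (ht : HasFDerivAt t t' z)
    (htc : ContDiffAt ℝ 1 t z) (hts : ∀ w ∈ disc, |t w| ≤ sig w φ) :
    HasFDerivAt (fun w => chord a w φ (t w))
      (t'.smulRight (a (mid z φ + t z * dir φ)) + (innerSL ℝ (dirPerp φ)).smulRight
        (t z * avg (fderiv ℝ a) (mid z φ) (t z * dir φ) (dirPerp φ))) z := by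
  have hX : HasFDerivAt (fun w => mid w φ)
      ((innerSL ℝ (dirPerp φ)).smulRight (dirPerp φ)) z :=
    ((hasFDerivAt_sPar z φ).smul_const (dirPerp φ)).congr_of_eventuallyEq
      (Eventually.of_forall fun w => by simp [mid])
  have hY : HasFDerivAt (fun w => (t w * dir φ : ℂ)) (t'.smulRight (dir φ)) z :=
    (ht.smul_const (dir φ)).congr_of_eventuallyEq (Eventually.of_forall fun w => by simp)
  have hXc : ContDiffAt ℝ 1 (fun w => mid w φ) z :=
    ((contDiff_sPar φ).contDiffAt.smul contDiffAt_const).congr_of_eventuallyEq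
      (f := fun w => sPar w φ • dirPerp φ) (Eventually.of_forall fun w => by simp [mid])
  have hYc : ContDiffAt ℝ 1 (fun w => (t w * dir φ : ℂ)) z :=
    (htc.smul contDiffAt_const).congr_of_eventuallyEq (f := fun w => t w • dir φ)
      (Eventually.of_forall fun w => by simp)
  have hseg : ∀ᶠ w in 𝓝 z, SegIn (mid w φ) (t w * dir φ) := by
    filter_upwards [isOpen_disc.mem_nhds hz] with w hw using segIn_mid hw φ (hts w hw)
  have h0 := hseg.self_of_nhds
  obtain ⟨hi, hd⟩ := H.hasFDerivAt_avg hX hY hXc hYc hseg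
  have hmul : HasFDerivAt (fun w => chord a w φ (t w)) _ z :=
    (ht.smul hd).congr_of_eventuallyEq (Eventually.of_forall fun w => by simp [chord])
  refine hmul.congr_fderiv ?_
  refine ContinuousLinearMap.ext fun e => ?_
  have hpart := H.integral_mul_fderiv h0
  have e1 : (∫ r in (0 : ℝ)..1, (fderiv ℝ a (mid z φ + r * (t z * dir φ))).comp
      ((innerSL ℝ (dirPerp φ)).smulRight (dirPerp φ) + r • t'.smulRight (dir φ))) e =
      (inner ℝ (dirPerp φ) e : ℝ) * avg (fderiv ℝ a) (mid z φ) (t z * dir φ) (dirPerp φ) +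
      (t' e : ℝ) * ∫ r in (0 : ℝ)..1,
        (r : ℂ) * fderiv ℝ a (mid z φ + r * (t z * dir φ)) (dir φ) := by
    rw [ContinuousLinearMap.intervalIntegral_apply hi, avg,
      ContinuousLinearMap.intervalIntegral_apply (H.intervalIntegrable_fderiv h0),
      ← intervalIntegral.integral_const_mul, ← intervalIntegral.integral_const_mul,
      ← intervalIntegral.integral_add]
    · refine intervalIntegral.integral_congr fun r _ => ?_
      simp only [ContinuousLinearMap.comp_apply, add_apply, smul_apply,
        ContinuousLinearMap.smulRight_apply, innerSL_apply_apply, map_add, map_smul]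
      simp only [Complex.real_smul]
      ring
    · exact (H.intervalIntegrable_fderiv_apply h0 _).const_mul _
    · exact ((H.intervalIntegrable_fderiv_apply h0 _).continuousOn_mul (by fun_prop)).const_mul _
  have e2 : (t z : ℂ) * ∫ r in (0 : ℝ)..1,
        (r : ℂ) * fderiv ℝ a (mid z φ + r * (t z * dir φ)) (dir φ) =
      a (mid z φ + t z * dir φ) - avg a (mid z φ) (t z * dir φ) := by
    rw [← hpart, ← intervalIntegral.integral_const_mul]
    refine intervalIntegral.integral_congr fun r _ => ?_
    have : (t z * dir φ : ℂ) = (t z) • dir φ := by simp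
    rw [this, map_smul]
    simp only [Complex.real_smul]
    ring
  simp only [add_apply, smul_apply, Complex.real_smul]
  rw [e1, mul_add, mul_left_comm (t z : ℂ) (t' e : ℂ), e2]
  simp
  ring

end

/-! ### The odd part of the ray integral and its gradient -/

section

/-- The odd part in `θ` of the ray integral; see `rayIntegral_sub_radon`. -/
def qOdd (a : ℂ → ℂ) (z : ℂ) (φ : ℝ) : ℂ :=
  (1 / 2) * (chord a z φ (sig z φ) + chord a z φ (-sig z φ) - 2 * chord a z φ (mPar z φ))

/-- The average of the derivative of `a` over the segment of signed length `t` from the midpoint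
of a chord. -/
def avgD (a : ℂ → ℂ) (z : ℂ) (φ t : ℝ) : ℂ →L[ℝ] ℂ := avg (fderiv ℝ a) (mid z φ) (t * dir φ)

/-- Twice the transversal derivative of `qOdd`. -/
def transQ (a : ℂ → ℂ) (z : ℂ) (φ : ℝ) : ℂ :=
  -(sPar z φ : ℂ) * (avgD a z φ (sig z φ) (dir φ) + avgD a z φ (-sig z φ) (dir φ)) +
    (sig z φ : ℂ) * (avgD a z φ (sig z φ) (dirPerp φ) - avgD a z φ (-sig z φ) (dirPerp φ)) -
    2 * ((mPar z φ : ℂ) * avgD a z φ (mPar z φ) (dirPerp φ))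

/-- The derivative of `qOdd` in `z`. -/
def gradQ (a : ℂ → ℂ) (z : ℂ) (φ : ℝ) : ℂ →L[ℝ] ℂ :=
  (innerSL ℝ (dirPerp φ)).smulRight ((1 / 2) * transQ a z φ) - (innerSL ℝ (dir φ)).smulRight (a z)

variable {ν K : ℝ} {a : ℂ → ℂ}

/-- The two moving endpoints contribute ∓s/σ times the values of a at the ends of the chord. Only
their difference occurs, and it is of order σ, so no singularity remains at ∂Ω. -/
lemma HolderData.hasFDerivAt_qOdd (H : HolderData ν K a) {z : ℂ} (hz : z ∈ disc) (φ : ℝ) :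
    HasFDerivAt (fun w => qOdd a w φ) (gradQ a z φ) z := by
  have hs := hasFDerivAt_sig hz φ
  have hsc := contDiffAt_sig hz φ
  have h1 := H.hasFDerivAt_chord hz φ hs hsc
    fun w hw => by rw [abs_of_pos (sig_pos hw φ)]
  have h2 := H.hasFDerivAt_chord hz φ (t := fun w => -sig w φ) hs.neg hsc.neg
    fun w hw => by rw [abs_neg, abs_of_pos (sig_pos hw φ)]
  have h3 := H.hasFDerivAt_chord hz φ (hasFDerivAt_mPar z φ) (contDiff_mPar φ).contDiffAt
    fun w hw => (abs_mPar_lt_sig hw φ).le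
  refine (((h1.add h2).sub (h3.const_mul 2)).const_mul (1 / 2)).congr_fderiv ?_
  have hσ := sig_pos hz φ
  have hσc : (sig z φ : ℂ) ≠ 0 := by exact_mod_cast hσ.ne'
  have f1 := H.avg_fderiv_apply (segIn_mid hz φ (t := sig z φ) (by rw [abs_of_pos hσ]))
  have f2 := H.avg_fderiv_apply (segIn_mid hz φ (t := -sig z φ) (by rw [abs_neg, abs_of_pos hσ]))
  have r1 : ∀ t : ℝ, (t * dir φ : ℂ) = t • dir φ := fun t => by simp
  have f1' : (sig z φ : ℂ) * avgD a z φ (sig z φ) (dir φ) =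
      a (mid z φ + sig z φ * dir φ) - a (mid z φ) := by
    rw [← f1, avgD]
    conv_rhs => arg 2; rw [r1]
    rw [map_smul, Complex.real_smul]
  have f2' : -(sig z φ : ℂ) * avgD a z φ (-sig z φ) (dir φ) =
      a (mid z φ + (-sig z φ : ℝ) * dir φ) - a (mid z φ) := by
    rw [← f2, avgD]
    conv_rhs => arg 2; rw [r1]
    rw [map_smul, Complex.real_smul]; push_cast; ring
  refine ContinuousLinearMap.ext fun e => ?_
  simp only [add_apply, sub_apply, smul_apply, neg_apply, ContinuousLinearMap.smulRight_apply,
    innerSL_apply_apply, gradQ, transQ]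
  change (1 / 2 : ℂ) • _ = _
  simp only [Complex.real_smul, smul_eq_mul, mid_add]
  push_cast at f2' ⊢
  -- Both endpoint values are expanded from the midpoint by the fundamental theorem of calculus. The
  -- midpoint value drops out, and the factor σ gained cancels the denominator.
  have g1 : a (mid z φ + sig z φ * dir φ) =
      a (mid z φ) + (sig z φ : ℂ) * avgD a z φ (sig z φ) (dir φ) := by rw [f1']; ring
  have g2 : a (mid z φ + -(sig z φ : ℂ) * dir φ) =
      a (mid z φ) - (sig z φ : ℂ) * avgD a z φ (-sig z φ) (dir φ) := by
    linear_combination -f2'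
  rw [g1, g2]
  simp only [avgD]
  push_cast
  field_simp
  ring

/-! ### Uniform Hölder continuity in the direction -/

/-- Uniform boundedness and `ν`-Hölder continuity in `φ`, for `z ∈ Ω`. -/
def UnifHolder {E : Type*} [NormedAddCommGroup E] (ν : ℝ) (f : ℂ → ℝ → E) : Prop :=
  ∃ B, 0 ≤ B ∧ ∀ z ∈ disc, (∀ φ, ‖f z φ‖ ≤ B) ∧ ∀ φ ψ, ‖f z φ - f z ψ‖ ≤ B * |φ - ψ| ^ ν

namespace UnifHolder

variable {E : Type*} [NormedAddCommGroup E] {f g : ℂ → ℝ → E}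

lemma add (hf : UnifHolder ν f) (hg : UnifHolder ν g) :
    UnifHolder ν fun z φ => f z φ + g z φ := by
  obtain ⟨B, hB, h⟩ := hf
  obtain ⟨C, hC, h'⟩ := hg
  refine ⟨B + C, by positivity, fun z hz => ⟨fun φ => (norm_add_le _ _).trans
    (add_le_add ((h z hz).1 φ) ((h' z hz).1 φ)), fun φ ψ => ?_⟩⟩
  rw [add_sub_add_comm, add_mul]
  exact (norm_add_le _ _).trans (add_le_add ((h z hz).2 φ ψ) ((h' z hz).2 φ ψ))

lemma neg (hf : UnifHolder ν f) : UnifHolder ν fun z φ => -f z φ := by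
  obtain ⟨B, hB, h⟩ := hf
  refine ⟨B, hB, fun z hz => ⟨fun φ => by rw [norm_neg]; exact (h z hz).1 φ, fun φ ψ => ?_⟩⟩
  rw [neg_sub_neg, norm_sub_rev]
  exact (h z hz).2 φ ψ

lemma sub (hf : UnifHolder ν f) (hg : UnifHolder ν g) :
    UnifHolder ν fun z φ => f z φ - g z φ := by
  simpa only [sub_eq_add_neg] using hf.add hg.neg

lemma bilin {F G : Type*} [NormedAddCommGroup F] [NormedAddCommGroup G] [NormedSpace ℝ E]
    [NormedSpace ℝ F] [NormedSpace ℝ G] (L : E →L[ℝ] F →L[ℝ] G) (hL : ∀ x y, ‖L x y‖ ≤ ‖x‖ * ‖y‖)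
    {g : ℂ → ℝ → F} (hf : UnifHolder ν f) (hg : UnifHolder ν g) :
    UnifHolder ν fun z φ => L (f z φ) (g z φ) := by
  obtain ⟨B, hB, h⟩ := hf
  obtain ⟨C, hC, h'⟩ := hg
  refine ⟨2 * (B * C), by positivity, fun z hz => ⟨fun φ => ?_, fun φ ψ => ?_⟩⟩
  · refine (hL _ _).trans ((mul_le_mul ((h z hz).1 φ) ((h' z hz).1 φ) (norm_nonneg _) hB).trans ?_)
    have := mul_nonneg hB hC
    linarith
  · have e : L (f z φ) (g z φ) - L (f z ψ) (g z ψ) =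
        L (f z φ) (g z φ - g z ψ) + L (f z φ - f z ψ) (g z ψ) := by
      simp
    rw [e]
    refine (norm_add_le _ _).trans ?_
    have h1 := (hL (f z φ) (g z φ - g z ψ)).trans
      (mul_le_mul ((h z hz).1 φ) ((h' z hz).2 φ ψ) (norm_nonneg _) hB)
    have h2 := (hL (f z φ - f z ψ) (g z ψ)).trans
      (mul_le_mul ((h z hz).2 φ ψ) ((h' z hz).1 ψ) (norm_nonneg _) (by positivity))
    linarith

lemma mul {f g : ℂ → ℝ → ℂ} (hf : UnifHolder ν f) (hg : UnifHolder ν g) :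
    UnifHolder ν fun z φ => f z φ * g z φ :=
  hf.bilin (ContinuousLinearMap.mul ℝ ℂ) (fun x y => (norm_mul x y).le) hg

lemma apply {f : ℂ → ℝ → ℂ →L[ℝ] ℂ} {g : ℂ → ℝ → ℂ} (hf : UnifHolder ν f)
    (hg : UnifHolder ν g) : UnifHolder ν fun z φ => f z φ (g z φ) :=
  hf.bilin (ContinuousLinearMap.id ℝ (ℂ →L[ℝ] ℂ)) (fun x y => x.le_opNorm y) hg

lemma of_const {c : ℂ → E} {B : ℝ} (h : ∀ z ∈ disc, ‖c z‖ ≤ B) :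
    UnifHolder ν fun z _ => c z :=
  ⟨max B 0, le_max_right _ _, fun z hz => ⟨fun _ => (h z hz).trans (le_max_left _ _),
    fun φ ψ => by simp; positivity⟩⟩

/-- For |φ - ψ| ≤ 1 the Lipschitz bound is the stronger one because ν ≤ 1; for larger distances the
sup bound 2B suffices. -/
lemma of_lipschitz (h0 : 0 ≤ ν) (h1 : ν ≤ 1) {B L : ℝ} (hL0 : 0 ≤ L)
    (hB : ∀ z ∈ disc, ∀ φ, ‖f z φ‖ ≤ B)
    (hL : ∀ z ∈ disc, ∀ φ ψ, ‖f z φ - f z ψ‖ ≤ L * |φ - ψ|) : UnifHolder ν f := by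
  have hB0 : 0 ≤ B := (norm_nonneg _).trans (hB 0 (by simp [mem_disc]) 0)
  refine ⟨L + 2 * B, by positivity, fun z hz => ⟨fun φ => (hB z hz φ).trans (by linarith),
    fun φ ψ => ?_⟩⟩
  rcases le_total |φ - ψ| 1 with h | h
  · have h3 : |φ - ψ| ≤ |φ - ψ| ^ ν := by
      rcases (abs_nonneg (φ - ψ)).eq_or_lt with h4 | h4
      · rw [← h4]; positivity
      · simpa using Real.rpow_le_rpow_of_exponent_ge h4 h h1
    calc _ ≤ L * |φ - ψ| := hL z hz φ ψ
      _ ≤ (L + 2 * B) * |φ - ψ| ^ ν := by gcongr; linarith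
  · have h3 : 1 ≤ |φ - ψ| ^ ν := Real.one_le_rpow h h0
    calc _ ≤ ‖f z φ‖ + ‖f z ψ‖ := norm_sub_le _ _
      _ ≤ 2 * B := by linarith [hB z hz φ, hB z hz ψ]
      _ ≤ (L + 2 * B) * 1 := by linarith
      _ ≤ _ := by gcongr

lemma of_real {r : ℂ → ℝ → ℝ} (h0 : 0 ≤ ν) (h1 : ν ≤ 1) (hB : ∀ z ∈ disc, ∀ φ, |r z φ| ≤ 1)
    (hL : ∀ z ∈ disc, ∀ φ ψ, |r z φ - r z ψ| ≤ |φ - ψ|) :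
    UnifHolder ν fun z φ => (r z φ : ℂ) :=
  of_lipschitz h0 h1 (B := 1) zero_le_one (fun z hz φ => by simpa using hB z hz φ)
    fun z hz φ ψ => by
      rw [← Complex.ofReal_sub, Complex.norm_real, one_mul]; exact hL z hz φ ψ

end UnifHolder

lemma HolderData.unifHolder_avgD (H : HolderData ν K a) {t : ℂ → ℝ → ℝ}
    (hts : ∀ w ∈ disc, ∀ φ, |t w φ| ≤ sig w φ)
    (htL : ∀ w ∈ disc, ∀ φ ψ, |t w φ - t w ψ| ≤ |φ - ψ|) :
    UnifHolder ν fun z φ => avgD a z φ (t z φ) := by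
  have hν : 0 ≤ ν := by linarith [H.half_lt]
  have hK := H.nonneg
  have h4 : (1 : ℝ) ≤ 4 ^ ν := Real.one_le_rpow (by norm_num) hν
  -- The midpoint and the segment vector tθ each move by at most 2|φ - ψ|, whence 4.
  refine ⟨K * 4 ^ ν, by positivity, fun z hz => ⟨fun φ => ?_, fun φ ψ => ?_⟩⟩
  · exact (H.norm_avg_fderiv_le (segIn_mid hz φ (hts z hz φ))).trans
      (le_mul_of_one_le_right hK h4)
  · refine (H.avg_fderiv_sub (segIn_mid hz φ (hts z hz φ)) (segIn_mid hz ψ (hts z hz ψ))).trans ?_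
    rw [mul_assoc, ← Real.mul_rpow (by norm_num) (abs_nonneg _)]
    refine mul_le_mul_of_nonneg_left (Real.rpow_le_rpow (by positivity) ?_ hν) hK
    have h1 := norm_mid_sub_le hz φ ψ
    have h2 := norm_real_mul_sub_le ((hts z hz φ).trans (sig_le_one hz φ)) (htL z hz φ ψ)
      (norm_dir ψ) (norm_dir_sub_le φ ψ)
    linarith

lemma HolderData.unifHolder_chord (H : HolderData ν K a) {t : ℂ → ℝ → ℝ}
    (hts : ∀ w ∈ disc, ∀ φ, |t w φ| ≤ sig w φ)
    (htL : ∀ w ∈ disc, ∀ φ ψ, |t w φ - t w ψ| ≤ |φ - ψ|) :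
    UnifHolder 1 fun z φ => chord a z φ (t z φ) := by
  have hK := H.nonneg
  refine UnifHolder.mul (UnifHolder.of_real zero_le_one le_rfl
    (fun z hz φ => (hts z hz φ).trans (sig_le_one hz φ)) htL)
    (UnifHolder.of_lipschitz zero_le_one le_rfl (B := K) (L := K * 4) (by positivity)
      (fun z hz φ => H.norm_avg_le (segIn_mid hz φ (hts z hz φ))) fun z hz φ ψ => ?_)
  refine (H.avg_sub (segIn_mid hz φ (hts z hz φ)) (segIn_mid hz ψ (hts z hz ψ))).trans ?_
  rw [mul_assoc]
  refine mul_le_mul_of_nonneg_left ?_ hK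
  have h1 := norm_mid_sub_le hz φ ψ
  have h2 := norm_real_mul_sub_le ((hts z hz φ).trans (sig_le_one hz φ)) (htL z hz φ ψ)
    (norm_dir ψ) (norm_dir_sub_le φ ψ)
  linarith

lemma HolderData.unifHolder_qOdd (H : HolderData ν K a) : UnifHolder 1 (qOdd a) := by
  have h1 := H.unifHolder_chord (t := sig) (fun w hw φ => by rw [abs_of_pos (sig_pos hw φ)])
    fun w hw => abs_sig_sub_le hw
  have h2 := H.unifHolder_chord (t := fun z φ => -sig z φ)
    (fun w hw φ => by rw [abs_neg, abs_of_pos (sig_pos hw φ)])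
    fun w hw φ ψ => by rw [neg_sub_neg, abs_sub_comm]; exact abs_sig_sub_le hw φ ψ
  have h3 := H.unifHolder_chord (t := mPar) (fun w hw φ => (abs_mPar_lt_sig hw φ).le)
    fun w hw => abs_mPar_sub_le hw
  exact (UnifHolder.of_const (fun _ _ => le_rfl)).mul
    ((h1.add h2).sub ((UnifHolder.of_const (fun _ _ => le_rfl)).mul h3))

/-- After the cancellation of 1/σ the gradient is a polynomial in Lipschitz functions of the angle,
values of a independent of the angle, and averages of the Hölder derivative of a. -/
lemma HolderData.unifHolder_gradQ (H : HolderData ν K a) (e : ℂ) :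
    UnifHolder ν fun z φ => gradQ a z φ e := by
  have hν : 0 ≤ ν := by linarith [H.half_lt]
  have h1 := H.unifHolder_avgD (t := sig) (fun w hw φ => by rw [abs_of_pos (sig_pos hw φ)])
    fun w hw => abs_sig_sub_le hw
  have h2 := H.unifHolder_avgD (t := fun z φ => -sig z φ)
    (fun w hw φ => by rw [abs_neg, abs_of_pos (sig_pos hw φ)])
    fun w hw φ ψ => by rw [neg_sub_neg, abs_sub_comm]; exact abs_sig_sub_le hw φ ψ
  have h3 := H.unifHolder_avgD (t := mPar) (fun w hw φ => (abs_mPar_lt_sig hw φ).le)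
    fun w hw => abs_mPar_sub_le hw
  have hs : UnifHolder ν fun z φ => (sPar z φ : ℂ) :=
    UnifHolder.of_real hν H.le_one (fun z hz => abs_sPar_le hz) fun z hz => abs_sPar_sub_le hz
  have hm : UnifHolder ν fun z φ => (mPar z φ : ℂ) :=
    UnifHolder.of_real hν H.le_one (fun z hz => abs_mPar_le hz) fun z hz => abs_mPar_sub_le hz
  have hσ : UnifHolder ν fun z φ => (sig z φ : ℂ) :=
    UnifHolder.of_real hν H.le_one
      (fun z hz φ => by rw [abs_of_pos (sig_pos hz φ)]; exact sig_le_one hz φ)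
      fun z hz => abs_sig_sub_le hz
  have hd : UnifHolder ν fun (_ : ℂ) φ => dir φ :=
    UnifHolder.of_lipschitz hν H.le_one zero_le_one (fun _ _ φ => (norm_dir φ).le)
      fun _ _ φ ψ => by rw [one_mul]; exact norm_dir_sub_le φ ψ
  have hp : UnifHolder ν fun (_ : ℂ) φ => dirPerp φ :=
    UnifHolder.of_lipschitz hν H.le_one zero_le_one (fun _ _ φ => (norm_dirPerp φ).le)
      fun _ _ φ ψ => by rw [one_mul]; exact norm_dirPerp_sub_le φ ψ
  have hc : ∀ c : ℂ, UnifHolder ν fun (_ : ℂ) (_ : ℝ) => c :=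
    fun c => UnifHolder.of_const fun _ _ => le_rfl
  have hW : UnifHolder ν (transQ a) :=
    ((hs.neg.mul ((h1.apply hd).add (h2.apply hd))).add
      (hσ.mul ((h1.apply hp).sub (h2.apply hp)))).sub
      ((hc 2).mul (hm.mul (h3.apply hp)))
  have ha : UnifHolder ν fun z (_ : ℝ) => a z :=
    UnifHolder.of_const fun z hz => H.norm_le z (disc_subset hz)
  have hin : ∀ d : ℝ → ℂ, (∀ φ, ‖d φ‖ = 1) → (∀ φ ψ, ‖d φ - d ψ‖ ≤ |φ - ψ|) →
      UnifHolder ν fun (_ : ℂ) φ => ((inner ℝ (d φ) e : ℝ) : ℂ) := by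
    intro d hd1 hd2
    refine UnifHolder.of_lipschitz hν H.le_one (B := ‖e‖) (norm_nonneg e) (fun _ _ φ => ?_)
      fun _ _ φ ψ => ?_
    · rw [Complex.norm_real]
      simpa [hd1] using norm_inner_le_norm (𝕜 := ℝ) (d φ) e
    · rw [← Complex.ofReal_sub, Complex.norm_real, ← inner_sub_left]
      refine (norm_inner_le_norm _ _).trans ?_
      rw [mul_comm]
      exact mul_le_mul_of_nonneg_left (hd2 φ ψ) (norm_nonneg e)
  have := ((hin dirPerp norm_dirPerp norm_dirPerp_sub_le).mul ((hc (1 / 2)).mul hW)).sub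
    ((hin dir norm_dir norm_dir_sub_le).mul ha)
  simpa [gradQ] using this

lemma HolderData.continuousOn_avgD (H : HolderData ν K a) (φ : ℝ) {t : ℂ → ℝ}
    (ht : ContinuousOn t disc) (hts : ∀ w ∈ disc, |t w| ≤ sig w φ) :
    ContinuousOn (fun z => avgD a z φ (t z)) disc := by
  have hν : 0 < ν := by linarith [H.half_lt]
  have hs : Continuous fun z => mid z φ := by
    have := (contDiff_sPar φ).continuous
    unfold mid; fun_prop
  intro z hz
  refine tendsto_iff_norm_sub_tendsto_zero.2 ?_
  have h1 : ContinuousOn (fun w => K * (‖mid w φ - mid z φ‖ +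
      ‖(t w * dir φ : ℂ) - t z * dir φ‖) ^ ν) disc := by
    refine continuousOn_const.mul (ContinuousOn.rpow_const ?_ fun _ _ => Or.inr hν.le)
    exact ((hs.sub continuous_const).norm.continuousOn).add
      ((((Complex.continuous_ofReal.comp_continuousOn ht).mul continuousOn_const).sub
        continuousOn_const).norm)
  have h2 := (h1 z hz).tendsto
  simp only [sub_self, norm_zero, add_zero, Real.zero_rpow hν.ne', mul_zero] at h2
  refine squeeze_zero' (Eventually.of_forall fun _ => norm_nonneg _) ?_ h2
  filter_upwards [self_mem_nhdsWithin] with w hw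
  exact H.avg_fderiv_sub (segIn_mid hw φ (hts w hw)) (segIn_mid hz φ (hts z hz))

lemma HolderData.continuousOn_gradQ (H : HolderData ν K a) (φ : ℝ) :
    ContinuousOn (fun z => gradQ a z φ) disc := by
  have hsg : ContinuousOn (fun z => sig z φ) disc := fun z hz =>
    (hasFDerivAt_sig hz φ).continuousAt.continuousWithinAt
  have h1 := H.continuousOn_avgD φ hsg (fun w hw => by rw [abs_of_pos (sig_pos hw φ)])
  have h2 := H.continuousOn_avgD φ (t := fun z => -sig z φ) hsg.neg
    (fun w hw => by rw [abs_neg, abs_of_pos (sig_pos hw φ)])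
  have hm := (contDiff_mPar φ).continuous.continuousOn (s := disc)
  have h3 := H.continuousOn_avgD φ hm (fun w hw => (abs_mPar_lt_sig hw φ).le)
  have hs := (contDiff_sPar φ).continuous.continuousOn (s := disc)
  have ha := H.continuousOn.mono disc_subset
  have hW : ContinuousOn (fun z => transQ a z φ) disc := by
    unfold transQ
    have hsg' := Complex.continuous_ofReal.comp_continuousOn hsg
    have hs' := Complex.continuous_ofReal.comp_continuousOn hs
    have hm' := Complex.continuous_ofReal.comp_continuousOn hm
    exact ((hs'.neg.mul ((h1.clm_apply continuousOn_const).add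
      (h2.clm_apply continuousOn_const))).add (hsg'.mul ((h1.clm_apply continuousOn_const).sub
      (h2.clm_apply continuousOn_const)))).sub
      (continuousOn_const.mul (hm'.mul (h3.clm_apply continuousOn_const)))
  unfold gradQ
  have hL : ∀ f : ℂ →L[ℝ] ℝ, Continuous fun x : ℂ => f.smulRight x := fun f =>
    (ContinuousLinearMap.smulRightL ℝ ℂ ℂ f).continuous
  exact ((hL _).comp_continuousOn (continuousOn_const.mul hW)).sub ((hL _).comp_continuousOn ha)

end

section

/-! ### Ray integrals -/

variable {ν K : ℝ} {a : ℂ → ℂ} {z : ℂ}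

lemma HolderData.measurable_extendZero (H : HolderData ν K a) : Measurable (extendZero a) := by
  classical
  have := ContinuousOn.measurable_piecewise (f := a) (g := 0) (s := closure disc)
    (closure_disc ▸ H.continuousOn) continuousOn_const isClosed_closure.measurableSet
  rwa [piecewise_eq_indicator] at this

lemma extendZero_of_norm_le {w : ℂ} (hw : ‖w‖ ≤ 1) : extendZero a w = a w := by
  rw [extendZero, indicator_of_mem]; rw [closure_disc]; simpa using hw

lemma extendZero_of_lt_norm {w : ℂ} (hw : 1 < ‖w‖) : extendZero a w = 0 := by
  rw [extendZero, indicator_of_notMem]; rw [closure_disc]; simpa using hw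

lemma HolderData.norm_extendZero_le (H : HolderData ν K a) (w : ℂ) : ‖extendZero a w‖ ≤ K := by
  rcases le_or_gt ‖w‖ 1 with h | h
  · rw [extendZero_of_norm_le h]; exact H.norm_le w (by simpa using h)
  · rw [extendZero_of_lt_norm h, norm_zero]; exact H.nonneg

lemma HolderData.integrable_line (H : HolderData ν K a) (c : ℂ) (φ : ℝ) :
    Integrable fun t : ℝ => extendZero a (c + t * dir φ) := by
  have hsupp : Function.support (fun t : ℝ => extendZero a (c + t * dir φ)) ⊆
      Icc (-(‖c‖ + 1)) (‖c‖ + 1) := by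
    intro t ht
    by_contra hcon
    apply ht
    apply extendZero_of_lt_norm
    have h1 : ‖c‖ + 1 < |t| := by
      rw [lt_abs]; simp only [mem_Icc, not_and_or, not_le] at hcon
      rcases hcon with h | h
      · right; linarith
      · left; exact h
    have h2 := norm_sub_norm_le (t * dir φ) (-c)
    rw [norm_mul, norm_dir, mul_one, Complex.norm_real, Real.norm_eq_abs, norm_neg,
      sub_neg_eq_add, add_comm (_ * _)] at h2
    linarith
  rw [← integrableOn_iff_integrable_of_support_subset hsupp]
  refine IntegrableOn.of_bound (C := K) (by simp) ?_
    (ae_of_all _ fun t => H.norm_extendZero_le _)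
  exact (H.measurable_extendZero.comp (by fun_prop)).aestronglyMeasurable

lemma norm_mid_add (z : ℂ) (φ t : ℝ) : ‖mid z φ + t * dir φ‖ ^ 2 = sPar z φ ^ 2 + t ^ 2 :=
  normSq_frame _ _ _

lemma extendZero_line_of_le (hz : z ∈ disc) (φ : ℝ) {t : ℝ} (ht : |t| ≤ sig z φ) :
    extendZero a (mid z φ + t * dir φ) = a (mid z φ + t * dir φ) := by
  apply extendZero_of_norm_le
  rw [← sq_le_one_iff₀ (norm_nonneg _), norm_mid_add]
  have := sig_sq hz φ
  have := sq_le_sq' (abs_le.1 ht).1 (abs_le.1 ht).2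
  linarith

lemma extendZero_line_of_lt (hz : z ∈ disc) (φ : ℝ) {t : ℝ} (ht : sig z φ < |t|) :
    extendZero a (mid z φ + t * dir φ) = 0 := by
  apply extendZero_of_lt_norm
  rw [← one_lt_sq_iff₀ (norm_nonneg _), norm_mid_add]
  have := sig_sq hz φ
  have h2 := sig_pos hz φ
  have : sig z φ ^ 2 < t ^ 2 := by rw [← sq_abs t]; gcongr
  linarith

lemma chord_eq_integral (hz : z ∈ disc) (φ : ℝ) {t : ℝ} (ht : |t| ≤ sig z φ) :
    chord a z φ t = ∫ x in (0 : ℝ)..t, extendZero a (mid z φ + x * dir φ) := by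
  have h1 := intervalIntegral.smul_integral_comp_mul_left (a := 0) (b := 1)
    (fun x : ℝ => extendZero a (mid z φ + x * dir φ)) t
  rw [mul_zero, mul_one] at h1
  rw [← h1, chord, avg, Complex.real_smul]
  congr 1
  refine intervalIntegral.integral_congr fun r hr => ?_
  rw [uIcc_of_le zero_le_one] at hr
  have h2 : |t * r| ≤ sig z φ := by
    rw [abs_mul, abs_of_nonneg hr.1]
    exact (mul_le_of_le_one_right (abs_nonneg t) hr.2).trans ht
  have h3 := extendZero_line_of_le (a := a) hz φ h2
  push_cast at h3 ⊢
  rw [h3]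
  ring_nf

lemma HolderData.integral_Ioi_line (H : HolderData ν K a) (hz : z ∈ disc) (φ : ℝ) {t : ℝ}
    (ht : |t| ≤ sig z φ) :
    ∫ x in Ioi t, extendZero a (mid z φ + x * dir φ) =
      chord a z φ (sig z φ) - chord a z φ t := by
  have hi := H.integrable_line (mid z φ) φ
  have hσ := sig_pos hz φ
  have hts : t ≤ sig z φ := (le_abs_self t).trans ht
  rw [chord_eq_integral hz φ (abs_of_pos hσ).le, chord_eq_integral hz φ ht,
    intervalIntegral.integral_interval_sub_left hi.intervalIntegrable hi.intervalIntegrable,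
    intervalIntegral.integral_of_le hts]
  refine (setIntegral_eq_of_subset_of_forall_sdiff_eq_zero measurableSet_Ioi
    Ioc_subset_Ioi_self fun x hx => ?_)
  apply extendZero_line_of_lt hz
  have h1 : sig z φ < x := by
    by_contra hcon
    exact hx.2 ⟨hx.1, not_lt.1 hcon⟩
  exact h1.trans_le (le_abs_self x)

lemma HolderData.rayIntegral_eq (H : HolderData ν K a) (hz : z ∈ disc) (φ : ℝ) :
    rayIntegral a z φ = chord a z φ (sig z φ) - chord a z φ (mPar z φ) := by
  rw [← H.integral_Ioi_line hz φ (abs_mPar_lt_sig hz φ).le, rayIntegral]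
  have := (measurePreserving_add_right volume (mPar z φ)).setIntegral_preimage_emb
    (measurableEmbedding_addRight _) (fun x : ℝ => extendZero a (mid z φ + x * dir φ))
    (Ioi (mPar z φ))
  rw [← this, preimage_add_const_Ioi, sub_self]
  refine setIntegral_congr_fun measurableSet_Ioi fun t _ => ?_
  congr 1
  conv_lhs => rw [← mid_add z φ]
  push_cast; ring

lemma HolderData.radon_eq (H : HolderData ν K a) (hz : z ∈ disc) (φ : ℝ) :
    radon a φ (sPar z φ) = chord a z φ (sig z φ) - chord a z φ (-sig z φ) := by
  have hσ := sig_pos hz φ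
  rw [← H.integral_Ioi_line hz φ (by rw [abs_neg, abs_of_pos hσ]), radon,
    ← integral_Ici_eq_integral_Ioi]
  symm
  refine setIntegral_eq_integral_of_forall_compl_eq_zero fun x hx => ?_
  apply extendZero_line_of_lt hz
  simp only [mem_Ici, not_le] at hx
  rw [lt_abs]; right; linarith

/-- The Radon transform along the line through z is the sum of the two opposite ray integrals from
z. Subtracting half of it leaves half their difference, the part that changes sign with θ. -/
lemma HolderData.rayIntegral_sub_radon (H : HolderData ν K a) (hz : z ∈ disc) (φ : ℝ) :
    rayIntegral a z φ - (1 / 2) * radon a φ (sPar z φ) = qOdd a z φ := by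
  rw [H.rayIntegral_eq hz, H.radon_eq hz, qOdd]; ring

lemma dir_add_pi (φ : ℝ) : dir (φ + Real.pi) = -dir φ := by
  simp only [dir]; push_cast; rw [add_mul, Complex.exp_add, Complex.exp_pi_mul_I]; ring

lemma dirPerp_add_pi (φ : ℝ) : dirPerp (φ + Real.pi) = -dirPerp φ := by
  simp [dirPerp, dir_add_pi]

lemma sPar_add_pi (z : ℂ) (φ : ℝ) : sPar z (φ + Real.pi) = -sPar z φ := by
  simp [sPar, dirPerp_add_pi]

lemma mPar_add_pi (z : ℂ) (φ : ℝ) : mPar z (φ + Real.pi) = -mPar z φ := by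
  simp [mPar, dir_add_pi]

lemma sig_add_pi (z : ℂ) (φ : ℝ) : sig z (φ + Real.pi) = sig z φ := by
  simp [sig, sPar_add_pi]

lemma mid_add_pi (z : ℂ) (φ : ℝ) : mid z (φ + Real.pi) = mid z φ := by
  simp [mid, sPar_add_pi, dirPerp_add_pi]

lemma chord_add_pi (z : ℂ) (φ t : ℝ) : chord a z (φ + Real.pi) t = -chord a z φ (-t) := by
  simp [chord, mid_add_pi, dir_add_pi]

lemma qOdd_add_pi (z : ℂ) (φ : ℝ) : qOdd a z (φ + Real.pi) = -qOdd a z φ := by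
  simp only [qOdd, chord_add_pi, sig_add_pi, mPar_add_pi, neg_neg]; ring

lemma qOdd_periodic (z : ℂ) : Function.Periodic (qOdd a z) (2 * Real.pi) := fun φ => by
  rw [two_mul, ← add_assoc, qOdd_add_pi, qOdd_add_pi, neg_neg]

lemma HolderData.rayIntegral_sub_opposite (H : HolderData ν K a) (hz : z ∈ disc) (φ : ℝ) :
    rayIntegral a z φ - rayIntegral a z (φ + Real.pi) = 2 * qOdd a z φ := by
  rw [H.rayIntegral_eq hz, H.rayIntegral_eq hz, qOdd]
  simp only [chord_add_pi, sig_add_pi, mPar_add_pi, neg_neg]; ring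

/-- The ray integral starting at distance `δ`. -/
def rayCut (a : ℂ → ℂ) (z : ℂ) (φ δ : ℝ) : ℂ := ∫ r in Ioi δ, extendZero a (z + r * dir φ)

lemma HolderData.norm_rayIntegral_sub_rayCut_le (H : HolderData ν K a) (z : ℂ) (φ : ℝ) {δ : ℝ}
    (hδ : 0 ≤ δ) : ‖rayIntegral a z φ - rayCut a z φ δ‖ ≤ K * δ := by
  have hi := H.integrable_line z φ
  rw [rayIntegral, rayCut, intervalIntegral.integral_Ioi_sub_Ioi hi.integrableOn hδ]
  have := intervalIntegral.norm_integral_le_of_norm_le_const (a := 0) (b := δ) (C := K)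
    (f := fun r : ℝ => extendZero a (z + r * dir φ)) fun r _ => H.norm_extendZero_le _
  simpa [abs_of_nonneg hδ] using this

/-- The ray from z leaves the closed disc at distance σ - z·θ. Where both rays are inside, a is
Lipschitz and r ≤ 2; where only one is inside, r lies between the two exit distances and the jump is
at most K. -/
lemma HolderData.norm_extendZero_ray_sub_le (H : HolderData ν K a) (hz : z ∈ disc) (φ ψ : ℝ)
    {r : ℝ} (hr : 0 < r) :
    ‖extendZero a (z + r * dir φ) - extendZero a (z + r * dir ψ)‖ ≤
      (Ioc (0 : ℝ) 2).indicator (fun _ => 2 * K * |φ - ψ|) r +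
      (uIcc (sig z φ - mPar z φ) (sig z ψ - mPar z ψ)).indicator (fun _ => K) r := by
  have hK := H.nonneg
  have hline : ∀ φ, z + r * dir φ = mid z φ + ((r + mPar z φ : ℝ) : ℂ) * dir φ := fun φ => by
    conv_lhs => rw [← mid_add z φ]
    push_cast; ring
  have hin : ∀ φ, r ≤ sig z φ - mPar z φ → ‖z + r * dir φ‖ ≤ 1 := fun φ h => by
    have h1 := (abs_lt.1 (abs_mPar_lt_sig hz φ)).1
    have hs := sig_sq hz φ
    rw [← sq_le_one_iff₀ (norm_nonneg _), hline, norm_mid_add]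
    nlinarith
  have hout : ∀ φ, sig z φ - mPar z φ < r → extendZero a (z + r * dir φ) = 0 := fun φ h => by
    rw [hline]
    exact extendZero_line_of_lt hz φ ((by linarith : _ < r + mPar z φ).trans_le (le_abs_self _))
  have n1 : 0 ≤ (Ioc (0 : ℝ) 2).indicator (fun _ => 2 * K * |φ - ψ|) r :=
    indicator_nonneg (fun _ _ => by positivity) _
  have n2 : 0 ≤ (uIcc (sig z φ - mPar z φ) (sig z ψ - mPar z ψ)).indicator (fun _ => K) r :=
    indicator_nonneg (fun _ _ => hK) _
  rcases le_or_gt r (sig z φ - mPar z φ) with h1 | h1 <;>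
    rcases le_or_gt r (sig z ψ - mPar z ψ) with h2 | h2
  · have hr2 : r ≤ 2 := by
      have := sig_le_one hz φ
      have := (abs_le.1 (abs_mPar_le hz φ)).1
      linarith
    rw [indicator_of_mem (show r ∈ Ioc (0 : ℝ) 2 from ⟨hr, hr2⟩)]
    refine le_trans ?_ (le_add_of_nonneg_right n2)
    rw [extendZero_of_norm_le (hin φ h1), extendZero_of_norm_le (hin ψ h2)]
    refine (H.lipschitz _ (by simpa using hin φ h1) _ (by simpa using hin ψ h2)).trans ?_
    rw [add_sub_add_left_eq_sub, ← mul_sub, norm_mul, Complex.norm_real, Real.norm_of_nonneg hr.le]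
    have := norm_dir_sub_le φ ψ
    calc K * (r * ‖dir φ - dir ψ‖) ≤ K * (2 * |φ - ψ|) := by gcongr
      _ = _ := by ring
  · rw [indicator_of_mem (show r ∈ uIcc (sig z φ - mPar z φ) (sig z ψ - mPar z ψ) from
      mem_uIcc.2 (Or.inr ⟨h2.le, h1⟩)), hout ψ h2, sub_zero]
    exact (H.norm_extendZero_le _).trans (le_add_of_nonneg_left n1)
  · rw [indicator_of_mem (show r ∈ uIcc (sig z φ - mPar z φ) (sig z ψ - mPar z ψ) from
      mem_uIcc.2 (Or.inl ⟨h1.le, h2⟩)), hout φ h1, zero_sub, norm_neg]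
    exact (H.norm_extendZero_le _).trans (le_add_of_nonneg_left n1)
  · rw [hout φ h1, hout ψ h2, sub_zero, norm_zero]
    positivity

/-- Integrating the pointwise bound gives 4K|φ - ψ| from the common range and 2K|φ - ψ| from the
exit distances. Linearity in the angle, uniformly in δ, is what absorbs the 1/sin ω singularity of
the Hilbert kernel. -/
lemma HolderData.norm_rayCut_sub_le (H : HolderData ν K a) (hz : z ∈ disc) (φ ψ : ℝ) {δ : ℝ}
    (hδ : 0 ≤ δ) : ‖rayCut a z φ δ - rayCut a z ψ δ‖ ≤ 6 * K * |φ - ψ| := by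
  have hK := H.nonneg
  rw [rayCut, rayCut, ← integral_sub (H.integrable_line z φ).integrableOn
    (H.integrable_line z ψ).integrableOn]
  set b : ℝ → ℝ := fun r => (Ioc (0 : ℝ) 2).indicator (fun _ => 2 * K * |φ - ψ|) r +
      (uIcc (sig z φ - mPar z φ) (sig z ψ - mPar z ψ)).indicator (fun _ => K) r with hb
  have i1 : Integrable ((Ioc (0 : ℝ) 2).indicator (fun _ => 2 * K * |φ - ψ|)) :=
    (integrable_indicator_iff measurableSet_Ioc).2
      (integrableOn_const measure_Ioc_lt_top.ne)
  have i2 : Integrable ((uIcc (sig z φ - mPar z φ) (sig z ψ - mPar z ψ)).indicator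
      (fun _ => K)) := (integrable_indicator_iff measurableSet_uIcc).2
      (integrableOn_const isCompact_uIcc.measure_lt_top.ne)
  have hbi : Integrable b := i1.add i2
  have h1 : ‖∫ r in Ioi δ, extendZero a (z + r * dir φ) - extendZero a (z + r * dir ψ)‖ ≤
      ∫ r in Ioi δ, b r := by
    refine norm_integral_le_of_norm_le hbi.integrableOn ?_
    exact (ae_restrict_iff' measurableSet_Ioi).2 (ae_of_all _ fun r hr =>
      H.norm_extendZero_ray_sub_le hz φ ψ (hδ.trans_lt hr))
  have h2 : ∫ r in Ioi δ, b r ≤ ∫ r, b r :=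
    setIntegral_le_integral hbi (ae_of_all _ fun r => add_nonneg
      (indicator_nonneg (fun _ _ => by positivity) _) (indicator_nonneg (fun _ _ => hK) _))
  refine h1.trans (h2.trans ?_)
  rw [integral_add i1 i2, integral_indicator measurableSet_Ioc,
    integral_indicator measurableSet_uIcc]
  simp only [integral_const, measureReal_restrict_apply_univ, Real.volume_real_Ioc, sub_zero,
    smul_eq_mul, Real.volume_real_interval]
  have h3 := abs_sig_sub_le hz ψ φ
  have h4 := abs_mPar_sub_le hz ψ φ
  rw [abs_sub_comm ψ φ] at h3 h4
  have h5 : |sig z ψ - mPar z ψ - (sig z φ - mPar z φ)| ≤ 2 * |φ - ψ| := by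
    have := abs_sub (sig z ψ - sig z φ) (mPar z ψ - mPar z φ)
    have e : sig z ψ - mPar z ψ - (sig z φ - mPar z φ) =
      (sig z ψ - sig z φ) - (mPar z ψ - mPar z φ) := by ring
    rw [e]; linarith
  rw [max_eq_left (by norm_num)]
  nlinarith [mul_le_mul_of_nonneg_right h5 hK]

end

section

/-! ### The Hilbert transform of the Radon transform in polar coordinates -/

variable {ν K : ℝ} {a : ℂ → ℂ} {z : ℂ}

/-- The truncated kernel of the Hilbert transform of the Radon transform. -/
def cutKernel (a : ℂ → ℂ) (z : ℂ) (φ ε : ℝ) (p : ℝ × ℝ) : ℂ :=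
  {p : ℝ × ℝ | ε < |p.2|}.indicator
    (fun p => extendZero a (z + (p.1 + p.2 * Complex.I) * dir φ) / p.2) p

lemma HolderData.measurable_cutKernel (H : HolderData ν K a) (z : ℂ) (φ ε : ℝ) :
    Measurable (cutKernel a z φ ε) := by
  refine Measurable.indicator ?_ (measurableSet_lt measurable_const (by fun_prop))
  exact (H.measurable_extendZero.comp (by fun_prop)).div (by fun_prop)

lemma HolderData.norm_cutKernel_le (H : HolderData ν K a) (z : ℂ) (φ : ℝ) {ε : ℝ} (hε : 0 < ε)
    (p : ℝ × ℝ) : ‖cutKernel a z φ ε p‖ ≤ K / ε := by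
  have hK := H.nonneg
  by_cases hp : ε < |p.2|
  · rw [cutKernel, indicator_of_mem (show p ∈ {p : ℝ × ℝ | ε < |p.2|} from hp), norm_div,
      Complex.norm_real, Real.norm_eq_abs]
    exact div_le_div₀ hK (H.norm_extendZero_le _) hε hp.le
  · rw [cutKernel, indicator_of_notMem (show p ∉ {p : ℝ × ℝ | ε < |p.2|} from hp), norm_zero]
    positivity

lemma cutKernel_eq_zero (hz : z ∈ disc) (φ ε : ℝ) {p : ℝ × ℝ}
    (hp : 2 < ‖(p.1 + p.2 * Complex.I : ℂ)‖) : cutKernel a z φ ε p = 0 := by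
  have : extendZero a (z + (p.1 + p.2 * Complex.I) * dir φ) = 0 := by
    apply extendZero_of_lt_norm
    have h2 := norm_sub_norm_le ((p.1 + p.2 * Complex.I : ℂ) * dir φ) (-z)
    rw [norm_mul, norm_dir, mul_one, norm_neg, sub_neg_eq_add, add_comm (_ * _)] at h2
    have := mem_disc.1 hz
    linarith
  simp [cutKernel, indicator_apply, this]

lemma HolderData.integrable_cutKernel (H : HolderData ν K a) (hz : z ∈ disc) (φ : ℝ) {ε : ℝ}
    (hε : 0 < ε) : Integrable (cutKernel a z φ ε) := by
  have hsupp : Function.support (cutKernel a z φ ε) ⊆ Icc (-2) 2 ×ˢ Icc (-2) 2 := by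
    intro p hp
    have h1 : ‖(p.1 + p.2 * Complex.I : ℂ)‖ ≤ 2 := by
      by_contra hcon
      exact hp (cutKernel_eq_zero hz φ ε (not_le.1 hcon))
    have h2 := (Complex.abs_re_le_norm _).trans h1
    have h3 := (Complex.abs_im_le_norm _).trans h1
    simp at h2 h3
    exact ⟨abs_le.1 h2, abs_le.1 h3⟩
  rw [← integrableOn_iff_integrable_of_support_subset hsupp]
  refine IntegrableOn.of_bound (C := K / ε)
    ((isCompact_Icc.prod isCompact_Icc).measure_lt_top) ?_
    (ae_of_all _ fun p => H.norm_cutKernel_le z φ hε p)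
  exact (H.measurable_cutKernel z φ ε).aestronglyMeasurable

/-- Fubini in the orthonormal frame (θ, θ^⊥) centred at z. With t = s + y the kernel 1/(s - t) is
-1/y, hence the sign. -/
lemma HolderData.truncated_hilbert_eq (H : HolderData ν K a) (hz : z ∈ disc) (φ : ℝ) {ε : ℝ}
    (hε : 0 < ε) :
    ∫ t in {t : ℝ | ε < |sPar z φ - t|}, radon a φ t / ((sPar z φ - t : ℝ) : ℂ) =
      -∫ p, cutKernel a z φ ε p := by
  have hmeas : MeasurableSet {t : ℝ | ε < |sPar z φ - t|} :=
    measurableSet_lt measurable_const (by fun_prop)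
  rw [← integral_indicator hmeas, ← integral_add_left_eq_self _ (sPar z φ), Measure.volume_eq_prod,
    integral_prod_symm _ (H.integrable_cutKernel hz φ hε), ← integral_neg]
  congr 1
  funext y
  by_cases hy : ε < |y|
  · rw [indicator_of_mem (by simpa using hy)]
    have h1 : radon a φ (sPar z φ + y) =
        ∫ x : ℝ, extendZero a (z + (x + y * Complex.I) * dir φ) := by
      rw [radon, ← integral_add_right_eq_self _ (mPar z φ)]
      congr 1
      funext x
      congr 1
      conv_rhs => rw [← mid_add z φ]
      simp only [mid, dirPerp]
      push_cast; ring
    rw [h1]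
    simp only [cutKernel]
    have h2 : ∀ x : ℝ, (x, y) ∈ {p : ℝ × ℝ | ε < |p.2|} := fun x => hy
    simp only [indicator_of_mem (h2 _), integral_div]
    push_cast
    rw [sub_add_cancel_left, div_neg]
  · rw [indicator_of_notMem (by simpa using hy)]
    have h2 : ∀ x : ℝ, (x, y) ∉ {p : ℝ × ℝ | ε < |p.2|} := fun x => hy
    simp only [cutKernel, indicator_of_notMem (h2 _), integral_zero, neg_zero]

lemma dir_add (φ ω : ℝ) : dir (φ + ω) = (Real.cos ω + Real.sin ω * Complex.I) * dir φ := by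
  rw [← dir_eq, dir, dir, dir, ← Complex.exp_add]; congr 1; push_cast; ring

/-- The Jacobian r cancels against the kernel 1/(r sin ω), and the cut |y| > ε becomes r > ε/|sin
ω|. -/
lemma integral_polar_cutKernel (z : ℂ) (φ : ℝ) {ε : ℝ} (hε : 0 < ε) (ω : ℝ) :
    ∫ r in Ioi (0 : ℝ), r • cutKernel a z φ ε (r * Real.cos ω, r * Real.sin ω) =
      ((Real.sin ω)⁻¹ : ℝ) * rayCut a z (φ + ω) (ε / |Real.sin ω|) := by
  rcases eq_or_ne (Real.sin ω) 0 with h0 | h0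
  -- In the directions with sin ω = 0 the truncation removes the whole ray, and `0⁻¹ = 0` makes the
  -- right side vanish too.
  · simp [h0, cutKernel, hε.le]
  have hpos : 0 < |Real.sin ω| := abs_pos.2 h0
  have h1 : ∀ r ∈ Ioi (0 : ℝ), r • cutKernel a z φ ε (r * Real.cos ω, r * Real.sin ω) =
      (Ioi (ε / |Real.sin ω|)).indicator
        (fun r : ℝ => ((Real.sin ω)⁻¹ : ℝ) * extendZero a (z + r * dir (φ + ω))) r := by
    intro r hr
    have hr0 : 0 < r := hr
    have hiff : (r * Real.cos ω, r * Real.sin ω) ∈ {p : ℝ × ℝ | ε < |p.2|} ↔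
        r ∈ Ioi (ε / |Real.sin ω|) := by
      simp only [mem_ofPred_eq, mem_Ioi]
      rw [abs_mul, abs_of_pos hr0, div_lt_iff₀ hpos]
    rw [cutKernel]
    by_cases hm : r ∈ Ioi (ε / |Real.sin ω|)
    · rw [indicator_of_mem hm, indicator_of_mem (hiff.2 hm)]
      have e : (z + ((r * Real.cos ω : ℝ) + (r * Real.sin ω : ℝ) * Complex.I) * dir φ : ℂ) =
          z + r * dir (φ + ω) := by rw [dir_add]; push_cast; ring
      simp only [e, Complex.real_smul]
      have hr' : (r : ℂ) ≠ 0 := by exact_mod_cast hr0.ne'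
      have hs' : ((Real.sin ω : ℝ) : ℂ) ≠ 0 := by exact_mod_cast h0
      rw [Complex.ofReal_inv, Complex.ofReal_mul]
      field_simp
    · rw [indicator_of_notMem hm, indicator_of_notMem (mt hiff.1 hm), smul_zero]
  rw [setIntegral_congr_fun measurableSet_Ioi h1, setIntegral_indicator measurableSet_Ioi,
    inter_eq_right.2 (Ioi_subset_Ioi (by positivity)), integral_const_mul, rayCut]

/-- The integrand, in the angular variable, of the truncated Hilbert transform. -/
def angular (a : ℂ → ℂ) (z : ℂ) (φ ε ω : ℝ) : ℂ :=
  ((Real.sin ω)⁻¹ : ℝ) * rayCut a z (φ + ω) (ε / |Real.sin ω|)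

lemma HolderData.integral_cutKernel (H : HolderData ν K a) (hz : z ∈ disc) (φ : ℝ) {ε : ℝ}
    (hε : 0 < ε) :
    IntervalIntegrable (angular a z φ ε) volume (-Real.pi) Real.pi ∧
    ∫ p, cutKernel a z φ ε p = ∫ ω in (-Real.pi)..Real.pi, angular a z φ ε ω := by
  have hK := H.nonneg
  set Q : ℝ × ℝ → ℂ := fun p => p.1 • cutKernel a z φ ε (p.1 * Real.cos p.2, p.1 * Real.sin p.2)
    with hQ
  have hQm : Measurable Q :=
    measurable_fst.smul ((H.measurable_cutKernel z φ ε).comp (by fun_prop))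
  have hQi : Integrable Q
      ((volume.restrict (Ioi (0 : ℝ))).prod (volume.restrict (Ioo (-Real.pi) Real.pi))) := by
    rw [Measure.prod_restrict]
    have hsub : (Ioc (0 : ℝ) 2) ×ˢ (Ioo (-Real.pi) Real.pi) ⊆
        (Ioi (0 : ℝ)) ×ˢ (Ioo (-Real.pi) Real.pi) := prod_mono Ioc_subset_Ioi_self le_rfl
    have hz0 : ∀ p ∈ ((Ioi (0 : ℝ)) ×ˢ (Ioo (-Real.pi) Real.pi)) \
        ((Ioc (0 : ℝ) 2) ×ˢ (Ioo (-Real.pi) Real.pi)), Q p = 0 := by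
      intro p hp
      have hp1 : 2 < p.1 := by
        by_contra hcon
        exact hp.2 ⟨⟨hp.1.1, not_lt.1 hcon⟩, hp.1.2⟩
      have : ‖(((p.1 * Real.cos p.2 : ℝ) : ℂ) + ((p.1 * Real.sin p.2 : ℝ) : ℂ) * Complex.I)‖ =
          p.1 := by
        have e : (((p.1 * Real.cos p.2 : ℝ) : ℂ) + ((p.1 * Real.sin p.2 : ℝ) : ℂ) * Complex.I) =
          p.1 * dir p.2 := by rw [dir_eq]; push_cast; ring
        rw [e, norm_mul, norm_dir, mul_one, Complex.norm_real, Real.norm_of_nonneg (by linarith)]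
      simp only [hQ]
      rw [cutKernel_eq_zero hz φ ε (by rw [this]; exact hp1), smul_zero]
    refine (IntegrableOn.of_bound (C := 2 * (K / ε)) (s := (Ioc (0 : ℝ) 2) ×ˢ
      (Ioo (-Real.pi) Real.pi)) ?_ hQm.aestronglyMeasurable ?_).of_forall_sdiff_eq_zero
      (measurableSet_Ioi.prod measurableSet_Ioo) hz0
    · rw [Measure.prod_prod]
      exact ENNReal.mul_lt_top measure_Ioc_lt_top measure_Ioo_lt_top
    · refine (ae_restrict_iff' (measurableSet_Ioc.prod measurableSet_Ioo)).2
        (ae_of_all _ fun p hp => ?_)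
      rw [hQ, norm_smul, Real.norm_of_nonneg hp.1.1.le]
      exact mul_le_mul hp.1.2 (H.norm_cutKernel_le z φ hε _) (norm_nonneg _) (by norm_num)
  have hle : -Real.pi ≤ Real.pi := by linarith [Real.pi_pos]
  have hint := hQi.integral_prod_right
  have hang : (fun ω => ∫ r in Ioi (0 : ℝ), Q (r, ω)) = angular a z φ ε :=
    funext fun ω => integral_polar_cutKernel z φ hε ω
  rw [hang] at hint
  refine ⟨(intervalIntegrable_iff_integrableOn_Ioo_of_le hle).2 hint, ?_⟩
  rw [← integral_comp_polarCoord_symm, intervalIntegral.integral_of_le hle,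
    integral_Ioc_eq_integral_Ioo, ← hang]
  change ∫ p in (Ioi (0 : ℝ)) ×ˢ (Ioo (-Real.pi) Real.pi), Q p = _
  rw [Measure.volume_eq_prod, ← Measure.prod_restrict, integral_prod_symm _ hQi]

/-- Folding collects the four angles ±ω and ±(π - ω), which share |sin ω|, so that the opposite
signs of 1/sin cancel near 0 and near ±π at once. -/
lemma integral_neg_pi_pi {g : ℝ → ℂ} (hg : IntervalIntegrable g volume (-Real.pi) Real.pi) :
    IntervalIntegrable (fun ω => g ω + g (-ω) + (g (Real.pi - ω) + g (ω - Real.pi)))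
      volume 0 (Real.pi / 2) ∧
    ∫ ω in (-Real.pi)..Real.pi, g ω =
      ∫ ω in (0 : ℝ)..(Real.pi / 2), (g ω + g (-ω) + (g (Real.pi - ω) + g (ω - Real.pi))) := by
  have hpi := Real.pi_pos
  have sub : ∀ c d : ℝ, c ∈ Icc (-Real.pi) Real.pi → d ∈ Icc (-Real.pi) Real.pi →
      IntervalIntegrable g volume c d := fun c d hc hd => by
    refine hg.mono_set ?_
    rw [uIcc_of_le (a := -Real.pi) (by linarith)]
    exact uIcc_subset_Icc hc hd
  have i1 := sub (-Real.pi) (-(Real.pi / 2)) ⟨by linarith, by linarith⟩ ⟨by linarith, by linarith⟩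
  have i2 := sub (-(Real.pi / 2)) 0 ⟨by linarith, by linarith⟩ ⟨by linarith, by linarith⟩
  have i3 := sub 0 (Real.pi / 2) ⟨by linarith, by linarith⟩ ⟨by linarith, by linarith⟩
  have i4 := sub (Real.pi / 2) Real.pi ⟨by linarith, by linarith⟩ ⟨by linarith, by linarith⟩
  have j2 : IntervalIntegrable (fun ω => g (-ω)) volume 0 (Real.pi / 2) := by
    have := i2.symm.comp_sub_left 0
    simpa using this
  have j4 : IntervalIntegrable (fun ω => g (Real.pi - ω)) volume 0 (Real.pi / 2) := by
    have := i4.symm.comp_sub_left Real.pi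
    rw [sub_self] at this
    convert! this using 1
    ring
  have j1 : IntervalIntegrable (fun ω => g (ω - Real.pi)) volume 0 (Real.pi / 2) := by
    have := i1.comp_sub_right Real.pi
    rw [neg_add_cancel] at this
    convert! this using 1
    ring
  refine ⟨(i3.add j2).add (j4.add j1), ?_⟩
  rw [intervalIntegral.integral_add (i3.add j2) (j4.add j1), intervalIntegral.integral_add i3 j2,
    intervalIntegral.integral_add j4 j1, intervalIntegral.integral_comp_neg,
    intervalIntegral.integral_comp_sub_left, intervalIntegral.integral_comp_sub_right,
    ← intervalIntegral.integral_add_adjacent_intervals i1 (i2.trans (i3.trans i4)),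
    ← intervalIntegral.integral_add_adjacent_intervals i2 (i3.trans i4),
    ← intervalIntegral.integral_add_adjacent_intervals i3 i4]
  have e1 : Real.pi - Real.pi / 2 = Real.pi / 2 := by ring
  have e2 : Real.pi / 2 - Real.pi = -(Real.pi / 2) := by ring
  rw [e1, e2, neg_zero, zero_sub, sub_zero]
  ring

/-- The conjugate function of `qOdd`, up to a constant. -/
def conjQ (a : ℂ → ℂ) (z : ℂ) (φ : ℝ) : ℂ :=
  ∫ ω in (0 : ℝ)..(Real.pi / 2), ((Real.sin ω)⁻¹ : ℝ) * (qOdd a z (φ + ω) - qOdd a z (φ - ω))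

lemma inv_sin_mul_le {ω : ℝ} (hω : ω ∈ Ioc 0 (Real.pi / 2)) :
    (Real.sin ω)⁻¹ * ω ≤ Real.pi / 2 := by
  have h1 := Real.mul_le_sin hω.1.le hω.2
  have h2 : 0 < Real.sin ω := Real.sin_pos_of_pos_of_lt_pi hω.1 (by linarith [hω.2, Real.pi_pos])
  rw [inv_mul_le_iff₀ h2]
  have := Real.pi_pos
  calc ω = (2 / Real.pi * ω) * (Real.pi / 2) := by field_simp
    _ ≤ _ := by gcongr

/-- After folding, the integrand is 1/sin ω times differences of rays at φ ± ω and at the opposite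
directions. As ε → 0, opposite rays combine into 2q, and domination legitimises the limit. -/
lemma HolderData.tendsto_truncated (H : HolderData ν K a) (hz : z ∈ disc) (φ : ℝ) :
    Tendsto (fun ε : ℝ => ∫ ω in (-Real.pi)..Real.pi, angular a z φ ε ω) (𝓝[>] 0)
      (𝓝 (2 * conjQ a z φ)) := by
  have hK := H.nonneg
  have hpi := Real.pi_pos
  have hang : ∀ ε, ∀ ω ∈ Ioc 0 (Real.pi / 2),
      angular a z φ ε ω + angular a z φ ε (-ω) +
        (angular a z φ ε (Real.pi - ω) + angular a z φ ε (ω - Real.pi)) =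
      ((Real.sin ω)⁻¹ : ℝ) * ((rayCut a z (φ + ω) (ε / Real.sin ω) -
        rayCut a z (φ - ω) (ε / Real.sin ω)) + (rayCut a z (φ - ω + Real.pi) (ε / Real.sin ω) -
        rayCut a z (φ + ω + Real.pi) (ε / Real.sin ω))) := by
    intro ε ω hω
    have h2 : 0 < Real.sin ω := Real.sin_pos_of_pos_of_lt_pi hω.1 (by linarith [hω.2])
    have e1 : φ + (Real.pi - ω) = φ - ω + Real.pi := by ring
    have e2 : rayCut a z (φ + (ω - Real.pi)) = rayCut a z (φ + ω + Real.pi) := by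
      funext δ
      have : dir (φ + (ω - Real.pi)) = dir (φ + ω + Real.pi) := by
        rw [dir_add_pi, ← neg_eq_iff_eq_neg, ← dir_add_pi]; congr 1; ring
      simp only [rayCut, this]
    have e3 : Real.sin (ω - Real.pi) = -Real.sin ω := Real.sin_sub_pi ω
    simp only [angular, Real.sin_neg, Real.sin_pi_sub, e3, abs_neg, abs_of_pos h2, e1, e2, inv_neg,
      ← sub_eq_add_neg]
    push_cast
    ring
  have hlim : Tendsto (fun ε : ℝ => ∫ ω in (0 : ℝ)..(Real.pi / 2),
      (angular a z φ ε ω + angular a z φ ε (-ω) +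
        (angular a z φ ε (Real.pi - ω) + angular a z φ ε (ω - Real.pi)))) (𝓝[>] 0)
      (𝓝 (∫ ω in (0 : ℝ)..(Real.pi / 2),
        2 * (((Real.sin ω)⁻¹ : ℝ) * (qOdd a z (φ + ω) - qOdd a z (φ - ω))))) := by
    -- Each of the two ray differences is over an angle 2ω and is at most 12Kω; together they give
    -- 24K(ω/sin ω), with ω/sin ω ≤ π/2.
    refine intervalIntegral.tendsto_integral_filter_of_dominated_convergence
      (fun _ => 24 * K * (Real.pi / 2)) ?_ ?_ intervalIntegrable_const ?_
    · filter_upwards [self_mem_nhdsWithin] with ε hε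
      exact (integral_neg_pi_pi (H.integral_cutKernel hz φ hε).1).1.def'.aestronglyMeasurable
    · filter_upwards [self_mem_nhdsWithin] with ε hε
      refine ae_of_all _ fun ω hω => ?_
      rw [uIoc_of_le (by positivity)] at hω
      have h2 : 0 < Real.sin ω := Real.sin_pos_of_pos_of_lt_pi hω.1 (by linarith [hω.2])
      have hδ : 0 ≤ ε / Real.sin ω := div_nonneg (le_of_lt hε) h2.le
      rw [hang ε ω hω, norm_mul, Complex.norm_real, Real.norm_of_nonneg (by positivity)]
      have b1 := H.norm_rayCut_sub_le hz (φ + ω) (φ - ω) hδ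
      have b2 := H.norm_rayCut_sub_le hz (φ - ω + Real.pi) (φ + ω + Real.pi) hδ
      have d1 : |φ + ω - (φ - ω)| = 2 * ω := by
        rw [show φ + ω - (φ - ω) = 2 * ω by ring, abs_of_pos (by linarith [hω.1])]
      have d2 : |φ - ω + Real.pi - (φ + ω + Real.pi)| = 2 * ω := by
        rw [show φ - ω + Real.pi - (φ + ω + Real.pi) = -(2 * ω) by ring, abs_neg,
          abs_of_pos (by linarith [hω.1])]
      rw [d1] at b1
      rw [d2] at b2
      have b3 := (norm_add_le _ _).trans (add_le_add b1 b2)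
      calc _ ≤ (Real.sin ω)⁻¹ * (6 * K * (2 * ω) + 6 * K * (2 * ω)) := by gcongr
        _ = 24 * K * ((Real.sin ω)⁻¹ * ω) := by ring
        _ ≤ _ := by gcongr; exact inv_sin_mul_le hω
    · refine ae_of_all _ fun ω hω => ?_
      rw [uIoc_of_le (by positivity)] at hω
      have h2 : 0 < Real.sin ω := Real.sin_pos_of_pos_of_lt_pi hω.1 (by linarith [hω.2])
      have hray : ∀ ψ, Tendsto (fun ε => rayCut a z ψ (ε / Real.sin ω)) (𝓝[>] 0)
          (𝓝 (rayIntegral a z ψ)) := fun ψ => by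
        refine tendsto_iff_norm_sub_tendsto_zero.2 ?_
        have h3 : Tendsto (fun ε => K * (ε / Real.sin ω)) (𝓝[>] 0) (𝓝 0) := by
          have : Continuous fun ε => K * (ε / Real.sin ω) := by fun_prop
          simpa using (this.tendsto 0).mono_left nhdsWithin_le_nhds
        refine squeeze_zero' (Eventually.of_forall fun _ => norm_nonneg _) ?_ h3
        filter_upwards [self_mem_nhdsWithin] with ε hε
        rw [norm_sub_rev]
        exact H.norm_rayIntegral_sub_rayCut_le z ψ (div_nonneg (le_of_lt hε) h2.le)
      have h4 := (((hray (φ + ω)).sub (hray (φ - ω))).add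
        ((hray (φ - ω + Real.pi)).sub (hray (φ + ω + Real.pi)))).const_mul
          ((((Real.sin ω)⁻¹ : ℝ)) : ℂ)
      have e := H.rayIntegral_sub_opposite hz (φ + ω)
      have e' := H.rayIntegral_sub_opposite hz (φ - ω)
      have e5 : 2 * ((((Real.sin ω)⁻¹ : ℝ) : ℂ) * (qOdd a z (φ + ω) - qOdd a z (φ - ω))) =
          (((Real.sin ω)⁻¹ : ℝ) : ℂ) * ((rayIntegral a z (φ + ω) - rayIntegral a z (φ - ω)) +
            (rayIntegral a z (φ - ω + Real.pi) - rayIntegral a z (φ + ω + Real.pi))) := by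
        linear_combination (((Real.sin ω)⁻¹ : ℝ) : ℂ) * (e' - e)
      rw [e5]
      refine h4.congr fun ε => (hang ε ω hω).symm
  rw [intervalIntegral.integral_const_mul] at hlim
  refine hlim.congr' ?_
  filter_upwards [self_mem_nhdsWithin] with ε hε
  exact (integral_neg_pi_pi (H.integral_cutKernel hz φ hε).1).2.symm

/-- The existence of the principal value is part of what is proved: the limit taken by `limUnder` is
only meaningful once convergence is known. -/
lemma HolderData.hilbert_radon (H : HolderData ν K a) (hz : z ∈ disc) (φ : ℝ) :
    hilbert (radon a φ) (sPar z φ) = -(2 / (Real.pi : ℂ)) * conjQ a z φ := by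
  have h : Tendsto (fun ε : ℝ => ∫ t in {t : ℝ | ε < |sPar z φ - t|},
      radon a φ t / ((sPar z φ - t : ℝ) : ℂ)) (𝓝[>] 0) (𝓝 (-(2 * conjQ a z φ))) := by
    refine (H.tendsto_truncated hz φ).neg.congr' ?_
    filter_upwards [self_mem_nhdsWithin] with ε hε
    rw [H.truncated_hilbert_eq hz φ hε, (H.integral_cutKernel hz φ hε).2]
  rw [hilbert, h.limUnder_eq]; ring

lemma HolderData.finchH_eq (H : HolderData ν K a) (hz : z ∈ disc) (φ : ℝ) :
    finchH a z φ = qOdd a z φ - Complex.I / Real.pi * conjQ a z φ := by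
  rw [finchH]
  change rayIntegral a z φ - 1 / 2 * (radon a φ (sPar z φ) -
    Complex.I * hilbert (radon a φ) (sPar z φ)) = _
  rw [H.hilbert_radon hz, ← H.rayIntegral_sub_radon hz]; ring

end

section

/-! ### Fourier series of the integrating factor -/

variable {ν K : ℝ} {a : ℂ → ℂ} {z : ℂ}

/-- A continuous periodic function with summable Fourier modes is the sum of its Fourier series. -/
lemma hasSum_modeZ {F : ℝ → ℂ} (hF : Continuous F) (hp : Function.Periodic F (2 * Real.pi))
    (hs : Summable fun k : ℤ => ‖modeZ F k‖) (φ : ℝ) :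
    HasSum (fun k : ℤ => modeZ F k * Complex.exp (k * φ * Complex.I)) (F φ) := by
  have : Fact (0 < 2 * Real.pi) := ⟨Real.two_pi_pos⟩
  set f : C(AddCircle (2 * Real.pi), ℂ) := ⟨hp.lift, by
    exact continuous_coinduced_dom.2 hF⟩ with hf
  have hpi : (Real.pi : ℂ) ≠ 0 := by exact_mod_cast Real.pi_ne_zero
  have hexp : ∀ (k : ℤ) (x : ℝ), fourier k (x : AddCircle (2 * Real.pi)) =
      Complex.exp (k * x * Complex.I) := fun k x => by
    rw [fourier_coe_apply]; congr 1; push_cast; field_simp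
  have hk : ∀ k, fourierCoeff f k = modeZ F k := fun k => by
    rw [fourierCoeff_eq_intervalIntegral f k 0, zero_add, modeZ, Complex.real_smul]
    push_cast
    congr 1
    refine intervalIntegral.integral_congr fun x _ => ?_
    change fourier (-k) (x : AddCircle (2 * Real.pi)) • F x = _
    rw [hexp, smul_eq_mul, mul_comm]; push_cast; ring_nf
  have hsum : Summable (fourierCoeff f) := by
    refine Summable.of_norm ?_
    simpa only [hk] using hs
  have := has_pointwise_sum_fourier_series_of_summable hsum (φ : AddCircle (2 * Real.pi))
  simp only [hk, hexp, smul_eq_mul] at this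
  exact this

lemma summable_modeZ {F : ℝ → ℂ} (hF : Continuous F) (hp : Function.Periodic F (2 * Real.pi))
    {C μ : ℝ} (hμ : 1 / 2 < μ) (hC : 0 ≤ C) (hH : ∀ x y, ‖F x - F y‖ ≤ C * |x - y| ^ μ) :
    Summable fun k : ℤ => ‖modeZ F k‖ := by
  have key : ∀ {G : ℝ → ℂ}, Continuous G → Function.Periodic G (2 * Real.pi) →
      (∀ x y, ‖G x - G y‖ ≤ C * |x - y| ^ μ) → Summable fun k : ℕ => ‖modeZ G k‖ := by
    intro G hG hGp hGH
    rw [← summable_nat_add_iff 1]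
    refine summable_of_sum_le (c := C * ((Real.pi / 2) ^ μ * ((2 : ℝ) ^ (1 / 2 - μ)) ^ 0 /
      (1 - (2 : ℝ) ^ (1 / 2 - μ)))) (fun _ => norm_nonneg _) fun s => ?_
    have := modeZ_tail hG hGp hμ hC hGH 0 (s.map (addRightEmbedding 1)) fun k hk => by
      simp only [Finset.mem_map, addRightEmbedding_apply] at hk
      obtain ⟨j, -, rfl⟩ := hk
      simp
    rw [Finset.sum_map] at this
    exact this
  -- Negative modes of F are positive modes of x ↦ F(-x), which has the same Hölder constant.
  refine Summable.of_nat_of_neg (key hF hp hH) ?_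
  have := key (G := fun x => F (-x)) (by fun_prop) (fun x => by
    have := hp.neg (-x)
    simp only [neg_add, ← sub_eq_add_neg] at this ⊢
    exact hp.sub_eq (-x)) fun x y => by
      refine (hH _ _).trans (le_of_eq ?_)
      rw [neg_sub_neg, abs_sub_comm]
  refine this.congr fun k => ?_
  rw [modeZ_neg_index hp]

lemma modeZ_zero_of_antiperiodic {F : ℝ → ℂ} (hp : Function.Periodic F (2 * Real.pi))
    (ha : ∀ φ, F (φ + Real.pi) = -F φ) {k : ℤ} (hk : Even k) : modeZ F k = 0 := by
  have h1 := modeZ_shift hp Real.pi k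
  have h2 : modeZ (fun x => F (x + Real.pi)) k = -modeZ F k := by
    simp only [ha, modeZ, neg_mul, intervalIntegral.integral_neg, mul_neg]
  obtain ⟨m, rfl⟩ := hk
  have h3 : Complex.exp (((m + m : ℤ) : ℂ) * Real.pi * Complex.I) = 1 := by
    rw [← Complex.exp_int_mul_two_pi_mul_I m]; congr 1; push_cast; ring
  rw [h3, one_mul, h2] at h1
  have : (2 : ℂ) * modeZ F (m + m) = 0 := by linear_combination -h1
  simpa using this

/-- Consecutive kernels differ by 2 cos((2n+2)ω), whose integral over [0, π/2] is a multiple of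
sin((n+1)π) = 0; the first kernel is 1. -/
lemma hasIntegral_dirichlet (n : ℕ) :
    IntervalIntegrable (fun ω => (Real.sin ω)⁻¹ * Real.sin ((2 * n + 1) * ω)) volume 0 (Real.pi / 2)
    ∧ ∫ ω in (0 : ℝ)..(Real.pi / 2), (Real.sin ω)⁻¹ * Real.sin ((2 * n + 1) * ω) =
      Real.pi / 2 := by
  have hpi := Real.pi_pos
  have hpos : ∀ ω ∈ uIoc (0 : ℝ) (Real.pi / 2), Real.sin ω ≠ 0 := fun ω hω => by
    rw [uIoc_of_le (by positivity)] at hω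
    exact (Real.sin_pos_of_pos_of_lt_pi hω.1 (by linarith [hω.2])).ne'
  induction n with
  | zero =>
    have h : EqOn (fun _ : ℝ => (1 : ℝ))
        (fun ω => (Real.sin ω)⁻¹ * Real.sin ((2 * (0 : ℕ) + 1) * ω))
        (uIoc 0 (Real.pi / 2)) := fun ω hω => by simp [hpos ω hω]
    refine ⟨intervalIntegrable_const.congr (h := h), ?_⟩
    rw [intervalIntegral.integral_congr_ae (ae_of_all _ fun ω hω => (h hω).symm)]
    simp
  | succ n ih =>
    have hc : Continuous fun ω : ℝ => 2 * Real.cos ((2 * n + 2) * ω) := by fun_prop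
    have h : EqOn (fun ω => (Real.sin ω)⁻¹ * Real.sin ((2 * n + 1) * ω) +
        2 * Real.cos ((2 * n + 2) * ω))
        (fun ω => (Real.sin ω)⁻¹ * Real.sin ((2 * (n + 1 : ℕ) + 1) * ω))
        (uIoc 0 (Real.pi / 2)) := fun ω hω => by
      have h0 := hpos ω hω
      have e1 : (2 * n + 1) * ω = (2 * n + 2) * ω - ω := by ring
      have e2 : (2 * ((n + 1 : ℕ) : ℝ) + 1) * ω = (2 * n + 2) * ω + ω := by push_cast; ring
      simp only [e1, e2, Real.sin_sub, Real.sin_add]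
      field_simp
      ring
    refine ⟨(ih.1.add (hc.intervalIntegrable _ _)).congr h, ?_⟩
    rw [intervalIntegral.integral_congr_ae (ae_of_all _ fun ω hω => (h hω).symm),
      intervalIntegral.integral_add ih.1 (hc.intervalIntegrable _ _), ih.2,
      intervalIntegral.integral_const_mul]
    have h1 : (2 * n + 2 : ℝ) ≠ 0 := by positivity
    have h2 := intervalIntegral.integral_comp_mul_left (a := 0) (b := Real.pi / 2) Real.cos h1
    rw [h2, integral_cos]
    have h3 : (2 * n + 2 : ℝ) * (Real.pi / 2) = ((n + 1 : ℕ) : ℝ) * Real.pi := by push_cast; ring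
    rw [h3, Real.sin_nat_mul_pi]
    simp

lemma HolderData.exists_lipschitz_qOdd (H : HolderData ν K a) :
    ∃ B, 0 ≤ B ∧ ∀ z ∈ disc, (∀ φ, ‖qOdd a z φ‖ ≤ B) ∧
      ∀ φ ψ, ‖qOdd a z φ - qOdd a z ψ‖ ≤ B * |φ - ψ| := by
  obtain ⟨B, hB, h⟩ := H.unifHolder_qOdd
  exact ⟨B, hB, fun z hz => ⟨(h z hz).1, fun φ ψ => by simpa using (h z hz).2 φ ψ⟩⟩

lemma HolderData.continuous_qOdd (H : HolderData ν K a) (hz : z ∈ disc) :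
    Continuous (qOdd a z) := by
  obtain ⟨B, hB, h⟩ := H.exists_lipschitz_qOdd
  exact (LipschitzWith.of_dist_le_mul (K := B.toNNReal) fun φ ψ => by
    rw [dist_eq_norm, Real.dist_eq, Real.coe_toNNReal _ hB]; exact (h z hz).2 φ ψ).continuous

lemma HolderData.exists_norm_conj_integrand_le (H : HolderData ν K a) (hz : z ∈ disc) :
    ∃ B, ∀ φ, ∀ ω ∈ Ioc 0 (Real.pi / 2),
      ‖(((Real.sin ω)⁻¹ : ℝ) : ℂ) * (qOdd a z (φ + ω) - qOdd a z (φ - ω))‖ ≤ B := by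
  obtain ⟨B, hB, h⟩ := H.exists_lipschitz_qOdd
  refine ⟨B * 2 * (Real.pi / 2), fun φ ω hω => ?_⟩
  have hpi := Real.pi_pos
  have h2 : 0 < Real.sin ω := Real.sin_pos_of_pos_of_lt_pi hω.1 (by linarith [hω.2])
  have h1 := (h z hz).2 (φ + ω) (φ - ω)
  rw [show φ + ω - (φ - ω) = 2 * ω by ring, abs_of_pos (by linarith [hω.1])] at h1
  rw [norm_mul, Complex.norm_real, Real.norm_of_nonneg (by positivity)]
  calc _ ≤ (Real.sin ω)⁻¹ * (B * (2 * ω)) := by gcongr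
    _ = B * 2 * ((Real.sin ω)⁻¹ * ω) := by ring
    _ ≤ _ := by gcongr; exact inv_sin_mul_le hω

lemma HolderData.continuous_conjQ (H : HolderData ν K a) (hz : z ∈ disc) :
    Continuous (conjQ a z) := by
  obtain ⟨B, hB⟩ := H.exists_norm_conj_integrand_le hz
  have hq := H.continuous_qOdd hz
  refine intervalIntegral.continuous_of_dominated_interval (bound := fun _ => B) (fun φ => ?_)
    (fun φ => ?_) intervalIntegrable_const (ae_of_all _ fun ω _ => by fun_prop)
  · refine Measurable.aestronglyMeasurable ?_
    exact (Complex.measurable_ofReal.comp Real.measurable_sin.inv).mul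
      (Continuous.measurable (by fun_prop))
  · refine ae_of_all _ fun ω hω => ?_
    rw [uIoc_of_le (by have := Real.pi_pos; positivity)] at hω
    exact hB φ ω hω

lemma conjQ_periodic (z : ℂ) : Function.Periodic (conjQ a z) (2 * Real.pi) := fun φ => by
  have h1 : ∀ ω, φ + 2 * Real.pi + ω = φ + ω + 2 * Real.pi := fun ω => by ring
  have h2 : ∀ ω, φ + 2 * Real.pi - ω = φ - ω + 2 * Real.pi := fun ω => by ring
  simp only [conjQ, h1, h2, qOdd_periodic z _]

/-- A translation of q by ±ω multiplies its k-th mode by e^{±ikω}. Fubini applies because the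
Lipschitz bound on q makes the integrand bounded despite 1/sin ω. -/
lemma HolderData.modeZ_conjQ (H : HolderData ν K a) (hz : z ∈ disc) (k : ℤ) :
    modeZ (conjQ a z) k = modeZ (qOdd a z) k *
      (2 * Complex.I * ∫ ω in (0 : ℝ)..(Real.pi / 2),
        (((Real.sin ω)⁻¹ * Real.sin (k * ω) : ℝ) : ℂ)) := by
  obtain ⟨B, hB⟩ := H.exists_norm_conj_integrand_le hz
  have hq := H.continuous_qOdd hz
  have hpi := Real.pi_pos
  have hswap : ∫ φ in (0 : ℝ)..(2 * Real.pi), conjQ a z φ * Complex.exp (-(k * φ * Complex.I)) =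
      ∫ ω in (0 : ℝ)..(Real.pi / 2), ∫ φ in (0 : ℝ)..(2 * Real.pi),
        (((Real.sin ω)⁻¹ : ℝ) : ℂ) * (qOdd a z (φ + ω) - qOdd a z (φ - ω)) *
          Complex.exp (-(k * φ * Complex.I)) := by
    simp only [conjQ, ← intervalIntegral.integral_mul_const]
    simp only [intervalIntegral.integral_of_le Real.two_pi_pos.le,
      intervalIntegral.integral_of_le (half_pos hpi).le]
    refine integral_integral_swap ?_
    rw [Measure.prod_restrict]
    refine IntegrableOn.of_bound (C := B) ?_ ?_ ?_
    · rw [Measure.prod_prod]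
      exact ENNReal.mul_lt_top measure_Ioc_lt_top measure_Ioc_lt_top
    · refine Measurable.aestronglyMeasurable ?_
      refine Measurable.mul (Measurable.mul ?_ ?_) ?_
      · exact Complex.measurable_ofReal.comp (Real.measurable_sin.comp measurable_snd).inv
      · exact Continuous.measurable (by fun_prop)
      · exact Continuous.measurable (by fun_prop)
    · refine (ae_restrict_iff' (measurableSet_Ioc.prod measurableSet_Ioc)).2
        (ae_of_all _ fun p hp => ?_)
      simp only [Function.uncurry]
      rw [norm_mul, Complex.norm_exp]
      simpa using hB p.1 p.2 hp.2
  rw [modeZ, hswap, ← intervalIntegral.integral_const_mul, ← intervalIntegral.integral_const_mul,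
    ← intervalIntegral.integral_const_mul]
  refine intervalIntegral.integral_congr fun ω _ => ?_
  have h1 := modeZ_shift (qOdd_periodic (a := a) z) ω k
  have h2 := modeZ_shift (qOdd_periodic (a := a) z) (-ω) k
  have h3 := modeZ_sub (F := fun x => qOdd a z (x + ω)) (G := fun x => qOdd a z (x + -ω))
    (by fun_prop) (by fun_prop) k
  rw [h1, h2] at h3
  simp only [mul_assoc, intervalIntegral.integral_const_mul]
  rw [mul_left_comm]
  have h4 : 1 / (2 * (Real.pi : ℂ)) * ∫ φ in (0 : ℝ)..(2 * Real.pi),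
      (qOdd a z (φ + ω) - qOdd a z (φ - ω)) * Complex.exp (-(k * (φ * Complex.I))) =
      modeZ (fun x => qOdd a z (x + ω) - qOdd a z (x + -ω)) k := by
    simp only [modeZ, mul_assoc, sub_eq_add_neg]
  rw [h4, h3]
  have h5 : Complex.exp (k * ω * Complex.I) - Complex.exp (k * (-ω : ℝ) * Complex.I) =
      2 * Complex.I * (Real.sin (k * ω) : ℝ) := by
    have e1 : (k * ω * Complex.I : ℂ) = ((k * ω : ℝ) : ℂ) * Complex.I := by push_cast; ring
    have e2 : (k * (-ω : ℝ) * Complex.I : ℂ) = ((-(k * ω) : ℝ) : ℂ) * Complex.I := by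
      push_cast; ring
    rw [e1, e2, Complex.exp_mul_I, Complex.exp_mul_I]
    push_cast
    rw [Complex.cos_neg, Complex.sin_neg]
    ring
  rw [← sub_mul, h5]
  push_cast
  ring

/-- For odd k the multiplier is 2i times ±π/2. For even k, including 0, it is irrelevant because
antiperiodicity kills the mode of q. -/
lemma HolderData.modeZ_conjQ_of_pos (H : HolderData ν K a) (hz : z ∈ disc) (k : ℕ) :
    modeZ (conjQ a z) k = Complex.I * Real.pi * modeZ (qOdd a z) k ∧
    modeZ (conjQ a z) (-k) = -(Complex.I * Real.pi * modeZ (qOdd a z) (-k)) := by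
  rw [H.modeZ_conjQ hz, H.modeZ_conjQ hz]
  rcases Nat.even_or_odd k with hk | ⟨n, rfl⟩
  · have h1 : Even (k : ℤ) := by exact_mod_cast hk
    rw [modeZ_zero_of_antiperiodic (qOdd_periodic z) (qOdd_add_pi z) h1,
      modeZ_zero_of_antiperiodic (qOdd_periodic z) (qOdd_add_pi z) h1.neg]
    simp
  · have h := (hasIntegral_dirichlet n).2
    rw [intervalIntegral.integral_ofReal, intervalIntegral.integral_ofReal]
    have e : ∀ ω : ℝ, (Real.sin ω)⁻¹ * Real.sin ((-((2 * n + 1 : ℕ) : ℤ) : ℤ) * ω) =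
        -((Real.sin ω)⁻¹ * Real.sin ((2 * n + 1) * ω)) := fun ω => by
      push_cast
      rw [neg_mul, Real.sin_neg, mul_neg]
    have e' : ∀ ω : ℝ, (Real.sin ω)⁻¹ * Real.sin ((((2 * n + 1 : ℕ) : ℤ) : ℝ) * ω) =
        (Real.sin ω)⁻¹ * Real.sin ((2 * n + 1) * ω) := fun ω => by
      push_cast
      rfl
    simp only [e, e', intervalIntegral.integral_neg, h]
    push_cast
    constructor <;> ring

lemma HolderData.continuous_finchH (H : HolderData ν K a) (hz : z ∈ disc) :
    Continuous (finchH a z) := by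
  rw [funext (H.finchH_eq hz)]
  exact (H.continuous_qOdd hz).sub (continuous_const.mul (H.continuous_conjQ hz))

/-- The factor of q_k is 1 - (i/π)(±iπ), that is 2 or 0: the Hilbert transform term doubles the
positive modes and removes the negative ones. The zero mode of q vanishes, so k = 0 fits both
formulas. -/
lemma HolderData.modeZ_finchH (H : HolderData ν K a) (hz : z ∈ disc) (k : ℕ) :
    modeZ (finchH a z) k = 2 * modeZ (qOdd a z) k ∧
    modeZ (finchH a z) (-k) = 0 := by
  have hpi : (Real.pi : ℂ) ≠ 0 := by exact_mod_cast Real.pi_ne_zero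
  have h1 : ∀ k, modeZ (finchH a z) k =
      modeZ (qOdd a z) k - Complex.I / Real.pi * modeZ (conjQ a z) k := fun k => by
    rw [funext (H.finchH_eq hz), modeZ_sub
      (G := fun φ => Complex.I / Real.pi * conjQ a z φ) (H.continuous_qOdd hz)
      (continuous_const.mul (H.continuous_conjQ hz))]
    congr 1
    simp only [modeZ, mul_assoc, intervalIntegral.integral_const_mul]
    ring
  obtain ⟨h2, h3⟩ := H.modeZ_conjQ_of_pos hz k
  rw [h1, h1, h2, h3]
  constructor
  · field_simp
    linear_combination -modeZ (qOdd a z) k * Complex.I_sq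
  · field_simp
    linear_combination modeZ (qOdd a z) (-k) * Complex.I_sq

lemma HolderData.summable_modeZ_qOdd (H : HolderData ν K a) (hz : z ∈ disc) :
    Summable fun k : ℤ => ‖modeZ (qOdd a z) k‖ := by
  obtain ⟨B, hB, h⟩ := H.unifHolder_qOdd
  exact summable_modeZ (H.continuous_qOdd hz) (qOdd_periodic z) (by norm_num : (1 / 2 : ℝ) < 1) hB
    (h z hz).2

/-- The Fourier series of `h(z, ·)` has only nonnegative modes. -/
lemma HolderData.hasSum_finchH (H : HolderData ν K a) (hz : z ∈ disc) (φ : ℝ) :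
    HasSum (fun k : ℕ => 2 * modeZ (qOdd a z) k * dir φ ^ k) (finchH a z φ) := by
  have hneg : ∀ k : ℤ, k ∉ range ((↑) : ℕ → ℤ) → modeZ (finchH a z) k = 0 := fun k hk => by
    have hk0 : k < 0 := by
      by_contra hcon
      exact hk ⟨k.toNat, Int.toNat_of_nonneg (not_lt.1 hcon)⟩
    obtain ⟨n, rfl⟩ := Int.exists_eq_neg_ofNat hk0.le
    exact (H.modeZ_finchH hz n).2
  have hper : Function.Periodic (finchH a z) (2 * Real.pi) := by
    rw [funext (H.finchH_eq hz)]
    exact (qOdd_periodic z).sub fun φ => by rw [conjQ_periodic z φ]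
  have hs : Summable fun k : ℤ => ‖modeZ (finchH a z) k‖ := by
    rw [← Function.Injective.summable_iff Nat.cast_injective
      (fun k hk => by rw [hneg k hk, norm_zero])]
    have := ((H.summable_modeZ_qOdd hz).comp_injective
      (Nat.cast_injective (R := ℤ))).mul_left 2
    refine this.congr fun k => ?_
    simp [(H.modeZ_finchH hz k).1]
  have := hasSum_modeZ (H.continuous_finchH hz) hper hs φ
  rw [← Function.Injective.hasSum_iff (Nat.cast_injective (R := ℤ))
    (fun k hk => by rw [hneg k hk, zero_mul])] at this
  convert this using 1
  funext k
  simp only [Function.comp, (H.modeZ_finchH hz k).1]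
  congr 1
  rw [dir, ← Complex.exp_nat_mul]; push_cast; ring_nf

end

section

/-! ### The integrating factor in the Wiener algebra -/

variable {ν K : ℝ} {a : ℂ → ℂ} {z : ℂ}

/-- A shortcut: the path through `Ring` is expensive to unify with the normed one. -/
instance (priority := 5000) : AddCommGroup Wiener := NormedAddCommGroup.toAddCommGroup

/-- Twice the truncated analytic part of the Fourier series of `F`. -/
def truncW (N : ℕ) (F : ℝ → ℂ) : Wiener :=
  ∑ k ∈ Finset.range N, Wiener.monomial k (2 * modeZ F k)

open Classical in
/-- Twice the analytic part of the Fourier series of `F`. -/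
def analyticW (F : ℝ → ℂ) : Wiener :=
  if h : Summable fun k : ℕ => ‖2 * modeZ F k‖ then Wiener.mk (fun k => 2 * modeZ F k) h else 0

lemma Wiener.coeff_sum {ι : Type*} (s : Finset ι) (f : ι → Wiener) (k : ℕ) :
    (∑ i ∈ s, f i).coeff k = ∑ i ∈ s, (f i).coeff k :=
  map_sum (Wiener.coeffL k) f s

lemma coeff_truncW (N : ℕ) (F : ℝ → ℂ) (k : ℕ) :
    (truncW N F).coeff k = if k < N then 2 * modeZ F k else 0 := by
  simp [truncW, Wiener.coeff_sum, Wiener.coeff_monomial]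

/-- The tail function in Bernstein's theorem. -/
def bernstein (μ : ℝ) (j : ℕ) : ℝ :=
  2 * ((Real.pi / 2) ^ μ * ((2 : ℝ) ^ (1 / 2 - μ)) ^ j / (1 - (2 : ℝ) ^ (1 / 2 - μ)))

lemma tendsto_bernstein {μ : ℝ} (hμ : 1 / 2 < μ) : Tendsto (bernstein μ) atTop (𝓝 0) := by
  have h1 : (2 : ℝ) ^ (1 / 2 - μ) < 1 :=
    Real.rpow_lt_one_of_one_lt_of_neg (by norm_num) (by linarith)
  have h2 := tendsto_pow_atTop_nhds_zero_of_lt_one (by positivity) h1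
  have h3 := ((h2.const_mul ((Real.pi / 2) ^ μ)).div_const (1 - (2 : ℝ) ^ (1 / 2 - μ))).const_mul 2
  unfold bernstein
  simpa using h3

lemma summable_two_mul_modeZ {F : ℝ → ℂ} (hF : Continuous F)
    (hp : Function.Periodic F (2 * Real.pi)) {C μ : ℝ} (hμ : 1 / 2 < μ) (hC : 0 ≤ C)
    (hH : ∀ x y, ‖F x - F y‖ ≤ C * |x - y| ^ μ) : Summable fun k : ℕ => ‖2 * modeZ F k‖ := by
  have := ((summable_modeZ hF hp hμ hC hH).comp_injective
    (Nat.cast_injective (R := ℤ))).mul_left 2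
  refine this.congr fun k => ?_
  simp

lemma coeff_analyticW {F : ℝ → ℂ} (hs : Summable fun k : ℕ => ‖2 * modeZ F k‖) (k : ℕ) :
    (analyticW F).coeff k = 2 * modeZ F k := by
  rw [analyticW, dif_pos hs, Wiener.coeff_mk]

/-- The tail depends on F only through its Hölder constant. For the functions used here that
constant is uniform in z, which makes the convergence uniform on Ω. -/
lemma norm_analyticW_sub_truncW_le {F : ℝ → ℂ} (hF : Continuous F)
    (hp : Function.Periodic F (2 * Real.pi)) {C μ : ℝ} (hμ : 1 / 2 < μ) (hC : 0 ≤ C)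
    (hH : ∀ x y, ‖F x - F y‖ ≤ C * |x - y| ^ μ) (j : ℕ) :
    ‖analyticW F - truncW (2 ^ j) F‖ ≤ C * bernstein μ j := by
  have hs := summable_two_mul_modeZ hF hp hμ hC hH
  rw [Wiener.norm_eq]
  refine Real.tsum_le_of_sum_le (fun _ => norm_nonneg _) fun s => ?_
  have h1 : ∀ k : ℕ, ‖(analyticW F - truncW (2 ^ j) F).coeff k‖ =
      if 2 ^ j ≤ k then 2 * ‖modeZ F k‖ else 0 := fun k => by
    rw [Wiener.coeff_sub, coeff_analyticW hs, coeff_truncW]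
    by_cases h : k < 2 ^ j
    · simp [h, not_le.2 h]
    · simp [h, not_lt.1 h]
  simp only [h1]
  rw [← Finset.sum_filter, ← Finset.mul_sum]
  have := modeZ_tail hF hp hμ hC hH j (s.filter fun k => 2 ^ j ≤ k) fun k hk =>
    (Finset.mem_filter.1 hk).2
  rw [bernstein]
  linarith

lemma norm_modeZ_le {F : ℝ → ℂ} {B : ℝ} (hB : ∀ φ, ‖F φ‖ ≤ B) (k : ℤ) : ‖modeZ F k‖ ≤ B := by
  have h := intervalIntegral.norm_integral_le_of_norm_le_const (a := 0) (b := 2 * Real.pi) (C := B)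
    (f := fun φ : ℝ => F φ * Complex.exp (-(k * φ * Complex.I))) fun φ _ => by
      rw [norm_mul, Complex.norm_exp]; simpa using hB φ
  rw [sub_zero, abs_of_pos Real.two_pi_pos] at h
  rw [modeZ, norm_mul]
  have h2 : ‖(1 / (2 * (Real.pi : ℂ)))‖ = (2 * Real.pi)⁻¹ := by
    rw [norm_div, norm_mul, Complex.norm_real, Real.norm_of_nonneg Real.pi_pos.le]; simp
  rw [h2, inv_mul_le_iff₀ Real.two_pi_pos]
  linarith

lemma Wiener.norm_monomial (k : ℕ) (c : ℂ) : ‖Wiener.monomial k c‖ = ‖c‖ := by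
  rw [Wiener.norm_eq, tsum_eq_single k] <;> simp +contextual [Wiener.coeff_monomial]

lemma norm_analyticW_le {F : ℝ → ℂ} (hF : Continuous F) (hp : Function.Periodic F (2 * Real.pi))
    {C μ : ℝ} (hμ : 1 / 2 < μ) (hC : 0 ≤ C) (hH : ∀ x y, ‖F x - F y‖ ≤ C * |x - y| ^ μ)
    (hB : ∀ φ, ‖F φ‖ ≤ C) : ‖analyticW F‖ ≤ C * (bernstein μ 0 + 2) := by
  have h1 := norm_analyticW_sub_truncW_le hF hp hμ hC hH 0
  have h2 : ‖truncW (2 ^ 0) F‖ ≤ 2 * C := by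
    -- Truncation at 2^0 keeps the zero mode only, at most C in norm before doubling.
    rw [pow_zero, truncW, Finset.sum_range_one, Wiener.norm_monomial, norm_mul]
    have := norm_modeZ_le hB (0 : ℕ)
    simpa using this
  have h3 := norm_le_norm_add_norm_sub' (analyticW F) (truncW (2 ^ 0) F)
  linarith

/-- A real linear map on `ℂ` with given values at `1` and `i`. -/
def clmOf {E : Type*} [NormedAddCommGroup E] [NormedSpace ℝ E] (x y : E) : ℂ →L[ℝ] E :=
  Complex.reCLM.smulRight x + Complex.imCLM.smulRight y

lemma clmOf_apply {E : Type*} [NormedAddCommGroup E] [NormedSpace ℝ E] (x y : E) (e : ℂ) :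
    clmOf x y e = e.re • x + e.im • y := rfl

lemma clmOf_eq {E : Type*} [NormedAddCommGroup E] [NormedSpace ℝ E] (L : ℂ →L[ℝ] E) :
    clmOf (L 1) (L Complex.I) = L := by
  refine ContinuousLinearMap.ext fun e => ?_
  rw [clmOf_apply, ← map_smul, ← map_smul, ← map_add]
  congr 1
  simp

lemma norm_clmOf_le {E : Type*} [NormedAddCommGroup E] [NormedSpace ℝ E] (x y : E) :
    ‖clmOf x y‖ ≤ ‖x‖ + ‖y‖ := by
  refine ContinuousLinearMap.opNorm_le_bound _ (by positivity) fun e => ?_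
  rw [clmOf_apply, add_mul]
  refine (norm_add_le _ _).trans (add_le_add ?_ ?_)
  · rw [norm_smul, mul_comm]; gcongr; exact Complex.abs_re_le_norm e
  · rw [norm_smul, mul_comm]; gcongr; exact Complex.abs_im_le_norm e

lemma clmOf_sub {E : Type*} [NormedAddCommGroup E] [NormedSpace ℝ E] (x y x' y' : E) :
    clmOf x y - clmOf x' y' = clmOf (x - x') (y - y') := by
  refine ContinuousLinearMap.ext fun e => ?_
  simp only [sub_apply, clmOf_apply, smul_sub]; abel

lemma continuous_clmOf {E : Type*} [NormedAddCommGroup E] [NormedSpace ℝ E] :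
    Continuous fun p : E × E => clmOf p.1 p.2 :=
  ((ContinuousLinearMap.smulRightL ℝ ℂ E Complex.reCLM).continuous.comp continuous_fst).add
    ((ContinuousLinearMap.smulRightL ℝ ℂ E Complex.imCLM).continuous.comp continuous_snd)

lemma _root_.ContinuousOn.clmOf {E X : Type*} [NormedAddCommGroup E] [NormedSpace ℝ E]
    [TopologicalSpace X] {f g : X → E} {s : Set X} (hf : ContinuousOn f s)
    (hg : ContinuousOn g s) : ContinuousOn (fun x => clmOf (f x) (g x)) s :=
  continuous_clmOf.comp_continuousOn (hf.prodMk hg)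

/-! ### Derivatives of the modes -/

lemma dir_periodic : Function.Periodic dir (2 * Real.pi) := fun φ => by
  rw [two_mul, ← add_assoc, dir_add_pi, dir_add_pi, neg_neg]

lemma gradQ_periodic (z e : ℂ) : Function.Periodic (fun φ => gradQ a z φ e) (2 * Real.pi) :=
  fun φ => by
    simp only [gradQ, transQ, avgD, mid, sig, sPar, mPar, dirPerp, dir_periodic φ]

lemma HolderData.exists_gradQ_bound (H : HolderData ν K a) :
    ∃ B, 0 ≤ B ∧ ∀ e ∈ ({1, Complex.I} : Set ℂ), ∀ z ∈ disc, (∀ φ, ‖gradQ a z φ e‖ ≤ B) ∧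
      ∀ φ ψ, ‖gradQ a z φ e - gradQ a z ψ e‖ ≤ B * |φ - ψ| ^ ν := by
  obtain ⟨B₁, hB₁, h₁⟩ := H.unifHolder_gradQ 1
  obtain ⟨B₂, hB₂, h₂⟩ := H.unifHolder_gradQ Complex.I
  have key : ∀ {B e}, 0 ≤ B → B ≤ max B₁ B₂ → (∀ z ∈ disc, (∀ φ, ‖gradQ a z φ e‖ ≤ B) ∧
      ∀ φ ψ, ‖gradQ a z φ e - gradQ a z ψ e‖ ≤ B * |φ - ψ| ^ ν) → ∀ z ∈ disc,
      (∀ φ, ‖gradQ a z φ e‖ ≤ max B₁ B₂) ∧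
      ∀ φ ψ, ‖gradQ a z φ e - gradQ a z ψ e‖ ≤ max B₁ B₂ * |φ - ψ| ^ ν :=
    fun _ hle h z hz => ⟨fun φ => ((h z hz).1 φ).trans hle, fun φ ψ => ((h z hz).2 φ ψ).trans
      (mul_le_mul_of_nonneg_right hle (by positivity))⟩
  refine ⟨max B₁ B₂, le_max_of_le_left hB₁, fun e he => ?_⟩
  rcases he with rfl | rfl
  · exact key hB₁ (le_max_left _ _) h₁
  · exact key hB₂ (le_max_right _ _) h₂

lemma continuous_of_holder {F : ℝ → ℂ} {C μ : ℝ} (hμ : 0 < μ)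
    (hH : ∀ x y, ‖F x - F y‖ ≤ C * |x - y| ^ μ) : Continuous F := by
  refine continuous_iff_continuousAt.2 fun x => tendsto_iff_norm_sub_tendsto_zero.2 ?_
  have : Continuous fun y : ℝ => C * |y - x| ^ μ :=
    continuous_const.mul ((continuous_id.sub continuous_const).abs.rpow_const
      fun _ => Or.inr hμ.le)
  have h2 := this.tendsto x
  simp only [sub_self, abs_zero, Real.zero_rpow hμ.ne', mul_zero] at h2
  exact squeeze_zero (fun _ => norm_nonneg _) (fun y => hH y x) h2

lemma HolderData.continuous_gradQ (H : HolderData ν K a) (hz : z ∈ disc) {e : ℂ}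
    (he : e ∈ ({1, Complex.I} : Set ℂ)) : Continuous fun φ => gradQ a z φ e := by
  obtain ⟨B, hB, h⟩ := H.exists_gradQ_bound
  exact continuous_of_holder (by linarith [H.half_lt]) (h e he z hz).2

lemma HolderData.hasFDerivAt_modeZ (H : HolderData ν K a) (hz : z ∈ disc) (k : ℤ) :
    HasFDerivAt (fun w => modeZ (qOdd a w) k)
      (clmOf (modeZ (fun φ => gradQ a z φ 1) k) (modeZ (fun φ => gradQ a z φ Complex.I) k)) z := by
  obtain ⟨B, hB, h⟩ := H.exists_gradQ_bound
  have c1 := H.continuous_gradQ hz (e := 1) (by simp)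
  have c2 := H.continuous_gradQ hz (e := Complex.I) (by simp)
  have hgc : Continuous fun φ => gradQ a z φ := by
    have : (fun φ => gradQ a z φ) = fun φ => clmOf (gradQ a z φ 1) (gradQ a z φ Complex.I) :=
      funext fun φ => (clmOf_eq _).symm
    rw [this]
    exact continuous_clmOf.comp (c1.prodMk c2)
  have hgc2 : Continuous fun φ : ℝ =>
      Complex.exp (-(k * φ * Complex.I)) • gradQ a z φ :=
    (by fun_prop : Continuous fun φ : ℝ => Complex.exp (-(k * φ * Complex.I))).smul hgc
  have hd := intervalIntegral.hasFDerivAt_integral_of_dominated_of_fderiv_le (μ := volume)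
    (a := 0) (b := 2 * Real.pi) (s := disc) (x₀ := z) (bound := fun _ => B + B)
    (F := fun w (φ : ℝ) => Complex.exp (-(k * φ * Complex.I)) • qOdd a w φ)
    (F' := fun w (φ : ℝ) => Complex.exp (-(k * φ * Complex.I)) • gradQ a w φ)
    (isOpen_disc.mem_nhds hz) ?_ ?_ hgc2.aestronglyMeasurable ?_ intervalIntegrable_const ?_
  · have hd2 := hd.const_mul (1 / (2 * (Real.pi : ℂ)))
    have e1 : ∀ w, modeZ (qOdd a w) k = 1 / (2 * (Real.pi : ℂ)) *
        ∫ φ in (0 : ℝ)..(2 * Real.pi), Complex.exp (-(k * φ * Complex.I)) • qOdd a w φ := fun w => by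
      simp only [modeZ, smul_eq_mul, mul_comm (Complex.exp _)]
    simp only [e1]
    refine hd2.congr_fderiv ?_
    refine ContinuousLinearMap.ext fun e => ?_
    rw [smul_apply, ContinuousLinearMap.intervalIntegral_apply (hgc2.intervalIntegrable _ _),
      clmOf_apply]
    have e2 : ∀ φ, gradQ a z φ e = e.re • gradQ a z φ 1 + e.im • gradQ a z φ Complex.I := fun φ => by
      conv_lhs => rw [← clmOf_eq (gradQ a z φ)]
      rfl
    simp only [smul_apply, e2, modeZ, smul_add]
    rw [intervalIntegral.integral_add, smul_add]
    · simp only [Complex.real_smul, smul_eq_mul, ← intervalIntegral.integral_const_mul]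
      congr 1 <;> refine intervalIntegral.integral_congr fun φ _ => ?_ <;> ring
    · exact Continuous.intervalIntegrable (by fun_prop) _ _
    · exact Continuous.intervalIntegrable (by fun_prop) _ _
  · filter_upwards [isOpen_disc.mem_nhds hz] with w hw
    have := H.continuous_qOdd hw
    exact Continuous.aestronglyMeasurable (by fun_prop)
  · have := H.continuous_qOdd hz
    exact Continuous.intervalIntegrable (by fun_prop) _ _
  · refine ae_of_all _ fun φ _ w hw => ?_
    rw [norm_smul, Complex.norm_exp, ← clmOf_eq (gradQ a w φ)]
    have := norm_clmOf_le (gradQ a w φ 1) (gradQ a w φ Complex.I)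
    have h1 := (h 1 (by simp) w hw).1 φ
    have h2 := (h Complex.I (by simp) w hw).1 φ
    simp only [Complex.neg_re, Complex.mul_re, Complex.intCast_re, Complex.ofReal_re,
      Complex.intCast_im, Complex.ofReal_im, Complex.I_re, Complex.mul_im, Complex.I_im]
    norm_num
    linarith
  · exact ae_of_all _ fun φ _ w hw =>
      (H.hasFDerivAt_qOdd hw φ).const_smul (Complex.exp (-(k * φ * Complex.I)))

lemma HolderData.continuousOn_modeZ_gradQ (H : HolderData ν K a) (k : ℤ) {e : ℂ}
    (he : e ∈ ({1, Complex.I} : Set ℂ)) :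
    ContinuousOn (fun z => modeZ (fun φ => gradQ a z φ e) k) disc := by
  obtain ⟨B, hB, h⟩ := H.exists_gradQ_bound
  intro z hz
  refine ContinuousWithinAt.mul continuousWithinAt_const ?_
  refine intervalIntegral.continuousWithinAt_of_dominated_interval (bound := fun _ => B) ?_ ?_
    intervalIntegrable_const ?_
  · filter_upwards [self_mem_nhdsWithin] with w hw
    have := H.continuous_gradQ hw he
    exact Continuous.aestronglyMeasurable (by fun_prop)
  · filter_upwards [self_mem_nhdsWithin] with w hw
    refine ae_of_all _ fun φ _ => ?_
    rw [norm_mul, Complex.norm_exp]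
    simpa using (h e he w hw).1 φ
  · exact ae_of_all _ fun φ _ =>
      ((H.continuousOn_gradQ φ z hz).clm_apply continuousWithinAt_const).mul
        continuousWithinAt_const

/-! ### The exponent -/

/-- The exponent `h` with values in the Wiener algebra. -/
def expoW (a : ℂ → ℂ) (z : ℂ) : Wiener := analyticW (qOdd a z)

/-- The derivative of `expoW`. -/
def expoW' (a : ℂ → ℂ) (z : ℂ) : ℂ →L[ℝ] Wiener :=
  clmOf (analyticW fun φ => gradQ a z φ 1) (analyticW fun φ => gradQ a z φ Complex.I)

/-- The exponent is built from the analytic half of the series of q, and that half, doubled, is the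
whole Fourier series of h. -/
lemma HolderData.ev_expoW (H : HolderData ν K a) (hz : z ∈ disc) (φ : ℝ) :
    Wiener.ev φ (expoW a z) = finchH a z φ := by
  obtain ⟨B, hB, h⟩ := H.unifHolder_qOdd
  have hs := summable_two_mul_modeZ (H.continuous_qOdd hz) (qOdd_periodic z)
    (by norm_num : (1 / 2 : ℝ) < 1) hB (h z hz).2
  refine (Wiener.hasSum_ev φ _).unique ?_
  simpa only [expoW, coeff_analyticW hs] using H.hasSum_finchH hz φ

lemma HolderData.tendstoUniformlyOn_truncW_gradQ (H : HolderData ν K a) :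
    TendstoUniformlyOn (fun (j : ℕ) z => clmOf (truncW (2 ^ j) fun φ => gradQ a z φ 1)
      (truncW (2 ^ j) fun φ => gradQ a z φ Complex.I)) (expoW' a) atTop disc := by
  obtain ⟨B, hB, h⟩ := H.exists_gradQ_bound
  rw [Metric.tendstoUniformlyOn_iff]
  intro ε hε
  have h0 : Tendsto (fun j => B * bernstein ν j + B * bernstein ν j) atTop (𝓝 0) := by
    simpa using ((tendsto_bernstein H.half_lt).const_mul B).add
      ((tendsto_bernstein H.half_lt).const_mul B)
  filter_upwards [h0.eventually_lt_const hε] with j hj z hz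
  rw [dist_eq_norm, expoW', clmOf_sub]
  refine (norm_clmOf_le _ _).trans_lt (lt_of_le_of_lt (add_le_add ?_ ?_) hj)
  · exact norm_analyticW_sub_truncW_le (H.continuous_gradQ hz (by simp)) (gradQ_periodic z _)
      H.half_lt hB (h 1 (by simp) z hz).2 j
  · exact norm_analyticW_sub_truncW_le (H.continuous_gradQ hz (by simp)) (gradQ_periodic z _)
      H.half_lt hB (h Complex.I (by simp) z hz).2 j

lemma Wiener.monomial_eq_smul (k : ℕ) (c : ℂ) : monomial k c = c • monomial k 1 := by
  ext j; simp [coeff_monomial]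

lemma truncW_eq (N : ℕ) (F : ℝ → ℂ) :
    truncW N F = ∑ k ∈ Finset.range N, modeZ F k • Wiener.monomial k 2 := by
  refine Finset.sum_congr rfl fun k _ => ?_
  rw [Wiener.monomial_eq_smul, Wiener.monomial_eq_smul k 2, smul_smul, mul_comm]

/-- The truncations are polynomials in ξ whose coefficients are differentiable in z. Their
derivatives converge uniformly on Ω by the Bernstein tails of the gradient, and they themselves
converge pointwise. -/
lemma HolderData.hasFDerivAt_expoW (H : HolderData ν K a) (hz : z ∈ disc) :
    HasFDerivAt (expoW a) (expoW' a z) z := by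
  obtain ⟨B, hB, h⟩ := H.unifHolder_qOdd
  refine hasFDerivAt_of_tendstoUniformlyOn isOpen_disc H.tendstoUniformlyOn_truncW_gradQ
    (f := fun (j : ℕ) z => truncW (2 ^ j) (qOdd a z)) (fun j w hw => ?_) (fun w hw => ?_) hz
  · simp only [truncW_eq]
    have h1 : HasFDerivAt (fun w => ∑ k ∈ Finset.range (2 ^ j),
        modeZ (qOdd a w) k • Wiener.monomial k 2) _ w :=
      HasFDerivAt.fun_sum fun k _ => (H.hasFDerivAt_modeZ hw k).smul_const (Wiener.monomial k 2)
    refine h1.congr_fderiv (ContinuousLinearMap.ext fun e => ?_)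
    rw [clmOf_apply, sum_apply, Finset.smul_sum, Finset.smul_sum,
      ← Finset.sum_add_distrib]
    refine Finset.sum_congr rfl fun k _ => ?_
    simp only [ContinuousLinearMap.smulRight_apply, clmOf_apply, add_smul, smul_assoc]
  · refine tendsto_iff_norm_sub_tendsto_zero.2 ?_
    have h0 : Tendsto (fun j => B * bernstein 1 j) atTop (𝓝 0) := by
      simpa using (tendsto_bernstein (by norm_num : (1 / 2 : ℝ) < 1)).const_mul B
    refine squeeze_zero (fun _ => norm_nonneg _) (fun j => ?_) h0
    rw [norm_sub_rev]
    exact norm_analyticW_sub_truncW_le (H.continuous_qOdd hw) (qOdd_periodic w)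
      (by norm_num) hB (h w hw).2 j

lemma HolderData.continuousOn_truncW_gradQ (H : HolderData ν K a) (N : ℕ) {e : ℂ}
    (he : e ∈ ({1, Complex.I} : Set ℂ)) :
    ContinuousOn (fun z => truncW N fun φ => gradQ a z φ e) disc := by
  simp only [truncW_eq]
  exact continuousOn_finsetSum _ fun k _ =>
    (H.continuousOn_modeZ_gradQ k he).smul continuousOn_const

lemma HolderData.continuousOn_clmOf_truncW (H : HolderData ν K a) (N : ℕ) :
    ContinuousOn (fun z => clmOf (truncW N fun φ => gradQ a z φ 1)
      (truncW N fun φ => gradQ a z φ Complex.I)) disc :=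
  (H.continuousOn_truncW_gradQ N (by simp)).clmOf (H.continuousOn_truncW_gradQ N (by simp))

lemma HolderData.continuousOn_expoW' (H : HolderData ν K a) : ContinuousOn (expoW' a) disc :=
  H.tendstoUniformlyOn_truncW_gradQ.continuousOn
    (Frequently.of_forall fun j => H.continuousOn_clmOf_truncW (2 ^ j))

lemma HolderData.exists_expoW_bound (H : HolderData ν K a) :
    ∃ B, ∀ z ∈ disc, ‖expoW a z‖ ≤ B ∧ ‖expoW' a z‖ ≤ B := by
  obtain ⟨B, hB, h⟩ := H.unifHolder_qOdd
  obtain ⟨C, hC, h'⟩ := H.exists_gradQ_bound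
  refine ⟨max (B * (bernstein 1 0 + 2)) (C * (bernstein ν 0 + 2) + C * (bernstein ν 0 + 2)),
    fun z hz => ⟨le_max_of_le_left ?_, le_max_of_le_right ?_⟩⟩
  · exact norm_analyticW_le (H.continuous_qOdd hz) (qOdd_periodic z)
      (by norm_num) hB (h z hz).2 (h z hz).1
  · refine (norm_clmOf_le _ _).trans (add_le_add ?_ ?_)
    · exact norm_analyticW_le (H.continuous_gradQ hz (by simp)) (gradQ_periodic z _)
        H.half_lt hC (h' 1 (by simp) z hz).2 (h' 1 (by simp) z hz).1
    · exact norm_analyticW_le (H.continuous_gradQ hz (by simp)) (gradQ_periodic z _)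
        H.half_lt hC (h' Complex.I (by simp) z hz).2 (h' Complex.I (by simp) z hz).1

end

section

/-! ### The integrating factor -/

variable {ν K : ℝ} {a : ℂ → ℂ} {z : ℂ}

lemma inner_dir_dir (φ : ℝ) : inner ℝ (dir φ) (dir φ) = (1 : ℝ) := by
  rw [real_inner_self_eq_norm_sq, norm_dir, one_pow]

lemma inner_dirPerp_dir (φ : ℝ) : inner ℝ (dirPerp φ) (dir φ) = (0 : ℝ) := by
  rw [Complex.inner, Complex.mul_re, Complex.conj_re, Complex.conj_im, dirPerp_re, dirPerp_im,
    dir_re, dir_im]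
  ring

lemma gradQ_dir (z : ℂ) (φ : ℝ) : gradQ a z φ (dir φ) = -a z := by
  simp only [gradQ, sub_apply, ContinuousLinearMap.smulRight_apply, innerSL_apply_apply,
    inner_dir_dir, inner_dirPerp_dir, zero_smul, one_smul, zero_sub]

lemma sPar_add_dir (z : ℂ) (φ t : ℝ) : sPar (z + t • dir φ) φ = sPar z φ := by
  rw [sPar, sPar, inner_add_left, real_inner_smul_left, real_inner_comm _ (dir φ),
    inner_dirPerp_dir, mul_zero, add_zero]

lemma HolderData.finchH_eq_qOdd_add (H : HolderData ν K a) (hz : z ∈ disc) (φ : ℝ) :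
    finchH a z φ =
      qOdd a z φ + (1 / 2) * (Complex.I * hilbert (radon a φ) (sPar z φ)) := by
  rw [← H.rayIntegral_sub_radon hz, finchH, sPar]; ring

/-- Along a line in direction θ the coordinate z·θ^⊥ is constant, so the Hilbert transform term does
not move. Only q contributes, and its derivative along θ is -a. -/
lemma HolderData.ev_expoW'_dir (H : HolderData ν K a) (hz : z ∈ disc) (φ : ℝ) :
    Wiener.ev φ (expoW' a z (dir φ)) = -a z := by
  have hl : HasDerivAt (fun t : ℝ => z + t • dir φ) (dir φ) 0 := by
    simpa using ((hasDerivAt_id (0 : ℝ)).smul_const (dir φ)).const_add z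
  have hl0 : z + (0 : ℝ) • dir φ = z := by simp
  have hq : HasDerivAt (fun t : ℝ => qOdd a (z + t • dir φ) φ) (-a z) 0 := by
    have h := H.hasFDerivAt_qOdd hz φ
    rw [← hl0] at h
    have h2 := h.comp_hasDerivAt (0 : ℝ) hl
    rw [hl0, gradQ_dir] at h2
    exact h2
  have he : HasDerivAt (fun t : ℝ => Wiener.ev φ (expoW a (z + t • dir φ)))
      (Wiener.ev φ (expoW' a z (dir φ))) 0 := by
    have h := H.hasFDerivAt_expoW hz
    rw [← hl0] at h
    have h2 := h.comp_hasDerivAt (0 : ℝ) hl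
    rw [hl0] at h2
    exact ((Wiener.evL φ).restrictScalars ℝ).hasFDerivAt.comp_hasDerivAt (0 : ℝ) h2
  refine he.unique ((hq.add_const
    ((1 / 2) * (Complex.I * hilbert (radon a φ) (sPar z φ)))).congr_of_eventuallyEq ?_)
  have hev : ∀ᶠ t : ℝ in 𝓝 0, z + t • dir φ ∈ disc := by
    have := hl.continuousAt.preimage_mem_nhds (t := disc)
      (isOpen_disc.mem_nhds (by simpa using hz))
    exact this
  filter_upwards [hev] with t ht
  rw [H.ev_expoW ht, H.finchH_eq_qOdd_add ht, sPar_add_dir]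

/-- On the symbol side this is the identity θ·∇ = e^{-iθ}∂̄ + e^{iθ}∂, multiplied by e^{iθ}. -/
lemma transport_ev (L : ℂ →L[ℝ] Wiener) (φ : ℝ) :
    Wiener.ev φ ((1 / 2 : ℂ) • (L 1 + Complex.I • L Complex.I) +
      Wiener.gen * (Wiener.gen * ((1 / 2 : ℂ) • (L 1 - Complex.I • L Complex.I)))) =
      dir φ * Wiener.ev φ (L (dir φ)) := by
  have h : L (dir φ) = (Real.cos φ : ℂ) • L 1 + (Real.sin φ : ℂ) • L Complex.I := by
    conv_lhs => rw [← clmOf_eq L]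
    rw [clmOf_apply, dir_re, dir_im, Complex.coe_smul, Complex.coe_smul]
  rw [h]
  simp only [map_add, map_mul, map_sub, map_smul, Wiener.ev_gen, smul_eq_mul]
  have hc : (Real.cos φ : ℂ) ^ 2 + (Real.sin φ : ℂ) ^ 2 = 1 := by
    exact_mod_cast Real.cos_sq_add_sin_sq φ
  rw [dir_eq]
  generalize (Real.cos φ : ℂ) = c at *
  generalize (Real.sin φ : ℂ) = s at *
  have hI := Complex.I_sq
  generalize Wiener.ev φ (L 1) = x
  generalize Wiener.ev φ (L Complex.I) = y
  linear_combination (-(1 / 2) * (x + Complex.I * y)) * hc +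
    (1 / 2) * (s ^ 2 * x - s ^ 2 * Complex.I * y - 2 * c * s * y) * hI

/-- A family of elements of the Wiener algebra which intertwines `∂̄ + L²∂` and
`∂̄ + L²∂ + bL`. -/
structure IntFactor (b : ℂ → ℂ) (Γ : ℂ → Wiener) (Γ' : ℂ → ℂ →L[ℝ] Wiener) (B : ℝ) : Prop where
  hasFDerivAt : ∀ z ∈ disc, HasFDerivAt Γ (Γ' z) z
  continuousOn : ContinuousOn Γ' disc
  norm_le : ∀ z ∈ disc, ‖Γ z‖ ≤ B
  norm_le_one : ∀ z ∈ disc, ‖Γ' z 1‖ ≤ B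
  norm_le_I : ∀ z ∈ disc, ‖Γ' z Complex.I‖ ≤ B
  eqn : ∀ z ∈ disc, (1 / 2 : ℂ) • (Γ' z 1 + Complex.I • Γ' z Complex.I) +
    Wiener.gen * (Wiener.gen * ((1 / 2 : ℂ) • (Γ' z 1 - Complex.I • Γ' z Complex.I))) =
    b z • (Wiener.gen * Γ z)

lemma Wiener.norm_exp_le (x : Wiener) : ‖NormedSpace.exp x‖ ≤ Real.exp ‖x‖ := by
  have h1 : HasSum (fun n : ℕ => ((n.factorial : ℂ)⁻¹) • x ^ n) (NormedSpace.exp x) :=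
    NormedSpace.exp_series_hasSum_exp' (𝕂 := ℂ) x
  have h2 : HasSum (fun n : ℕ => ‖x‖ ^ n / n.factorial) (Real.exp ‖x‖) := by
    rw [Real.exp_eq_exp_ℝ]
    exact NormedSpace.expSeries_div_hasSum_exp ‖x‖
  rw [← h1.tsum_eq]
  refine tsum_of_norm_bounded h2 fun n => ?_
  rw [norm_smul, norm_inv, Complex.norm_natCast, div_eq_inv_mul]
  gcongr
  exact norm_pow_le _ _

/-- The exponential `e^{ch}` in the Wiener algebra. -/
def expW (a : ℂ → ℂ) (c : ℂ) (z : ℂ) : Wiener := NormedSpace.exp (c • expoW a z)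

/-- The derivative of `expW`. -/
def expW' (a : ℂ → ℂ) (c : ℂ) (z : ℂ) : ℂ →L[ℝ] Wiener :=
  clmOf (c • (expW a c z * expoW' a z 1)) (c • (expW a c z * expoW' a z Complex.I))

lemma expW'_apply (c z e : ℂ) : expW' a c z e = c • (expW a c z * expoW' a z e) := by
  have h : expoW' a z e = e.re • expoW' a z 1 + e.im • expoW' a z Complex.I := by
    conv_lhs => rw [← clmOf_eq (expoW' a z)]
    rw [clmOf_apply]
  rw [expW', clmOf_apply, h, ← Complex.coe_smul, ← Complex.coe_smul, ← Complex.coe_smul,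
    ← Complex.coe_smul, mul_add, mul_smul_comm, mul_smul_comm, smul_add, smul_comm c, smul_comm c]

lemma HolderData.hasFDerivAt_expW (H : HolderData ν K a) (c : ℂ) (hz : z ∈ disc) :
    HasFDerivAt (expW a c) (expW' a c z) z := by
  have h1 := (H.hasFDerivAt_expoW hz).const_smul c
  have h2 := (hasFDerivAt_exp (𝕂 := ℂ) (x := c • expoW a z)).restrictScalars ℝ
  refine (h2.comp z h1).congr_fderiv (ContinuousLinearMap.ext fun e => ?_)
  rw [expW'_apply, ← mul_smul_comm]
  rfl

lemma HolderData.exists_intFactor (H : HolderData ν K a) (c : ℂ) :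
    ∃ B, IntFactor (fun z => -c * a z) (expW a c) (expW' a c) B := by
  obtain ⟨B, hB⟩ := H.exists_expoW_bound
  have hB0 : 0 ≤ B := (norm_nonneg _).trans (hB 0 (by simp [disc])).1
  have hn : ∀ z ∈ disc, ‖expW a c z‖ ≤ Real.exp (‖c‖ * B) := fun z hz => by
    refine (Wiener.norm_exp_le _).trans ?_
    rw [norm_smul]
    exact Real.exp_le_exp.2 (by gcongr; exact (hB z hz).1)
  have hn' : ∀ z ∈ disc, ∀ e, ‖e‖ = 1 → ‖expW' a c z e‖ ≤ ‖c‖ * (Real.exp (‖c‖ * B) * B) :=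
    fun z hz e he => by
      rw [expW'_apply, norm_smul]
      gcongr
      refine (norm_mul_le _ _).trans (mul_le_mul (hn z hz) ?_ (norm_nonneg _) (Real.exp_nonneg _))
      have := (expoW' a z).le_opNorm e
      rw [he, mul_one] at this
      exact this.trans (hB z hz).2
  refine ⟨max (Real.exp (‖c‖ * B)) (‖c‖ * (Real.exp (‖c‖ * B) * B)), ?_⟩
  refine ⟨fun z hz => H.hasFDerivAt_expW c hz, ?_, fun z hz => le_max_of_le_left (hn z hz),
    fun z hz => le_max_of_le_right (hn' z hz 1 (by simp)),
    fun z hz => le_max_of_le_right (hn' z hz Complex.I (by simp)), fun z hz => ?_⟩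
  · have h1 : ContinuousOn (expW a c) disc :=
      fun z hz => (H.hasFDerivAt_expW c hz).continuousAt.continuousWithinAt
    have h2 : ∀ e, ContinuousOn (fun z => c • (expW a c z * expoW' a z e)) disc := fun e =>
      (h1.mul (H.continuousOn_expoW'.clm_apply continuousOn_const)).const_smul c
    exact (h2 1).clmOf (h2 Complex.I)
  · refine Wiener.ext_ev fun φ => ?_
    rw [transport_ev, expW'_apply]
    simp only [map_smul, map_mul, H.ev_expoW'_dir hz, Wiener.ev_gen, smul_eq_mul]
    ring

lemma HolderData.coeff_expW_neg_one (H : HolderData ν K a) (hz : z ∈ disc) (k : ℕ) :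
    (expW a (-1) z).coeff k = alpha a k z := by
  rw [← Wiener.fourierMode_ev, alpha]
  congr 1
  funext φ
  rw [expW, Wiener.ev_exp, neg_one_smul, map_neg, H.ev_expoW hz]

lemma HolderData.coeff_expW_one (H : HolderData ν K a) (hz : z ∈ disc) (k : ℕ) :
    (expW a 1 z).coeff k = beta a k z := by
  rw [← Wiener.fourierMode_ev, beta]
  congr 1
  funext φ
  rw [expW, Wiener.ev_exp, one_smul, H.ev_expoW hz]

lemma expW_mul_expW_neg (z c : ℂ) : expW a c z * expW a (-c) z = 1 := by
  rw [expW, expW, ← NormedSpace.exp_add]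
  simp

end

section

/-! ### The action of the Wiener algebra on sequences -/

namespace Wiener

/-- The convolution of `x` with the sequence `c`: the operator `∑_k x_k L^k`. -/
def act (x : Wiener) (c : ℕ → ℂ) (n : ℕ) : ℂ := ∑' k, x.coeff k * c (n + k)

variable {c d : ℕ → ℂ} {M : ℝ}

lemma summable_norm_act (x : Wiener) (hc : ∀ n, ‖c n‖ ≤ M) (n : ℕ) :
    Summable fun k => ‖x.coeff k * c (n + k)‖ := by
  refine Summable.of_nonneg_of_le (fun _ => norm_nonneg _) (fun k => ?_)
    (x.summable_norm.mul_right M)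
  rw [norm_mul]
  gcongr
  exact hc _

lemma summable_act (x : Wiener) (hc : ∀ n, ‖c n‖ ≤ M) (n : ℕ) :
    Summable fun k => x.coeff k * c (n + k) := (x.summable_norm_act hc n).of_norm

lemma add_act (x y : Wiener) (hc : ∀ n, ‖c n‖ ≤ M) (n : ℕ) :
    (x + y).act c n = x.act c n + y.act c n := by
  rw [act, act, act, ← (x.summable_act hc n).tsum_add (y.summable_act hc n)]
  exact tsum_congr fun k => by rw [coeff_add, add_mul]

lemma smul_act (r : ℂ) (x : Wiener) (c : ℕ → ℂ) (n : ℕ) : (r • x).act c n = r * x.act c n := by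
  rw [act, act, ← tsum_mul_left]
  exact tsum_congr fun k => by rw [coeff_smul, mul_assoc]

lemma sub_act (x y : Wiener) (hc : ∀ n, ‖c n‖ ≤ M) (n : ℕ) :
    (x - y).act c n = x.act c n - y.act c n := by
  have := add_act x ((-1 : ℂ) • y) hc n
  rw [smul_act, neg_one_smul, ← sub_eq_add_neg] at this
  rw [this]; ring

lemma act_add (x : Wiener) (hc : ∀ n, ‖c n‖ ≤ M) {N : ℝ} (hd : ∀ n, ‖d n‖ ≤ N) (n : ℕ) :
    x.act (fun m => c m + d m) n = x.act c n + x.act d n := by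
  rw [act, act, act, ← (x.summable_act hc n).tsum_add (x.summable_act hd n)]
  exact tsum_congr fun k => by rw [mul_add]

lemma act_const_mul (r : ℂ) (x : Wiener) (c : ℕ → ℂ) (n : ℕ) :
    x.act (fun m => r * c m) n = r * x.act c n := by
  rw [act, act, ← tsum_mul_left]
  exact tsum_congr fun k => by ring

lemma act_shift (x : Wiener) (c : ℕ → ℂ) (j n : ℕ) :
    x.act (fun m => c (m + j)) n = x.act c (n + j) :=
  tsum_congr fun k => by rw [add_right_comm]

lemma one_act (c : ℕ → ℂ) (n : ℕ) : (1 : Wiener).act c n = c n := by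
  rw [act, tsum_eq_single 0] <;> simp +contextual [coeff_one]

lemma gen_mul_act (x : Wiener) (hc : ∀ n, ‖c n‖ ≤ M) (n : ℕ) :
    (gen * x).act c n = x.act c (n + 1) := by
  rw [act, ((gen * x).summable_act hc n).tsum_eq_zero_add, coeff_gen_mul_zero, zero_mul, zero_add,
    act]
  exact tsum_congr fun k => by rw [coeff_gen_mul_succ, add_assoc, add_comm 1 k]

/-- Absolute convergence of the double series allows regrouping along antidiagonals, so composing
the operators corresponds to the Cauchy product of their symbols. -/
lemma mul_act (x y : Wiener) (hc : ∀ n, ‖c n‖ ≤ M) (n : ℕ) :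
    (x * y).act c n = x.act (y.act c) n := by
  have hs : Summable fun p : ℕ × ℕ => x.coeff p.1 * (y.coeff p.2 * c (n + p.1 + p.2)) := by
    refine Summable.of_norm_bounded
      ((x.summable_norm.mul_of_nonneg y.summable_norm (fun _ => norm_nonneg _)
        fun _ => norm_nonneg _).mul_right M) fun p => ?_
    rw [norm_mul, norm_mul, ← mul_assoc]
    gcongr
    exact hc _
  have h1 : x.act (y.act c) n =
      ∑' p : ℕ × ℕ, x.coeff p.1 * (y.coeff p.2 * c (n + p.1 + p.2)) := by
    rw [hs.tsum_prod]
    exact tsum_congr fun k => (tsum_mul_left (a := x.coeff k)).symm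
  have h2 : Summable fun q : Σ m : ℕ, Finset.HasAntidiagonal.antidiagonal m =>
      x.coeff q.2.1.1 * (y.coeff q.2.1.2 * c (n + q.2.1.1 + q.2.1.2)) :=
    Finset.HasAntidiagonal.sigmaAntidiagonalEquivProd.summable_iff.2 hs
  rw [h1, ← Finset.HasAntidiagonal.sigmaAntidiagonalEquivProd.tsum_eq]
  refine Eq.trans ?_ (h2.tsum_sigma' fun _ => (hasSum_fintype _).summable).symm
  refine tsum_congr fun k => ?_
  rw [tsum_fintype, coeff_mul, Finset.sum_mul, ← Finset.sum_coe_sort]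
  refine Finset.sum_congr rfl fun p _ => ?_
  rw [add_assoc, Finset.HasAntidiagonal.mem_antidiagonal.1 p.2, mul_assoc]

end Wiener

/-! ### Young's inequality -/

lemma two_mul_mul_le_sq_add_sq (a b : ENNReal) : 2 * (a * b) ≤ a ^ 2 + b ^ 2 := by
  rcases eq_or_ne a ⊤ with rfl | ha
  · simp
  rcases eq_or_ne b ⊤ with rfl | hb
  · simp
  lift a to NNReal using ha
  lift b to NNReal using hb
  norm_cast
  rw [← mul_assoc]
  exact two_mul_le_add_sq a b

/-- Cauchy–Schwarz with weights x, obtained by symmetrising the double sum and using 2 c_k c_j ≤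
c_k² + c_j². It holds for infinite values too, so no summability has to be tracked. -/
lemma sq_tsum_mul_le (x c : ℕ → ENNReal) :
    (∑' k, x k * c k) ^ 2 ≤ (∑' k, x k) * ∑' k, x k * c k ^ 2 := by
  have h1 : (∑' k, x k * c k) ^ 2 = ∑' k, ∑' j, x k * x j * (c k * c j) := by
    rw [sq, ← ENNReal.tsum_mul_right]
    refine tsum_congr fun k => ?_
    rw [← ENNReal.tsum_mul_left]
    exact tsum_congr fun j => by ring
  have h2 : (∑' k, x k) * ∑' k, x k * c k ^ 2 = ∑' k, ∑' j, x k * x j * c j ^ 2 := by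
    rw [← ENNReal.tsum_mul_right]
    refine tsum_congr fun k => ?_
    rw [← ENNReal.tsum_mul_left]
    exact tsum_congr fun j => by ring
  have h3 : (∑' k, x k) * ∑' k, x k * c k ^ 2 = ∑' k, ∑' j, x k * x j * c k ^ 2 := by
    rw [h2, ENNReal.tsum_comm]
    exact tsum_congr fun k => tsum_congr fun j => by ring
  have h4 : 2 * (∑' k, x k * c k) ^ 2 ≤ 2 * ((∑' k, x k) * ∑' k, x k * c k ^ 2) := by
    rw [two_mul ((∑' k, x k) * _)]
    nth_rewrite 1 [h3]
    rw [h2, h1, ← ENNReal.tsum_add, ← ENNReal.tsum_mul_left]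
    refine ENNReal.tsum_le_tsum fun k => ?_
    rw [← ENNReal.tsum_add, ← ENNReal.tsum_mul_left]
    refine ENNReal.tsum_le_tsum fun j => ?_
    calc 2 * (x k * x j * (c k * c j)) = x k * x j * (2 * (c k * c j)) := by ring
      _ ≤ x k * x j * (c k ^ 2 + c j ^ 2) := by gcongr; exact two_mul_mul_le_sq_add_sq _ _
      _ = _ := by ring
  exact (ENNReal.mul_le_mul_iff_right two_ne_zero ENNReal.ofNat_ne_top).1 h4

/-- Sum the weighted Cauchy–Schwarz inequality over n; a shifted sequence has no larger square sum.
-/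
lemma tsum_sq_tsum_mul_le (x c : ℕ → ENNReal) :
    ∑' n, (∑' k, x k * c (n + k)) ^ 2 ≤ (∑' k, x k) ^ 2 * ∑' n, c n ^ 2 := by
  refine (ENNReal.tsum_le_tsum fun n => sq_tsum_mul_le x fun k => c (n + k)).trans ?_
  rw [ENNReal.tsum_mul_left, ENNReal.tsum_comm, sq, mul_assoc]
  gcongr
  rw [← ENNReal.tsum_mul_right]
  refine ENNReal.tsum_le_tsum fun k => ?_
  rw [ENNReal.tsum_mul_left]
  refine mul_le_mul_right ?_ _
  exact ENNReal.tsum_comp_le_tsum_of_injective (add_left_injective k) fun n => c n ^ 2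

end

section

/-! ### Weak derivatives -/

variable {e : ℂ} {f g : ℂ → ℂ}

lemma measurableSet_disc : MeasurableSet disc := isOpen_disc.measurableSet

lemma integrableOn_smul_of_hasCompactSupport (hg : LocallyIntegrableOn g disc) {φ : ℂ → ℝ}
    (hφ : Continuous φ) (hc : HasCompactSupport φ) (hs : tsupport φ ⊆ disc) :
    IntegrableOn (fun z => φ z • g z) disc := by
  have h : IntegrableOn (fun z => φ z • g z) (tsupport φ) :=
    (hg.integrableOn_compact_subset hs hc).continuousOn_smul hφ.continuousOn hc
  refine ((integrableOn_iff_integrable_of_support_subset fun z hz => ?_).1 h).integrableOn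
  refine subset_tsupport φ fun h0 => hz ?_
  simp [h0]

/-- The fundamental lemma of the calculus of variations. It makes the choice hidden in `weakPartial`
harmless. -/
lemma HasWeakPartial.unique {g' : ℂ → ℂ} (h : HasWeakPartial e f g) (h' : HasWeakPartial e f g') :
    g =ᵐ[discMeasure] g' := by
  have := isOpen_disc.ae_eq_zero_of_integral_contDiff_smul_eq_zero (h.2.1.sub h'.2.1)
    fun φ hφ hc hs => by
      have h1 := h.2.2 φ hφ hc hs
      have h2 := h'.2.2 φ hφ hc hs
      have h3 : ∫ z, φ z • (g - g') z = ∫ z in disc, φ z • (g - g') z := by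
        refine (setIntegral_eq_integral_of_forall_compl_eq_zero fun z hz => ?_).symm
        rw [image_eq_zero_of_notMem_tsupport fun h => hz (hs h), zero_smul]
      rw [h3]
      simp only [Pi.sub_apply, smul_sub]
      rw [integral_sub (integrableOn_smul_of_hasCompactSupport h.2.1 hφ.continuous hc hs)
        (integrableOn_smul_of_hasCompactSupport h'.2.1 hφ.continuous hc hs)]
      rw [h1, neg_inj] at h2
      rw [h2, sub_self]
  rw [discMeasure, EventuallyEq, ae_restrict_iff' measurableSet_disc]
  filter_upwards [this] with z hz hz'
  exact sub_eq_zero.1 (hz hz')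

lemma HasWeakPartial.hasWeakPartial_weakPartial (h : HasWeakPartial e f g) :
    HasWeakPartial e f (weakPartial e f) := by
  have hex : ∃ g, HasWeakPartial e f g := ⟨g, h⟩
  rw [weakPartial, dif_pos hex]
  exact hex.choose_spec

lemma HasWeakPartial.weakPartial_ae_eq (h : HasWeakPartial e f g) :
    weakPartial e f =ᵐ[discMeasure] g := h.hasWeakPartial_weakPartial.unique h

/-- Mollified continuous test functions converge against locally integrable functions. -/
lemma tendsto_integral_mollify (hf : LocallyIntegrableOn f disc) {ρ : ℂ → ℝ} (hρ : Continuous ρ)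
    {k : Set ℂ} (hk : IsCompact k) (hkd : k ⊆ disc) (hc : HasCompactSupport ρ)
    {η : ℕ → ContDiffBump (0 : ℂ)}
    (hη : Tendsto (fun n => (η n).rOut) atTop (𝓝 0))
    (h0 : ∀ n, ∀ z ∉ k,
      convolution ((η n).normed volume) ρ (ContinuousLinearMap.lsmul ℝ ℝ) volume z = 0) :
    Tendsto (fun n => ∫ z in disc,
      convolution ((η n).normed volume) ρ (ContinuousLinearMap.lsmul ℝ ℝ) volume z • f z) atTop
      (𝓝 (∫ z in disc, ρ z • f z)) := by
  obtain ⟨C, hC⟩ := hc.exists_bound_of_continuous hρ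
  have hbd : ∀ n z,
      ‖convolution ((η n).normed volume) ρ (ContinuousLinearMap.lsmul ℝ ℝ) volume z‖ ≤ 3 * C :=
    fun n z => by
      -- An average of ρ differs from ρ by at most 2C; adding |ρ| ≤ C gives 3C.
      have h1 := (η n).dist_normed_convolution_le (μ := volume) (x₀ := z) (ε := 2 * C)
        hρ.aestronglyMeasurable fun x _ => by
          rw [dist_eq_norm, two_mul]
          exact (norm_sub_le _ _).trans (add_le_add (hC _) (hC _))
      rw [dist_eq_norm] at h1
      have := norm_le_norm_add_norm_sub'
        (convolution ((η n).normed volume) ρ (ContinuousLinearMap.lsmul ℝ ℝ) volume z) (ρ z)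
      linarith [hC z]
  have hfm : AEStronglyMeasurable f (volume.restrict disc) := hf.aestronglyMeasurable
  have hcont : ∀ n, Continuous
      (convolution ((η n).normed volume) ρ (ContinuousLinearMap.lsmul ℝ ℝ) volume) := fun n =>
    (hc.continuous_convolution_right _ (η n).continuous_normed.locallyIntegrable hρ)
  refine tendsto_integral_of_dominated_convergence
    (k.indicator fun z => 3 * C * ‖f z‖) (fun n => ?_) ?_ (fun n => ?_) ?_
  · exact (hcont n).aestronglyMeasurable.smul hfm
  · have h1 : IntegrableOn (fun z => 3 * C * ‖f z‖) k :=
      (hf.integrableOn_compact_subset hkd hk).norm.const_mul _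
    exact (h1.integrable_indicator hk.measurableSet).integrableOn
  · refine ae_of_all _ fun z => ?_
    by_cases hz : z ∈ k
    · rw [indicator_of_mem hz, norm_smul]
      gcongr
      exact hbd n z
    · rw [h0 n z hz, indicator_of_notMem hz]; simp
  · exact ae_of_all _ fun z =>
      (ContDiffBump.convolution_tendsto_right_of_continuous hη hρ z).smul_const _

/-- Test functions of class `C¹` are allowed. -/
lemma HasWeakPartial.integral_eq (h : HasWeakPartial e f g) {φ : ℂ → ℝ} (hφ : ContDiff ℝ 1 φ)
    (hc : HasCompactSupport φ) (hs : tsupport φ ⊆ disc) :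
    ∫ z in disc, (fderiv ℝ φ z e) • f z = -∫ z in disc, φ z • g z := by
  obtain ⟨δ, hδ, hδd⟩ := IsCompact.exists_cthickening_subset_open hc isOpen_disc hs
  -- The radii tend to 0 and stay at most δ, so all mollified functions live in one compact subset
  -- of Ω.
  let η : ℕ → ContDiffBump (0 : ℂ) := fun n =>
    ⟨δ / (n + 2) / 2, δ / (n + 2), by positivity, half_lt_self (by positivity)⟩
  have hη : Tendsto (fun n => (η n).rOut) atTop (𝓝 0) :=
    Tendsto.const_div_atTop (tendsto_atTop_add_const_right _ _ tendsto_natCast_atTop_atTop) _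
  have hle : ∀ n, (η n).rOut ≤ δ := fun n => div_le_self hδ.le (by
    have : (0 : ℝ) ≤ n := n.cast_nonneg
    linarith)
  have hk : IsCompact (Metric.cthickening δ (tsupport φ)) := IsCompact.cthickening hc
  have hsupp : ∀ ρ : ℂ → ℝ, Function.support ρ ⊆ tsupport φ → ∀ n,
      ∀ z ∉ Metric.cthickening δ (tsupport φ),
      convolution ((η n).normed volume) ρ (ContinuousLinearMap.lsmul ℝ ℝ) volume z = 0 :=
    fun ρ hρ n z hz => by
      by_contra hne
      have hmem := support_convolution_subset (ContinuousLinearMap.lsmul ℝ ℝ)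
        (Function.mem_support.2 hne)
      rw [(η n).support_normed_eq] at hmem
      obtain ⟨x, hx, y, hy, rfl⟩ := hmem
      refine hz (Metric.mem_cthickening_of_dist_le _ y _ _ (hρ hy) ?_)
      simp only [dist_eq_norm, add_sub_cancel_right]
      exact (mem_ball_zero_iff.1 hx).le.trans (hle n)
  have hD : Continuous fun z => fderiv ℝ φ z e :=
    (hφ.continuous_fderiv one_ne_zero).clm_apply continuous_const
  have hDs : Function.support (fun z => fderiv ℝ φ z e) ⊆ tsupport φ := fun z hz =>
    support_fderiv_subset ℝ (fun h0 => hz (by simp [h0]))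
  have hDc : HasCompactSupport fun z => fderiv ℝ φ z e := HasCompactSupport.intro hc
    fun z hz => by
      by_contra h0
      exact hz (hDs h0)
  have t1 := tendsto_integral_mollify h.1 hD hk hδd hDc hη (hsupp _ hDs)
  have t2 := tendsto_integral_mollify h.2.1 hφ.continuous hk hδd hc hη
    (hsupp _ (subset_tsupport φ))
  refine tendsto_nhds_unique (t1.congr fun n => ?_) t2.neg
  set ψ := convolution ((η n).normed volume) φ (ContinuousLinearMap.lsmul ℝ ℝ) volume with hψ
  have hli : LocallyIntegrable ((η n).normed volume) :=
    (η n).continuous_normed.locallyIntegrable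
  have hψs : tsupport ψ ⊆ Metric.cthickening δ (tsupport φ) :=
    closure_minimal (fun z hz => by
      by_contra hz'
      exact hz (hsupp φ (subset_tsupport φ) n z hz')) Metric.isClosed_cthickening
  rw [← h.2.2 ψ ((η n).hasCompactSupport_normed.contDiff_convolution_left _
    (η n).contDiff_normed hφ.continuous.locallyIntegrable)
    (hk.of_isClosed_subset (isClosed_tsupport _) hψs) (hψs.trans hδd)]
  refine integral_congr_ae (ae_of_all _ fun z => ?_)
  have := (hc.hasFDerivAt_convolution_right (ContinuousLinearMap.lsmul ℝ ℝ) hli hφ z).fderiv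
  simp only [hψ, this]
  rw [convolution_precompR_apply _ hli (hc.fderiv ℝ) (hφ.continuous_fderiv one_ne_zero)]

/-- Complex-valued test functions of class `C¹` are allowed. -/
lemma HasWeakPartial.integral_mul_eq (h : HasWeakPartial e f g) {ψ : ℂ → ℂ} (hψ : ContDiff ℝ 1 ψ)
    (hc : HasCompactSupport ψ) (hs : tsupport ψ ⊆ disc) :
    ∫ z in disc, fderiv ℝ ψ z e * f z = -∫ z in disc, ψ z * g z := by
  have hre : ContDiff ℝ 1 fun z => (ψ z).re := Complex.reCLM.contDiff.comp hψ
  have him : ContDiff ℝ 1 fun z => (ψ z).im := Complex.imCLM.contDiff.comp hψ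
  have hcre : HasCompactSupport fun z => (ψ z).re := hc.comp_left (g := Complex.re) rfl
  have hcim : HasCompactSupport fun z => (ψ z).im := hc.comp_left (g := Complex.im) rfl
  have hsre : tsupport (fun z => (ψ z).re) ⊆ disc :=
    (closure_mono (Function.support_comp_subset (g := Complex.re) rfl ψ)).trans hs
  have hsim : tsupport (fun z => (ψ z).im) ⊆ disc :=
    (closure_mono (Function.support_comp_subset (g := Complex.im) rfl ψ)).trans hs
  have hd : ∀ z, HasFDerivAt ψ (fderiv ℝ ψ z) z := fun z =>
    (hψ.differentiable one_ne_zero z).hasFDerivAt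
  have hdre : ∀ z, fderiv ℝ (fun z => (ψ z).re) z e = (fderiv ℝ ψ z e).re := fun z => by
    exact congrArg (fun L => L e) (Complex.reCLM.hasFDerivAt.comp z (hd z)).fderiv
  have hdim : ∀ z, fderiv ℝ (fun z => (ψ z).im) z e = (fderiv ℝ ψ z e).im := fun z => by
    exact congrArg (fun L => L e) (Complex.imCLM.hasFDerivAt.comp z (hd z)).fderiv
  have hDe : ∀ {φ : ℂ → ℝ}, ContDiff ℝ 1 φ → HasCompactSupport φ → tsupport φ ⊆ disc →
      IntegrableOn (fun z => fderiv ℝ φ z e • f z) disc := fun {φ} h1 h2 h3 =>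
    integrableOn_smul_of_hasCompactSupport h.1
      ((h1.continuous_fderiv one_ne_zero).clm_apply continuous_const)
      (h2.fderiv_apply ℝ e) ((tsupport_fderiv_apply_subset ℝ e).trans h3)
  have key : ∀ z w : ℂ, z * w = z.re • w + Complex.I * (z.im • w) := fun z w => by
    conv_lhs => rw [← Complex.re_add_im z]
    simp only [Complex.real_smul]; ring
  have e1 : ∀ z, fderiv ℝ ψ z e * f z = fderiv ℝ (fun z => (ψ z).re) z e • f z +
      Complex.I * (fderiv ℝ (fun z => (ψ z).im) z e • f z) := fun z => by
    rw [hdre, hdim]; exact key _ _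
  simp only [e1, fun z => key (ψ z) (g z)]
  rw [integral_add (hDe hre hcre hsre) ((hDe him hcim hsim).const_mul _),
    integral_add (integrableOn_smul_of_hasCompactSupport h.2.1 hre.continuous hcre hsre)
      ((integrableOn_smul_of_hasCompactSupport h.2.1 him.continuous hcim hsim).const_mul _),
    integral_const_mul, integral_const_mul, h.integral_eq hre hcre hsre,
    h.integral_eq him hcim hsim]
  ring

/-- The product rule. -/
lemma HasWeakPartial.mul {γ : ℂ → ℂ} {γ' : ℂ → ℂ →L[ℝ] ℂ}
    (hγ : ∀ z ∈ disc, HasFDerivAt γ (γ' z) z) (hγ' : ContinuousOn γ' disc)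
    (h : HasWeakPartial e f g) :
    HasWeakPartial e (fun z => γ z * f z) (fun z => γ z * g z + γ' z e * f z) := by
  have hlc : IsLocallyClosed disc := isOpen_disc.isLocallyClosed
  have hγc : ContinuousOn γ disc := fun z hz => (hγ z hz).continuousAt.continuousWithinAt
  have hγe : ContinuousOn (fun z => γ' z e) disc := hγ'.clm_apply continuousOn_const
  have l1 := h.1.continuousOn_mul hγc hlc
  have l2 := h.2.1.continuousOn_mul hγc hlc
  have l3 := h.1.continuousOn_mul hγe hlc
  refine ⟨l1, l2.add l3, fun φ hφ hc hs => ?_⟩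
  have hφ1 : ContDiff ℝ 1 φ := hφ.of_le (by exact_mod_cast le_top)
  have hψ0 : ∀ z ∉ tsupport φ, (fun z => φ z • γ z) =ᶠ[𝓝 z] 0 := fun z hz => by
    filter_upwards [(isClosed_tsupport φ).isOpen_compl.mem_nhds hz] with w hw
    simp [image_eq_zero_of_notMem_tsupport hw]
  have hγ1 : ContDiffOn ℝ 1 γ disc := by
    rw [← zero_add (1 : WithTop ℕ∞), contDiffOn_succ_iff_fderiv_of_isOpen isOpen_disc]
    exact ⟨fun z hz => (hγ z hz).differentiableAt.differentiableWithinAt, by simp,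
      contDiffOn_zero.2 (hγ'.congr fun z hz => (hγ z hz).fderiv)⟩
  -- Moving γ onto the test function leaves only a complex-valued C¹ test function, because γ is
  -- merely C¹ in Ω; near points outside the support of φ the product is zero.
  have hψ : ContDiff ℝ 1 fun z => φ z • γ z := contDiff_iff_contDiffAt.2 fun z => by
    by_cases hz : z ∈ tsupport φ
    · exact hφ1.contDiffAt.smul (hγ1.contDiffAt (isOpen_disc.mem_nhds (hs hz)))
    · exact contDiffAt_const.congr_of_eventuallyEq (hψ0 z hz)
  have hψs : tsupport (fun z => φ z • γ z) ⊆ tsupport φ :=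
    closure_mono fun z hz h0 => hz (by simp [h0])
  have key := h.integral_mul_eq hψ (hc.of_isClosed_subset (isClosed_tsupport _) hψs)
    (hψs.trans hs)
  have hd : ∀ z ∈ disc, fderiv ℝ (fun z => φ z • γ z) z e =
      fderiv ℝ φ z e • γ z + φ z • γ' z e := fun z hz => by
    refine (congrArg (fun L => L e)
      (((hφ1.differentiable one_ne_zero z).hasFDerivAt).smul (hγ z hz)).fderiv).trans ?_
    simp [add_comm]
  have i1 : IntegrableOn (fun z => fderiv ℝ φ z e • (γ z * f z)) disc :=
    integrableOn_smul_of_hasCompactSupport l1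
      ((hφ1.continuous_fderiv one_ne_zero).clm_apply continuous_const)
      (hc.fderiv_apply ℝ e) ((tsupport_fderiv_apply_subset ℝ e).trans hs)
  have i2 := integrableOn_smul_of_hasCompactSupport l2 hφ.continuous hc hs
  have i3 := integrableOn_smul_of_hasCompactSupport l3 hφ.continuous hc hs
  have e1 : ∫ z in disc, fderiv ℝ (fun z => φ z • γ z) z e * f z =
      ∫ z in disc, (fderiv ℝ φ z e • (γ z * f z) + φ z • (γ' z e * f z)) :=
    setIntegral_congr_fun measurableSet_disc fun z hz => by
      simp only [hd z hz, add_mul, smul_mul_assoc]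
  simp only [smul_mul_assoc] at key
  rw [e1, integral_add i1 i3] at key
  simp only [smul_add]
  rw [integral_add i2 i3, neg_add, ← key]
  ring

end

section

/-! ### Square summable sequences -/

instance : IsFiniteMeasure discMeasure :=
  ⟨by rw [discMeasure, Measure.restrict_apply_univ]; exact measure_ball_lt_top⟩

lemma memLp_two_iff {f : ℂ → ℂ} : MemLp f 2 discMeasure ↔
    AEStronglyMeasurable f discMeasure ∧ ∫⁻ z, ‖f z‖ₑ ^ 2 ∂discMeasure < ⊤ := by
  refine and_congr_right fun _ => ?_
  rw [eLpNorm_lt_top_iff_lintegral_rpow_enorm_lt_top two_ne_zero ENNReal.ofNat_ne_top]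
  simp

lemma meml2L2_iff {c : ℕ → ℂ → ℂ} : Meml2L2 c ↔ (∀ n, AEStronglyMeasurable (c n) discMeasure) ∧
    ∑' n, ∫⁻ z, ‖c n z‖ₑ ^ 2 ∂discMeasure < ⊤ := by
  refine ⟨fun h => ⟨fun n => (h.1 n).1, h.2⟩, fun h => ⟨fun n => memLp_two_iff.2 ⟨h.1 n, ?_⟩, h.2⟩⟩
  exact (ENNReal.le_tsum n).trans_lt h.2

namespace Meml2L2

variable {c d : ℕ → ℂ → ℂ}

lemma congr (hc : Meml2L2 c) (h : ∀ n, d n =ᵐ[discMeasure] c n) : Meml2L2 d := by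
  refine ⟨fun n => (hc.1 n).ae_eq (h n).symm, ?_⟩
  have : ∀ n, ∫⁻ z, ‖d n z‖ₑ ^ 2 ∂discMeasure = ∫⁻ z, ‖c n z‖ₑ ^ 2 ∂discMeasure := fun n =>
    lintegral_congr_ae ((h n).mono fun z hz => by simp only [hz])
  simpa only [this] using hc.2

lemma add (hc : Meml2L2 c) (hd : Meml2L2 d) : Meml2L2 fun n z => c n z + d n z := by
  refine ⟨fun n => (hc.1 n).add (hd.1 n), ?_⟩
  have h : ∀ n, ∫⁻ z, ‖c n z + d n z‖ₑ ^ 2 ∂discMeasure ≤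
      2 * ∫⁻ z, ‖c n z‖ₑ ^ 2 ∂discMeasure + 2 * ∫⁻ z, ‖d n z‖ₑ ^ 2 ∂discMeasure := fun n => by
    rw [← lintegral_const_mul' _ _ ENNReal.ofNat_ne_top,
      ← lintegral_const_mul' _ _ ENNReal.ofNat_ne_top,
      ← lintegral_add_left' (((hc.1 n).1.enorm.pow_const 2).const_mul _)]
    refine lintegral_mono fun z => ?_
    calc ‖c n z + d n z‖ₑ ^ 2 ≤ (‖c n z‖ₑ + ‖d n z‖ₑ) ^ 2 := by gcongr; exact enorm_add_le _ _
      _ = ‖c n z‖ₑ ^ 2 + ‖d n z‖ₑ ^ 2 + 2 * (‖c n z‖ₑ * ‖d n z‖ₑ) := by ring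
      _ ≤ ‖c n z‖ₑ ^ 2 + ‖d n z‖ₑ ^ 2 + (‖c n z‖ₑ ^ 2 + ‖d n z‖ₑ ^ 2) := by
        gcongr; exact two_mul_mul_le_sq_add_sq _ _
      _ = _ := by ring
  refine (ENNReal.tsum_le_tsum h).trans_lt ?_
  rw [ENNReal.tsum_add, ENNReal.tsum_mul_left, ENNReal.tsum_mul_left]
  exact ENNReal.add_lt_top.2 ⟨ENNReal.mul_lt_top (by simp) hc.2, ENNReal.mul_lt_top (by simp) hd.2⟩

/-- By Tonelli Σ |c_n(z)|² is finite for almost every z. Boundedness of z's sequence is all that an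
ℓ¹ symbol needs in order to act by an absolutely convergent series. -/
lemma ae_bounded (hc : Meml2L2 c) : ∀ᵐ z ∂discMeasure, ∃ M, ∀ n, ‖c n z‖ ≤ M := by
  have h : ∫⁻ z, ∑' n, ‖c n z‖ₑ ^ 2 ∂discMeasure < ⊤ := by
    rw [lintegral_tsum fun n => (hc.1 n).1.enorm.pow_const 2]
    exact hc.2
  filter_upwards [ae_lt_top' (AEMeasurable.tsum fun n => (hc.1 n).1.enorm.pow_const 2)
    h.ne] with z hz
  refine ⟨1 + (∑' n, ‖c n z‖ₑ ^ 2).toReal, fun n => ?_⟩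
  have h1 : ‖c n z‖ ^ 2 ≤ (∑' n, ‖c n z‖ₑ ^ 2).toReal := by
    have := ENNReal.toReal_mono hz.ne (ENNReal.le_tsum (f := fun n => ‖c n z‖ₑ ^ 2) n)
    simpa [ENNReal.toReal_pow] using this
  nlinarith [sq_nonneg (‖c n z‖ - 1), norm_nonneg (c n z)]

end Meml2L2

/-! ### Convolutions with a continuous family in the Wiener algebra -/

lemma Wiener.tsum_enorm_coeff (x : Wiener) : ∑' k, ‖x.coeff k‖ₑ = ‖x‖ₑ := by
  simp only [← ofReal_norm]
  rw [← ENNReal.ofReal_tsum_of_nonneg (fun _ => norm_nonneg _) x.summable_norm, x.norm_eq]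

lemma Wiener.enorm_act_le (x : Wiener) (c : ℕ → ℂ) (n : ℕ) :
    ‖x.act c n‖ₑ ≤ ∑' k, ‖x.coeff k‖ₑ * ‖c (n + k)‖ₑ := by
  refine (enorm_tsum_le_tsum_enorm (f := fun k => x.coeff k * c (n + k))).trans (le_of_eq ?_)
  exact tsum_congr fun k => enorm_mul _ _

section Family

variable {X : ℂ → Wiener} {B : ℝ} {c : ℕ → ℂ → ℂ}

lemma aestronglyMeasurable_coeff (hX : ContinuousOn X disc) (k : ℕ) :
    AEStronglyMeasurable (fun z => (X z).coeff k) discMeasure :=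
  ((Wiener.coeffL k).continuous.comp_continuousOn hX).aestronglyMeasurable measurableSet_disc

lemma aestronglyMeasurable_term (hX : ContinuousOn X disc) (hc : Meml2L2 c) (n k : ℕ) :
    AEStronglyMeasurable (fun z => (X z).coeff k * c (n + k) z) discMeasure :=
  (aestronglyMeasurable_coeff hX k).mul (hc.1 _).1

/-- Young's inequality at each point of Ω with the uniform bound B, followed by Tonelli. -/
lemma tsum_lintegral_sq_lt_top (hX : ContinuousOn X disc) (hB : ∀ z ∈ disc, ‖X z‖ ≤ B)
    (hc : Meml2L2 c) :
    ∑' n, ∫⁻ z, (∑' k, ‖(X z).coeff k‖ₑ * ‖c (n + k) z‖ₑ) ^ 2 ∂discMeasure < ⊤ := by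
  have hm : ∀ n, AEMeasurable (fun z => (∑' k, ‖(X z).coeff k‖ₑ * ‖c (n + k) z‖ₑ) ^ 2)
      discMeasure := fun n => (AEMeasurable.tsum fun k =>
    (aestronglyMeasurable_coeff hX k).enorm.mul (hc.1 _).1.enorm).pow_const 2
  rw [← lintegral_tsum hm]
  have h : ∫⁻ z, ∑' n, (∑' k, ‖(X z).coeff k‖ₑ * ‖c (n + k) z‖ₑ) ^ 2 ∂discMeasure ≤
      ∫⁻ z, ENNReal.ofReal B ^ 2 * ∑' n, ‖c n z‖ₑ ^ 2 ∂discMeasure := by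
    refine lintegral_mono_ae ?_
    filter_upwards [ae_restrict_mem measurableSet_disc] with z hz
    refine (tsum_sq_tsum_mul_le (fun k => ‖(X z).coeff k‖ₑ) fun k => ‖c k z‖ₑ).trans ?_
    rw [Wiener.tsum_enorm_coeff, ← ofReal_norm]
    gcongr
    exact hB z hz
  refine h.trans_lt ?_
  rw [lintegral_const_mul' _ _ (by simp), lintegral_tsum fun n => (hc.1 n).1.enorm.pow_const 2]
  exact ENNReal.mul_lt_top (by simp) hc.2

lemma tsum_lintegral_lt_top (hX : ContinuousOn X disc) (hB : ∀ z ∈ disc, ‖X z‖ ≤ B)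
    (hc : Meml2L2 c) (n : ℕ) :
    ∑' k, ∫⁻ z, ‖(X z).coeff k * c (n + k) z‖ₑ ∂discMeasure < ⊤ := by
  rw [← lintegral_tsum fun k => (aestronglyMeasurable_term hX hc n k).enorm]
  -- From square integrability to integrability by s ≤ 1 + s², the measure being finite.
  have h1 : ∫⁻ z, ∑' k, ‖(X z).coeff k * c (n + k) z‖ₑ ∂discMeasure ≤
      ∫⁻ z, (1 + (∑' k, ‖(X z).coeff k‖ₑ * ‖c (n + k) z‖ₑ) ^ 2) ∂discMeasure := by
    refine lintegral_mono fun z => ?_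
    simp only [enorm_mul]
    generalize ∑' k, ‖(X z).coeff k‖ₑ * ‖c (n + k) z‖ₑ = s
    rcases le_total s 1 with hs | hs
    · exact hs.trans le_self_add
    · exact (le_self_pow₀ hs two_ne_zero).trans le_add_self
  refine h1.trans_lt ?_
  rw [lintegral_add_left measurable_const, lintegral_const, one_mul]
  exact ENNReal.add_lt_top.2 ⟨measure_lt_top _ _,
    (ENNReal.le_tsum n).trans_lt (tsum_lintegral_sq_lt_top hX hB hc)⟩

lemma Meml2L2.act (hX : ContinuousOn X disc) (hB : ∀ z ∈ disc, ‖X z‖ ≤ B) (hc : Meml2L2 c) :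
    Meml2L2 fun n z => (X z).act (fun m => c m z) n := by
  refine meml2L2_iff.2 ⟨fun n => ?_, (ENNReal.tsum_le_tsum fun n => lintegral_mono fun z => ?_).trans_lt
    (tsum_lintegral_sq_lt_top hX hB hc)⟩
  · refine aestronglyMeasurable_of_tendsto_ae atTop
      (f := fun N z => ∑ k ∈ Finset.range N, (X z).coeff k * c (n + k) z) (fun N => ?_) ?_
    · exact Finset.aestronglyMeasurable_fun_sum _ fun k _ => aestronglyMeasurable_term hX hc n k
    · filter_upwards [hc.ae_bounded] with z ⟨M, hM⟩
      exact ((X z).summable_act hM n).hasSum.tendsto_sum_nat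
  · gcongr
    exact Wiener.enorm_act_le _ _ _

end Family

/-! ### Weak derivatives of series -/

/-- Termwise weak differentiation. -/
lemma HasWeakPartial.tsum {e : ℂ} {F G : ℕ → ℂ → ℂ} {f g : ℂ → ℂ}
    (h : ∀ k, HasWeakPartial e (F k) (G k))
    (hF : ∑' k, ∫⁻ z, ‖F k z‖ₑ ∂discMeasure < ⊤) (hG : ∑' k, ∫⁻ z, ‖G k z‖ₑ ∂discMeasure < ⊤)
    (hf : ∀ᵐ z ∂discMeasure, f z = ∑' k, F k z) (hg : ∀ᵐ z ∂discMeasure, g z = ∑' k, G k z)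
    (hfi : Integrable f discMeasure) (hgi : Integrable g discMeasure) :
    HasWeakPartial e f g := by
  have key : ∀ {F : ℕ → ℂ → ℂ} {f : ℂ → ℂ} {ρ : ℂ → ℝ}, (∀ k, LocallyIntegrableOn (F k) disc) →
      ∑' k, ∫⁻ z, ‖F k z‖ₑ ∂discMeasure < ⊤ → (∀ᵐ z ∂discMeasure, f z = ∑' k, F k z) →
      Continuous ρ → HasCompactSupport ρ →
      ∫ z in disc, ρ z • f z = ∑' k, ∫ z in disc, ρ z • F k z := by
    intro F f ρ hl hs hf hρ hc
    obtain ⟨C, hC⟩ := hc.exists_bound_of_continuous hρ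
    rw [← integral_tsum (f := fun k z => ρ z • F k z) (fun k => hρ.aestronglyMeasurable.smul (hl k).aestronglyMeasurable)]
    · refine integral_congr_ae (hf.mono fun z hz => ?_)
      simp only [hz, Complex.real_smul, tsum_mul_left]
    · refine ((ENNReal.tsum_le_tsum fun k => lintegral_mono (g := fun z =>
        ENNReal.ofReal C * ‖F k z‖ₑ) fun z => ?_).trans_lt ?_).ne
      · rw [enorm_smul, ← ofReal_norm]
        exact mul_le_mul' (ENNReal.ofReal_le_ofReal (hC z)) le_rfl
      · simp only [lintegral_const_mul' _ _ (ENNReal.ofReal_ne_top (r := C)),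
          ENNReal.tsum_mul_left]
        exact ENNReal.mul_lt_top (by simp) hs
  refine ⟨IntegrableOn.locallyIntegrableOn hfi, IntegrableOn.locallyIntegrableOn hgi,
    fun φ hφ hc hs => ?_⟩
  rw [key (fun k => (h k).1) hF hf ((hφ.continuous_fderiv (by simp)).clm_apply continuous_const)
    (hc.fderiv_apply ℝ e), key (fun k => (h k).2.1) hG hg hφ.continuous hc, ← tsum_neg]
  exact tsum_congr fun k => (h k).2.2 φ hφ hc hs

end

/-! ### The integrating factor acts on `l²(ℕ; H¹(Ω))` -/

lemma iterate_shift (u : ℕ → ℂ → ℂ) (k n : ℕ) : (shift^[k] u) n = u (n + k) := by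
  induction k generalizing u with
  | zero => rfl
  | succ k ih => rw [Function.iterate_succ_apply, ih, shift, add_assoc]

namespace Meml2H1

variable {u : ℕ → ℂ → ℂ}

lemma meml2L2 (hu : Meml2H1 u) : Meml2L2 u := by
  refine ⟨fun n => (hu.1 n).1, (ENNReal.tsum_le_tsum fun n => lintegral_mono fun z => ?_).trans_lt hu.2⟩
  rw [add_assoc]
  exact le_self_add

lemma hasWeakPartial_one (hu : Meml2H1 u) (n : ℕ) :
    HasWeakPartial 1 (u n) (weakPartial 1 (u n)) :=
  (hu.1 n).2.1.choose_spec.1.hasWeakPartial_weakPartial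

lemma hasWeakPartial_I (hu : Meml2H1 u) (n : ℕ) :
    HasWeakPartial Complex.I (u n) (weakPartial Complex.I (u n)) :=
  (hu.1 n).2.2.choose_spec.1.hasWeakPartial_weakPartial

lemma meml2L2_one (hu : Meml2H1 u) : Meml2L2 fun n => weakPartial 1 (u n) := by
  refine meml2L2_iff.2 ⟨fun n => (hu.hasWeakPartial_one n).2.1.aestronglyMeasurable,
    (ENNReal.tsum_le_tsum fun n => lintegral_mono fun z => ?_).trans_lt hu.2⟩
  rw [add_assoc, add_left_comm]
  exact le_self_add

lemma meml2L2_I (hu : Meml2H1 u) : Meml2L2 fun n => weakPartial Complex.I (u n) := by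
  refine meml2L2_iff.2 ⟨fun n => (hu.hasWeakPartial_I n).2.1.aestronglyMeasurable,
    (ENNReal.tsum_le_tsum fun n => lintegral_mono fun z => ?_).trans_lt hu.2⟩
  exact le_add_self

lemma of_hasWeakPartial {p q : ℕ → ℂ → ℂ} (hu : Meml2L2 u) (hp : Meml2L2 p) (hq : Meml2L2 q)
    (hup : ∀ n, HasWeakPartial 1 (u n) (p n)) (huq : ∀ n, HasWeakPartial Complex.I (u n) (q n)) :
    Meml2H1 u := by
  refine ⟨fun n => ⟨hu.1 n, ⟨_, hup n, hp.1 n⟩, ⟨_, huq n, hq.1 n⟩⟩, ?_⟩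
  have h : ∀ n, h1NormSq (u n) = ∫⁻ z, ‖u n z‖ₑ ^ 2 ∂discMeasure +
      ∫⁻ z, ‖p n z‖ₑ ^ 2 ∂discMeasure + ∫⁻ z, ‖q n z‖ₑ ^ 2 ∂discMeasure := fun n => by
    rw [← lintegral_add_left' ((hu.1 n).1.enorm.pow_const 2),
      ← lintegral_add_right' _ ((hq.1 n).1.enorm.pow_const 2)]
    refine lintegral_congr_ae ?_
    filter_upwards [(hup n).weakPartial_ae_eq, (huq n).weakPartial_ae_eq] with z h1 h2
    rw [h1, h2]
  simp only [h, ENNReal.tsum_add]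
  exact ENNReal.add_lt_top.2 ⟨ENNReal.add_lt_top.2 ⟨hu.2, hp.2⟩, hq.2⟩

end Meml2H1

namespace IntFactor

variable {b : ℂ → ℂ} {Γ : ℂ → Wiener} {Γ' : ℂ → ℂ →L[ℝ] Wiener} {B : ℝ} {u p : ℕ → ℂ → ℂ} {e : ℂ}

lemma continuousOn_self (h : IntFactor b Γ Γ' B) : ContinuousOn Γ disc := fun z hz =>
  (h.hasFDerivAt z hz).continuousAt.continuousWithinAt

lemma continuousOn_apply (h : IntFactor b Γ Γ' B) (e : ℂ) : ContinuousOn (fun z => Γ' z e) disc :=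
  h.continuousOn.clm_apply continuousOn_const

lemma meml2L2_deriv (h : IntFactor b Γ Γ' B) (he : ∀ z ∈ disc, ‖Γ' z e‖ ≤ B) (hu : Meml2L2 u)
    (hp : Meml2L2 p) : Meml2L2 fun n z => (Γ z).act (fun m => p m z) n +
      (Γ' z e).act (fun m => u m z) n :=
  (hp.act h.continuousOn_self h.norm_le).add (hu.act (h.continuousOn_apply e) he)

/-- The product rule applied to each term γ_k u_{n+k}. The L¹ summability of terms and derivatives,
a consequence of Young's inequality, permits termwise weak differentiation. -/
lemma hasWeakPartial_act (h : IntFactor b Γ Γ' B) (he : ∀ z ∈ disc, ‖Γ' z e‖ ≤ B)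
    (hu : Meml2L2 u) (hp : Meml2L2 p) (hup : ∀ n, HasWeakPartial e (u n) (p n)) (n : ℕ) :
    HasWeakPartial e (fun z => (Γ z).act (fun m => u m z) n)
      (fun z => (Γ z).act (fun m => p m z) n + (Γ' z e).act (fun m => u m z) n) := by
  refine HasWeakPartial.tsum (F := fun k z => (Γ z).coeff k * u (n + k) z)
    (G := fun k z => (Γ z).coeff k * p (n + k) z + (Γ' z e).coeff k * u (n + k) z)
    (fun k => ?_) (tsum_lintegral_lt_top h.continuousOn_self h.norm_le hu n) ?_
    (ae_of_all _ fun z => rfl) ?_ (((hu.act h.continuousOn_self h.norm_le).1 n).integrable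
      one_le_two) (((h.meml2L2_deriv he hu hp).1 n).integrable one_le_two)
  · refine HasWeakPartial.mul (γ' := fun z => ((Wiener.coeffL k).restrictScalars ℝ).comp (Γ' z))
      (fun z hz => ?_) (continuousOn_const.clm_comp h.continuousOn) (hup (n + k))
    exact ((Wiener.coeffL k).restrictScalars ℝ).hasFDerivAt.comp z (h.hasFDerivAt z hz)
  · refine (ENNReal.tsum_le_tsum fun k => (lintegral_mono fun z => enorm_add_le _ _).trans
      (lintegral_add_left' (aestronglyMeasurable_term h.continuousOn_self hp n k).enorm _).le).trans_lt
      ?_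
    rw [ENNReal.tsum_add]
    exact ENNReal.add_lt_top.2 ⟨tsum_lintegral_lt_top h.continuousOn_self h.norm_le hp n,
      tsum_lintegral_lt_top (h.continuousOn_apply e) he hu n⟩
  · filter_upwards [hu.ae_bounded, hp.ae_bounded] with z ⟨M, hM⟩ ⟨N, hN⟩
    exact (((Γ z).summable_act hN n).tsum_add ((Γ' z e).summable_act hM n)).symm

/-- The integrating factor maps `l²(ℕ; H¹(Ω))` to itself and intertwines the equations. -/
lemma act_meml2H1 (h : IntFactor b Γ Γ' B) (hu : Meml2H1 u) {v : ℕ → ℂ → ℂ}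
    (hv : ∀ n, ∀ z ∈ disc, v n z = (Γ z).act (fun m => u m z) n) :
    Meml2H1 v ∧ ∀ᵐ z ∂discMeasure, ∀ n, dbar (v n) z + del (v (n + 2)) z =
      (Γ z).act (fun m => dbar (u m) z + del (u (m + 2)) z) n + b z * v (n + 1) z := by
  have hu2 := hu.meml2L2
  have hp2 := hu.meml2L2_one
  have hq2 := hu.meml2L2_I
  have hvL : Meml2L2 v := (hu2.act h.continuousOn_self h.norm_le).congr fun n => by
    filter_upwards [ae_restrict_mem measurableSet_disc] with z hz using hv n z hz
  have congr_left : ∀ {e f f' g}, HasWeakPartial e f g → MemLp f' 2 discMeasure →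
      (∀ z ∈ disc, f' z = f z) → HasWeakPartial e f' g := fun {e f f' g} hfg hf' heq =>
    ⟨IntegrableOn.locallyIntegrableOn (hf'.integrable one_le_two), hfg.2.1, fun φ h1 h2 h3 => by
      rw [← hfg.2.2 φ h1 h2 h3]
      exact setIntegral_congr_fun measurableSet_disc fun z hz => by simp only [heq z hz]⟩
  have d1 : ∀ n, HasWeakPartial 1 (v n) _ := fun n =>
    congr_left (h.hasWeakPartial_act h.norm_le_one hu2 hp2 hu.hasWeakPartial_one n) (hvL.1 n) (hv n)
  have d2 : ∀ n, HasWeakPartial Complex.I (v n) _ := fun n =>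
    congr_left (h.hasWeakPartial_act h.norm_le_I hu2 hq2 hu.hasWeakPartial_I n) (hvL.1 n) (hv n)
  refine ⟨Meml2H1.of_hasWeakPartial hvL (h.meml2L2_deriv h.norm_le_one hu2 hp2)
    (h.meml2L2_deriv h.norm_le_I hu2 hq2) d1 d2, ?_⟩
  filter_upwards [ae_restrict_mem measurableSet_disc, hu2.ae_bounded, hp2.ae_bounded,
    hq2.ae_bounded, ae_all_iff.2 fun n => (d1 n).weakPartial_ae_eq,
    ae_all_iff.2 fun n => (d2 n).weakPartial_ae_eq] with z hz ⟨M, hM⟩ ⟨N, hN⟩ ⟨R, hR⟩ e1 e2 n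
  set U : ℕ → ℂ := fun m => u m z
  set P : ℕ → ℂ := fun m => weakPartial 1 (u m) z with hP
  set Q : ℕ → ℂ := fun m => weakPartial Complex.I (u m) z with hQ
  have hIQ : ∀ (c : ℂ) m, ‖c * Q m‖ ≤ ‖c‖ * R := fun c m => by
    rw [norm_mul]; gcongr; exact hR m
  have hsum : (Γ z).act (fun m => dbar (u m) z + del (u (m + 2)) z) n =
      (1 / 2) * ((Γ z).act P n + Complex.I * (Γ z).act Q n) +
        (1 / 2) * ((Γ z).act P (n + 2) - Complex.I * (Γ z).act Q (n + 2)) := by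
    have hfun : (fun m => dbar (u m) z + del (u (m + 2)) z) = fun m =>
        (1 / 2 : ℂ) * ((P m + Complex.I * Q m) + (P (m + 2) + (-Complex.I) * Q (m + 2))) :=
      funext fun m => by simp only [dbar, del, hP, hQ]; ring
    have hb1 : ∀ m, ‖P m + Complex.I * Q m‖ ≤ N + ‖Complex.I‖ * R := fun m =>
      (norm_add_le _ _).trans (add_le_add (hN m) (hIQ _ m))
    have hb2 : ∀ m, ‖P (m + 2) + (-Complex.I) * Q (m + 2)‖ ≤ N + ‖-Complex.I‖ * R := fun m =>
      (norm_add_le _ _).trans (add_le_add (hN _) (hIQ _ _))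
    rw [hfun, Wiener.act_const_mul, Wiener.act_add _ hb1 hb2, Wiener.act_add (c := P) _ hN (hIQ _),
      Wiener.act_add (c := fun m => P (m + 2)) _ (fun m => hN (m + 2)) (fun m => hIQ _ (m + 2)),
      Wiener.act_const_mul, Wiener.act_const_mul _ _ fun m => Q (m + 2), Wiener.act_shift _ P,
      Wiener.act_shift _ Q]
    ring
  -- The terms in which the derivative falls on Γ form (∂̄ + ξ²∂)Γ acting on u. The algebra identity
  -- replaces them by bξΓ, and ξ acts as the shift.
  have heqn := congrArg (fun x : Wiener => x.act U n) (h.eqn z hz)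
  rw [Wiener.add_act _ _ hM, Wiener.gen_mul_act _ hM, Wiener.gen_mul_act _ hM, Wiener.smul_act,
    Wiener.smul_act, Wiener.smul_act, Wiener.add_act _ _ hM, Wiener.sub_act _ _ hM,
    Wiener.smul_act, Wiener.smul_act, Wiener.gen_mul_act _ hM] at heqn
  rw [hsum, hv (n + 1) z hz, ← heqn, dbar, del, e1, e2, e1, e2]
  ring

end IntFactor

/-! ### From the abstract factor to e^{-G} and e^{G} -/

lemma convConverges_of_ae_bounded {γ c : ℕ → ℂ → ℂ} {Γ : ℂ → Wiener}
    (hγ : ∀ z ∈ disc, ∀ k, (Γ z).coeff k = γ k z)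
    (hc : ∀ᵐ z ∂discMeasure, ∃ M, ∀ n, ‖c n z‖ ≤ M) : ConvConverges γ c := fun n => by
  filter_upwards [hc, ae_restrict_mem measurableSet_disc] with z ⟨M, hM⟩ hz
  simpa only [iterate_shift, hγ z hz] using (Γ z).summable_act hM n

lemma conv_eq_act {γ c : ℕ → ℂ → ℂ} {x : Wiener} {z : ℂ} (hγ : ∀ k, x.coeff k = γ k z) (n : ℕ) :
    conv γ c n z = x.act (fun m => c m z) n := by
  simp only [conv, Wiener.act, iterate_shift, hγ]

/-- In (i) the right-hand side w is not assumed square summable. It is determined by u, and this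
pointwise bound is enough for e^{-G}w to converge. -/
lemma ae_bounded_source {u : ℕ → ℂ → ℂ} (hu : Meml2H1 u) (a : ℂ → ℂ) :
    ∀ᵐ z ∂discMeasure, ∃ M, ∀ n, ‖dbar (u n) z + del (u (n + 2)) z + a z * u (n + 1) z‖ ≤ M := by
  filter_upwards [hu.meml2L2.ae_bounded, hu.meml2L2_one.ae_bounded, hu.meml2L2_I.ae_bounded]
    with z ⟨M, hM⟩ ⟨N, hN⟩ ⟨R, hR⟩
  refine ⟨(N + R) + (N + R) + ‖a z‖ * M, fun n => ?_⟩
  have hd : ∀ x y : ℂ, ‖x‖ ≤ N → ‖y‖ ≤ R → ‖1 / 2 * (x + Complex.I * y)‖ ≤ N + R ∧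
      ‖1 / 2 * (x - Complex.I * y)‖ ≤ N + R := fun x y hx hy => by
    have h1 := norm_add_le x (Complex.I * y)
    have h2 := norm_sub_le x (Complex.I * y)
    rw [norm_mul, Complex.norm_I, one_mul] at h1 h2
    rw [norm_mul, norm_mul]
    norm_num
    constructor <;> linarith [norm_nonneg x, norm_nonneg y]
  refine (norm_add_le _ _).trans (add_le_add ((norm_add_le _ _).trans (add_le_add ?_ ?_)) ?_)
  · exact (hd _ _ (hN n) (hR n)).1
  · exact (hd _ _ (hN (n + 2)) (hR (n + 2))).2
  · rw [norm_mul]; gcongr; exact hM _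

section Equivalence

variable {μ : ℝ} {a : ℂ → ℂ} {u v w : ℕ → ℂ → ℂ}

lemma IsC1Holder.expNegG_solves (hμ : 1 / 2 < μ) (ha : IsC1Holder μ a) (hu : Meml2H1 u)
    (hw : SolvesAttenuated a u w) : ConvConverges (alpha a) u ∧ ConvConverges (alpha a) w ∧
      Meml2H1 (expNegG a u) ∧ SolvesBeltrami (expNegG a u) (expNegG a w) := by
  obtain ⟨ν, K, H⟩ := ha.exists_holderData hμ
  have hα : ∀ z ∈ disc, ∀ k, (expW a (-1) z).coeff k = alpha a k z :=
    fun z hz k => H.coeff_expW_neg_one hz k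
  obtain ⟨B, F⟩ := H.exists_intFactor (-1)
  have hw' : ∀ᵐ z ∂discMeasure, ∀ n,
      w n z = dbar (u n) z + del (u (n + 2)) z + a z * u (n + 1) z :=
    ae_all_iff.2 fun n => (hw n).mono fun z hz => by
      rw [← hz, iterate_shift (fun m => del (u m)) 2 n, shift]
  obtain ⟨h1, h2⟩ := F.act_meml2H1 hu (v := expNegG a u) fun n z hz => conv_eq_act (hα z hz) n
  refine ⟨convConverges_of_ae_bounded hα hu.meml2L2.ae_bounded,
    convConverges_of_ae_bounded hα ?_, h1, fun n => ?_⟩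
  · filter_upwards [hw', ae_bounded_source hu a] with z hz ⟨M, hM⟩
    exact ⟨M, fun n => by rw [hz]; exact hM n⟩
  -- With zero attenuation the bound concerns ∂̄u + L²∂u alone, which is needed to split the action
  -- on w additively.
  · filter_upwards [h2, hw', ae_bounded_source hu 0,
      hu.meml2L2.ae_bounded, ae_restrict_mem measurableSet_disc] with z e1 e2 ⟨M, hM⟩ ⟨N, hN⟩ hz
    simp only [Pi.zero_apply, zero_mul, add_zero] at hM
    have hb : ∀ m, ‖a z * u (m + 1) z‖ ≤ ‖a z‖ * N := fun m => by
      rw [norm_mul]; gcongr; exact hN _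
    rw [iterate_shift (fun m => del (expNegG a u m)) 2 n, e1 n, expNegG, expNegG,
      conv_eq_act (hα z hz), conv_eq_act (hα z hz), funext e2, Wiener.act_add _ hM hb,
      Wiener.act_const_mul, Wiener.act_shift _ fun m => u m z]
    ring

lemma IsC1Holder.expG_solves (hμ : 1 / 2 < μ) (ha : IsC1Holder μ a) (hv : Meml2H1 v)
    (hw : Meml2L2 w) (hs : SolvesBeltrami v (expNegG a w)) :
    ConvConverges (alpha a) w ∧ ConvConverges (beta a) v ∧
      Meml2H1 (expG a v) ∧ SolvesAttenuated a (expG a v) w := by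
  obtain ⟨ν, K, H⟩ := ha.exists_holderData hμ
  have hα : ∀ z ∈ disc, ∀ k, (expW a (-1) z).coeff k = alpha a k z :=
    fun z hz k => H.coeff_expW_neg_one hz k
  have hβ : ∀ z ∈ disc, ∀ k, (expW a 1 z).coeff k = beta a k z :=
    fun z hz k => H.coeff_expW_one hz k
  obtain ⟨B, F⟩ := H.exists_intFactor 1
  obtain ⟨h1, h2⟩ := F.act_meml2H1 hv (v := expG a v) fun n z hz => conv_eq_act (hβ z hz) n
  refine ⟨convConverges_of_ae_bounded hα hw.ae_bounded,
    convConverges_of_ae_bounded hβ hv.meml2L2.ae_bounded, h1, fun n => ?_⟩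
  filter_upwards [h2, ae_all_iff.2 hs, hw.ae_bounded, ae_restrict_mem measurableSet_disc]
    with z e1 e2 ⟨M, hM⟩ hz
  -- The source of v is e^{-h} acting on w, so e^{h} acting on it returns w by associativity of the
  -- action and e^{h}e^{-h} = 1.
  have e3 : (fun m => dbar (v m) z + del (v (m + 2)) z) =
      (expW a (-1) z).act fun m => w m z := funext fun m => by
    have := e2 m
    rw [iterate_shift (fun m => del (v m)) 2 m] at this
    rw [this, expNegG, conv_eq_act (hα z hz)]
  rw [iterate_shift (fun m => del (expG a v m)) 2 n, e1 n, e3, ← Wiener.mul_act _ _ hM,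
    expW_mul_expW_neg, Wiener.one_act, shift]
  ring

end Equivalence

end BukhgeimBeltrami

end

theorem lemma5p2 (μ : ℝ) (hμ : 1 / 2 < μ) (a : ℂ → ℂ)
    (ha : BukhgeimBeltrami.IsC1Holder μ a) :
    (∀ u w : ℕ → ℂ → ℂ,
      BukhgeimBeltrami.Meml2H1 u →
      BukhgeimBeltrami.SolvesAttenuated a u w →
        BukhgeimBeltrami.ConvConverges (BukhgeimBeltrami.alpha a) u ∧
        BukhgeimBeltrami.ConvConverges (BukhgeimBeltrami.alpha a) w ∧
        BukhgeimBeltrami.Meml2H1 (BukhgeimBeltrami.expNegG a u) ∧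
        BukhgeimBeltrami.SolvesBeltrami
          (BukhgeimBeltrami.expNegG a u) (BukhgeimBeltrami.expNegG a w)) ∧
    (∀ v w : ℕ → ℂ → ℂ,
      BukhgeimBeltrami.Meml2H1 v →
      BukhgeimBeltrami.Meml2L2 w →
      BukhgeimBeltrami.SolvesBeltrami v (BukhgeimBeltrami.expNegG a w) →
        BukhgeimBeltrami.ConvConverges (BukhgeimBeltrami.alpha a) w ∧
        BukhgeimBeltrami.ConvConverges (BukhgeimBeltrami.beta a) v ∧
        BukhgeimBeltrami.Meml2H1 (BukhgeimBeltrami.expG a v) ∧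
        BukhgeimBeltrami.SolvesAttenuated a (BukhgeimBeltrami.expG a v) w) := by
  exact ⟨fun u w hu hw => ha.expNegG_solves hμ hu hw,
    fun v w hv hw hs => ha.expG_solves hμ hv hw hs⟩
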